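/- **Model.** Let $k=k_n\in\mathbb N$ with $k=n^{\beta+o(1)}$. Let $u\in\{-1,0,1\}^n$ have i.i.d. entries equal to $\pm1$ with probability $k/(2n)$ each and $0$ otherwise; put $v=u$ if $k/2\le\|u\|_0\le 2k$ and $v=1_{[k]}$ (the indicator of the first $k$ coordinates) otherwise. Let $P$ be the law of $X=\mathrm{vec}(v^{\otimes3})\in\mathbb R^{N}$, $N=n^3$, and for $\lambda\ge 0$ observe $Y=\lambda X+Z$ with $Z\sim N(0,I_N)$ independent of $X$. The quenched Franz–Parisi potential is $$\mathcal F_\lambda(q)=-\mathbb E_{X\sim P,\,Z}\,\log\,\mathbb E_{X'\sim P}\Big[\mathbf 1\{\langle X,X'\rangle=q\}\,e^{-\|Y-\lambda X'\|_2^2/2}\Big]\in[0,\infty],\qquad Y=\lambda X+Z .$$ Let $\mathrm{MMSE}^{\le D}(\lambda)$ be the infimum of $\mathbb E\sum_{i\le N}(f_i(Y)-X_i)^2$ over real polynomials $f_i$ of degree at most $D$, and let $\mathrm{MMSE}^{\mathrm{trivial}}$ be the infimum of $\mathbb E\|X-b\|_2^2$ over constants $b\in\mathbb R^N$. **Theorem.**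 There are constants $c,C,\beta_0>0$ such that the following holds for every $\beta\in(0,\beta_0)$ and every sequence $k=n^{\beta+o(1)}$. 1. For all sufficiently large $n$, all $\lambda\ge0$ and all real $q\ge1$, the value $\mathcal F_\lambda(0)$ is finite and $$\mathcal F_\lambda(q)-\mathcal F_\lambda(0)\ \ge\ -\lambda^2q-Ck\log(n/k)+\frac{c\,\lambda\,k\,q^{1/3}}{\sqrt{\log n}} .$$ 2. Let $\epsilon\in(0,1)$ and $\lambda=\lambda_n>0$ with $\lambda=k^{\epsilon+o(1)}$. Then $\lambda\ge n^{\Omega(1)}$, and for every $D=\Theta(\log n)$ we have $\mathrm{MMSE}^{\le D}(\lambda)=o(\mathrm{MMSE}^{\mathrm{trivial}})$ (the low-degree easy regime). Nevertheless there is $\delta>0$ depending only on $\epsilon$ such that for every $d>3$ and all sufficiently large $n$: - for all $q$ with $C(\log n)^3\le q\le(\log n)^d$, $\ \mathcal F_\lambda(q)-\mathcal F_\lambda(0)\ge k^{1+\delta}>0$; - $\mathcal F_\lambda$ is finite at the overlaps $q=j^3\le(\log n)^d$, $j\in\{0,1,2,\dots\}$, and it is not non-increasing on the set of these overlaps; in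 particular it is not a decreasing function of $q\in[0,(\log n)^d]$. -/

import Mathlib

open MeasureTheory ProbabilityTheory Filter Topology Asymptotics
open scoped ENNReal

noncomputable section

/-- The law `N(0, I)` of the noise on `ℝ^ι`. -/
def stdGaussianNoise (ι : Type) [Fintype ι] : Measure (ι → ℝ) :=
  Measure.pi fun _ => gaussianReal 0 1

/-- The observation `Y = √snr • X + Z` of a Gaussian additive model with signal-to-noise ratio
`snr`, signal `X` and noise `Z`. -/
def gamObs {ι : Type} (snr : ℝ) (X Z : ι → ℝ) : ι → ℝ :=
  fun i => Real.sqrt snr * X i + Z i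

/-- `E_{X' ∼ μ} 1{⟨X, X'⟩ = q} exp (-‖Y - √snr X'‖² / 2)`, with the Euclidean norm. -/
def overlapPartition {ι : Type} [Fintype ι] (μ : Measure (ι → ℝ)) (snr q : ℝ)
    (X Y : ι → ℝ) : ℝ≥0∞ :=
  ∫⁻ X', Set.indicator {X' : ι → ℝ | ∑ i, X i * X' i = q}
    (fun X' => ENNReal.ofReal (Real.exp (-(∑ i, (Y i - Real.sqrt snr * X' i) ^ 2) / 2))) X' ∂μ

/-- The quenched Franz-Parisi potential at overlap `q` of the Gaussian additive model with prior
`μ` and signal-to-noise ratio `snr`,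
`- E_{X ∼ μ, Z ∼ N(0, I), Y = √snr X + Z} log E_{X' ∼ μ} 1{⟨X, X'⟩ = q} exp (-‖Y - √snr X'‖² / 2)`.
The argument of the logarithm is at most `1`, so minus its logarithm lies in `[0, ∞]` (it is `∞`
exactly when the argument is `0`) and its expectation is a well-defined element of `[0, ∞]`. -/
def quenchedFP {ι : Type} [Fintype ι] (μ : Measure (ι → ℝ)) (snr q : ℝ) : ℝ≥0∞ :=
  ∫⁻ X, ∫⁻ Z, (-(ENNReal.log (overlapPartition μ snr q X (gamObs snr X Z)))).toENNReal
    ∂(stdGaussianNoise ι) ∂μ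

/-- The degree-`D` minimum mean squared error: the infimum of `E ∑ i, (f i (Y) - X i)²` over real
polynomials `f i` of total degree at most `D` in the entries of `Y = √snr X + Z`. -/
def lowDegreeMMSE {ι : Type} [Fintype ι] (μ : Measure (ι → ℝ)) (snr : ℝ) (D : ℕ) : ℝ≥0∞ :=
  ⨅ f : ι → {p : MvPolynomial ι ℝ // p.totalDegree ≤ D},
    ∫⁻ X, ∫⁻ Z, ENNReal.ofReal
      (∑ i, (MvPolynomial.eval (gamObs snr X Z) (f i).1 - X i) ^ 2) ∂(stdGaussianNoise ι) ∂μ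

/-- The trivial mean squared error: the infimum of `E ‖b - X‖²` over constant estimators `b`,
that is, `E ‖X‖² - ‖E X‖²` for a square-integrable prior. -/
def trivialMMSE {ι : Type} [Fintype ι] (μ : Measure (ι → ℝ)) : ℝ≥0∞ :=
  ⨅ b : ι → ℝ, ∫⁻ X, ENNReal.ofReal (∑ i, (b i - X i) ^ 2) ∂μ

/-- The sparse Rademacher law `Rad(p)` on `ℝ`: the values `1` and `-1` with probability `p / 2`
each, and `0` with probability `1 - p`. -/
def sparseRademacher (p : ℝ) : Measure ℝ :=
  ENNReal.ofReal (p / 2) • Measure.dirac 1 + ENNReal.ofReal (p / 2) • Measure.dirac (-1) +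
    ENNReal.ofReal (1 - p) • Measure.dirac 0

/-- Truncation: keep `u` if its number of nonzero entries lies in `[k / 2, 2 k]`, and otherwise
replace it by the indicator vector of the first `k` coordinates. -/
def truncateSparse {n : ℕ} (k : ℕ) (u : Fin n → ℝ) : Fin n → ℝ :=
  if k ≤ 2 * hammingNorm u ∧ hammingNorm u ≤ 2 * k then u
  else fun i => if (i : ℕ) < k then 1 else 0

/-- The vectorized third tensor power of `v`. -/
def tensorCube {n : ℕ} (v : Fin n → ℝ) : Fin n × Fin n × Fin n → ℝ :=
  fun i => v i.1 * v i.2.1 * v i.2.2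

/-- The law of `v`: the truncation of a vector with i.i.d. `Rad(k / n)` entries. -/
def truncSparseVector (n k : ℕ) : Measure (Fin n → ℝ) :=
  (Measure.pi fun _ : Fin n => sparseRademacher ((k : ℝ) / n)).map (truncateSparse k)

/-- The prior of the truncated Rademacher sparse 3-tensor PCA model: the law of `vec(v^{⊗3})`. -/
def truncSparseTensorPrior (n k : ℕ) : Measure (Fin n × Fin n × Fin n → ℝ) :=
  (truncSparseVector n k).map tensorCube

/-- The quenched Franz-Parisi potential of the truncated sparse 3-tensor PCA model with
observation `Y = lam • vec(v^{⊗3}) + Z`, that is, with signal-to-noise ratio `lam ^ 2`. -/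
def tensorFP (n k : ℕ) (lam q : ℝ) : ℝ≥0∞ :=
  quenchedFP (truncSparseTensorPrior n k) (lam ^ 2) q

theorem measurable_truncateSparse {n : ℕ} (k : ℕ) :
    Measurable (truncateSparse k : (Fin n → ℝ) → Fin n → ℝ) := by
  have h : Measurable (fun u : Fin n → ℝ => hammingNorm u) := by
    have e : (fun u : Fin n → ℝ => hammingNorm u) =
        fun u => ∑ i, if u i ≠ 0 then 1 else 0 := by
      funext u
      simp [hammingNorm, Finset.card_filter]
    rw [e]
    refine Finset.measurable_sum _ fun i _ => ?_
    refine Measurable.ite ?_ measurable_const measurable_const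
    exact (measurableSet_singleton (0 : ℝ)).compl.preimage (measurable_pi_apply i)
  refine Measurable.ite ?_ measurable_id measurable_const
  exact (h (MeasurableSet.of_discrete (s := {m : ℕ | k ≤ 2 * m ∧ m ≤ 2 * k})))

theorem measurable_tensorCube {n : ℕ} :
    Measurable (tensorCube : (Fin n → ℝ) → Fin n × Fin n × Fin n → ℝ) := by
  unfold tensorCube
  fun_prop

/-- For `k ≤ n` the prior is a probability measure. -/
theorem isProbabilityMeasure_truncSparseTensorPrior {n k : ℕ} (hk : k ≤ n) :
    IsProbabilityMeasure (truncSparseTensorPrior n k) := by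
  have hp : (k : ℝ) / n ≤ 1 := div_le_one_of_le₀ (by exact_mod_cast hk) (by positivity)
  have hp0 : (0 : ℝ) ≤ (k : ℝ) / n := by positivity
  have h1 : IsProbabilityMeasure (sparseRademacher ((k : ℝ) / n)) := by
    constructor
    simp only [sparseRademacher, Measure.coe_add, Measure.coe_smul, Pi.add_apply, Pi.smul_apply,
      measure_univ, smul_eq_mul, mul_one]
    rw [← ENNReal.ofReal_add (by positivity) (by positivity),
      ← ENNReal.ofReal_add (by positivity) (by linarith)]
    simp
  have h2 : IsProbabilityMeasure (truncSparseVector n k) :=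
    Measure.isProbabilityMeasure_map (measurable_truncateSparse k).aemeasurable
  exact Measure.isProbabilityMeasure_map measurable_tensorCube.aemeasurable

end

/-! Since `⟨v^{⊗3}, w^{⊗3}⟩ = ⟨v, w⟩ ^ 3`, fixing the tensor overlap at `q = j ^ 3` fixes the vector
overlap at `j`. Expanding the square gives `F(j ^ 3) - F(0) = -lam ^ 2 * j ^ 3 + E log Z_0 - E log
Z_j`, where `Z_j` is the partition function of the pure noise energy `lam * ⟨Z, w^{⊗3}⟩`, plus a
deterministic term, over the sparse vectors `w` with `⟨v, w⟩ = j`. The task is to show that the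
restricted free energy drops by order `lam * k * √(log n)` per unit of overlap
(`integral_lse_overlapShell_le`).

The drop is a competition between a fixed site and a free one. Let `w` have `b` nonzero entries
besides the one at a site `i` of the support of `v`, and put `ρ = √(2 log n)`. If the entry at `i`
may be moved to the best of about `n` fresh sites, it feels the maximum of independent Gaussian
fields of variance `(b + 1) ^ 3 - b ^ 3 ≈ 3 * b ^ 2`, worth about `√3 * b * ρ`
(`integral_lse_site_relocate`). If it stays at `i`, the field there comes from the noise entries
with some but not all indices equal to `i`, and the rest of `w` can adapt to it. Its contribution is
bounded by scaling these mixed entries by `s` and letting `s` go from `1` to `0`. Gaussian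
integration by parts writes the derivative as `s` times a two-replica kernel, which is at most `3 /
b` times the kernel of the energy of the other entries, up to lower order (`mixed_kernel_le`).
Integration by parts in reverse turns this into `3 / b` times an average energy. That energy is at
most about `b ^ 2 * ρ`, because there are roughly `n ^ b` vectors and the variance is `b ^ 3`.
Integrating `s` over `[0, 1]` gives `(3 / 2) * b * ρ`. As `√3 > 3 / 2`, moving wins by a constant
fraction of `k * ρ`.

Two devices make this rigorous. Replicas that disagree at `i` are controlled by first amplifying the
single noise entry `(i, i, i)` by a factor `k`; by convexity this only increases the free energy,
and its cost `k * √(log k)` is small when `k` is a small power of `n`. Fresh sites are found by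
averaging over `k ^ 4` disjoint blocks: a sparse vector meets at most `2 * k` of them, so some block
can be forbidden at bounded cost (`exists_block_avoid`). Noise entries touching that block are then
independent of the Gibbs measure.

The sites of the support of `v` are eliminated one by one, each occupied site carrying a reward `lam
* g` that the margin pays for. A vector of overlap `j` occupies at least `j` of them, and after all
eliminations only vectors disjoint from `v` remain, which have overlap `0`. The prior changes this
by `O(k log (n / k))`.

For `lam = k ^ (ε + o(1))` with `ε < 1`, the linear term beats `lam ^ 2 * q` for polylogarithmic
`q`, and it beats the entropy once `q ^ (1 / 3)` exceeds a multiple of `log n`. Low-degree recovery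
is elementary: the entrywise odd power `(Y / lam) ^ d` of constant degree nearly fixes `0, 1, -1`
and suppresses the noise at the `n ^ 3` mostly zero entries. -/

noncomputable section

/-! ### Log-partition functions and Gibbs averages on finite sets -/

section Gibbs

variable {Ω Ω' : Type*}

/-- The log-partition function of the energies `X` on the finite set `A`. -/
def lse (A : Finset Ω) (X : Ω → ℝ) : ℝ := Real.log (∑ a ∈ A, Real.exp (X a))

/-- The average of `f` under the Gibbs measure on `A` with energies `X`. -/
def gibbs (A : Finset Ω) (X f : Ω → ℝ) : ℝ :=
  (∑ a ∈ A, Real.exp (X a) * f a) / ∑ a ∈ A, Real.exp (X a)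

theorem partition_pos {A : Finset Ω} (hA : A.Nonempty) (X : Ω → ℝ) :
    0 < ∑ a ∈ A, Real.exp (X a) :=
  Finset.sum_pos (fun _ _ => Real.exp_pos _) hA

theorem exp_lse {A : Finset Ω} (hA : A.Nonempty) (X : Ω → ℝ) :
    Real.exp (lse A X) = ∑ a ∈ A, Real.exp (X a) :=
  Real.exp_log (partition_pos hA X)

theorem gibbs_add (A : Finset Ω) (X f g : Ω → ℝ) :
    gibbs A X (fun a => f a + g a) = gibbs A X f + gibbs A X g := by
  simp only [gibbs, mul_add, Finset.sum_add_distrib, add_div]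

theorem gibbs_sub (A : Finset Ω) (X f g : Ω → ℝ) :
    gibbs A X (fun a => f a - g a) = gibbs A X f - gibbs A X g := by
  simp only [gibbs, mul_sub, Finset.sum_sub_distrib, sub_div]

theorem gibbs_const_mul (A : Finset Ω) (X f : Ω → ℝ) (r : ℝ) :
    gibbs A X (fun a => r * f a) = r * gibbs A X f := by
  simp only [gibbs, mul_left_comm _ r, ← Finset.mul_sum, mul_div_assoc]

theorem gibbs_mul_const (A : Finset Ω) (X f : Ω → ℝ) (r : ℝ) :
    gibbs A X (fun a => f a * r) = gibbs A X f * r := by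
  simp only [mul_comm _ r, gibbs_const_mul]

theorem gibbs_sum {κ : Type*} (s : Finset κ) (A : Finset Ω) (X : Ω → ℝ) (f : κ → Ω → ℝ) :
    gibbs A X (fun a => ∑ t ∈ s, f t a) = ∑ t ∈ s, gibbs A X (f t) := by
  simp only [gibbs, Finset.mul_sum, ← Finset.sum_div]
  rw [Finset.sum_comm]

theorem gibbs_congr {A : Finset Ω} (X : Ω → ℝ) {f g : Ω → ℝ} (h : ∀ a ∈ A, f a = g a) :
    gibbs A X f = gibbs A X g := by
  unfold gibbs
  rw [Finset.sum_congr rfl fun a ha => by rw [h a ha]]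

theorem gibbs_mono {A : Finset Ω} (X : Ω → ℝ) {f g : Ω → ℝ} (h : ∀ a ∈ A, f a ≤ g a) :
    gibbs A X f ≤ gibbs A X g := by
  unfold gibbs
  have : 0 ≤ ∑ a ∈ A, Real.exp (X a) := Finset.sum_nonneg fun _ _ => (Real.exp_pos _).le
  gcongr with a ha
  exact h a ha

theorem gibbs_const {A : Finset Ω} (hA : A.Nonempty) (X : Ω → ℝ) (r : ℝ) :
    gibbs A X (fun _ => r) = r := by
  unfold gibbs
  rw [← Finset.sum_mul, mul_div_assoc, mul_div_cancel₀]
  exact (partition_pos hA X).ne'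

theorem gibbs_nonneg {A : Finset Ω} (X : Ω → ℝ) {f : Ω → ℝ} (h : ∀ a ∈ A, 0 ≤ f a) :
    0 ≤ gibbs A X f :=
  div_nonneg (Finset.sum_nonneg fun a ha => mul_nonneg (Real.exp_pos _).le (h a ha))
    (Finset.sum_nonneg fun _ _ => (Real.exp_pos _).le)

theorem gibbs_le_of_le {A : Finset Ω} (hA : A.Nonempty) (X : Ω → ℝ) {f : Ω → ℝ} {r : ℝ}
    (h : ∀ a ∈ A, f a ≤ r) : gibbs A X f ≤ r :=
  (gibbs_mono X h).trans_eq (gibbs_const hA X r)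

theorem gibbs_le_sum {A : Finset Ω} (X : Ω → ℝ) {f : Ω → ℝ} (h : ∀ a ∈ A, 0 ≤ f a) :
    gibbs A X f ≤ ∑ a ∈ A, f a := by
  rcases A.eq_empty_or_nonempty with rfl | hA
  · simp [gibbs]
  · exact gibbs_le_of_le hA X fun a ha => Finset.single_le_sum h ha

theorem abs_gibbs_le (A : Finset Ω) (X f : Ω → ℝ) :
    |gibbs A X f| ≤ ∑ a ∈ A, |f a| := by
  refine abs_le.2 ⟨?_, ?_⟩
  · have h1 : gibbs A X (fun a => -1 * f a) ≤ gibbs A X (fun a => |f a|) :=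
      gibbs_mono X fun a _ => by simpa using neg_le_abs (f a)
    have h2 := gibbs_le_sum (A := A) X (f := fun a => |f a|) fun a _ => abs_nonneg _
    rw [gibbs_const_mul] at h1
    linarith
  · exact (gibbs_mono X fun a _ => le_abs_self (f a)).trans
      (gibbs_le_sum X fun a _ => abs_nonneg _)

/-- The log-partition function lies above its tangents. -/
theorem lse_add_gibbs_le {A : Finset Ω} (hA : A.Nonempty) (X X' : Ω → ℝ) :
    lse A X + gibbs A X (fun a => X' a - X a) ≤ lse A X' := by
  set m := gibbs A X (fun a => X' a - X a) with hm
  have hpos := partition_pos hA X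
  have key : Real.exp (lse A X + m) ≤ ∑ a ∈ A, Real.exp (X' a) := by
    rw [Real.exp_add, exp_lse hA]
    -- Jensen's inequality by hand: `exp` is replaced by its tangent at the mean increment `m`,
    -- whose linear term averages to zero.
    have h1 : ∀ a ∈ A, Real.exp (X a) * (Real.exp m * (1 + (X' a - X a) - m)) ≤
        Real.exp (X' a) := fun a _ => by
      have : Real.exp (X' a) = Real.exp (X a) * (Real.exp m * Real.exp (X' a - X a - m)) := by
        rw [← Real.exp_add, ← Real.exp_add]; congr 1; ring
      rw [this]
      gcongr
      have := Real.add_one_le_exp (X' a - X a - m)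
      linarith
    refine le_trans (le_of_eq ?_) (Finset.sum_le_sum h1)
    have h2 : ∑ a ∈ A, Real.exp (X a) * (X' a - X a) = m * ∑ a ∈ A, Real.exp (X a) := by
      rw [hm, gibbs, div_mul_cancel₀ _ hpos.ne']
    have h3 : ∀ a ∈ A, Real.exp (X a) * (Real.exp m * (1 + (X' a - X a) - m)) =
        Real.exp m * (1 - m) * Real.exp (X a) + Real.exp m * (Real.exp (X a) * (X' a - X a)) :=
      fun a _ => by ring
    rw [Finset.sum_congr rfl h3, Finset.sum_add_distrib, ← Finset.mul_sum, ← Finset.mul_sum, h2]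
    ring
  rw [lse.eq_1 A X', Real.le_log_iff_exp_le (partition_pos hA X')]
  exact key

theorem lse_mono {A : Finset Ω} (hA : A.Nonempty) {X X' : Ω → ℝ} (h : ∀ a ∈ A, X a ≤ X' a) :
    lse A X ≤ lse A X' :=
  Real.log_le_log (partition_pos hA X) (Finset.sum_le_sum fun a ha => Real.exp_le_exp.2 (h a ha))

theorem lse_mono_set {A B : Finset Ω} (hA : A.Nonempty) (h : A ⊆ B) (X : Ω → ℝ) :
    lse A X ≤ lse B X :=
  Real.log_le_log (partition_pos hA X)
    (Finset.sum_le_sum_of_subset_of_nonneg h fun _ _ _ => (Real.exp_pos _).le)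

/-- By injectivity distinct configurations keep distinct images, so rearranging configurations loses
no entropy. The rearrangement of interest moves one nonzero entry to a better site. -/
theorem lse_comp_le {A : Finset Ω} {B : Finset Ω'} (hA : A.Nonempty) {T : Ω → Ω'}
    (hT : ∀ a ∈ A, T a ∈ B) (hinj : Set.InjOn T A) (X : Ω' → ℝ) :
    lse A (fun a => X (T a)) ≤ lse B X := by
  classical
  refine Real.log_le_log (partition_pos hA _) ?_
  rw [← Finset.sum_image (g := T) (f := fun b => Real.exp (X b)) hinj]
  refine Finset.sum_le_sum_of_subset_of_nonneg ?_ fun _ _ _ => (Real.exp_pos _).le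
  intro b hb
  obtain ⟨a, ha, rfl⟩ := Finset.mem_image.1 hb
  exact hT a ha

theorem le_lse {A : Finset Ω} (X : Ω → ℝ) {a : Ω} (ha : a ∈ A) : X a ≤ lse A X := by
  rw [lse, Real.le_log_iff_exp_le (partition_pos ⟨a, ha⟩ X)]
  exact Finset.single_le_sum (f := fun a => Real.exp (X a)) (fun _ _ => (Real.exp_pos _).le) ha

theorem lse_le {A : Finset Ω} (hA : A.Nonempty) (X : Ω → ℝ) {r : ℝ} (h : ∀ a ∈ A, X a ≤ r) :
    lse A X ≤ Real.log A.card + r := by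
  have : lse A X ≤ lse A fun _ => r := lse_mono hA h
  refine this.trans_eq ?_
  rw [lse, Finset.sum_const, nsmul_eq_mul, Real.log_mul (by simpa using hA.ne_empty)
    (Real.exp_pos _).ne', Real.log_exp]

theorem lse_add_const {A : Finset Ω} (hA : A.Nonempty) (X : Ω → ℝ) (r : ℝ) :
    lse A (fun a => X a + r) = lse A X + r := by
  simp only [lse, Real.exp_add, ← Finset.sum_mul]
  rw [Real.log_mul (partition_pos hA X).ne' (Real.exp_pos _).ne', Real.log_exp]

theorem abs_lse_le {A : Finset Ω} (hA : A.Nonempty) (X : Ω → ℝ) :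
    |lse A X| ≤ Real.log A.card + ∑ a ∈ A, |X a| := by
  obtain ⟨a₀, ha₀⟩ := hA
  have hcard : 0 ≤ Real.log A.card := Real.log_natCast_nonneg _
  have h1 : ∀ a ∈ A, |X a| ≤ ∑ a ∈ A, |X a| := fun a ha =>
    Finset.single_le_sum (f := fun a => |X a|) (fun _ _ => abs_nonneg _) ha
  refine abs_le.2 ⟨?_, lse_le ⟨a₀, ha₀⟩ X fun a ha => (le_abs_self _).trans (h1 a ha)⟩
  have := le_lse X ha₀
  have := neg_abs_le (X a₀)
  have := h1 a₀ ha₀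
  linarith

theorem hasDerivAt_gibbs {A : Finset Ω} (hA : A.Nonempty) (h y f : Ω → ℝ) (t : ℝ) :
    HasDerivAt (fun t => gibbs A (fun a => h a + t * y a) f)
      (gibbs A (fun a => h a + t * y a) (fun a => f a * y a) -
        gibbs A (fun a => h a + t * y a) f * gibbs A (fun a => h a + t * y a) y) t := by
  have hexp : ∀ a, HasDerivAt (fun t => Real.exp (h a + t * y a))
      (Real.exp (h a + t * y a) * y a) t := fun a => by
    have : HasDerivAt (fun t : ℝ => h a + t * y a) (y a) t := by
      simpa using ((hasDerivAt_id t).mul_const (y a)).const_add (h a)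
    exact this.exp
  have hnum : HasDerivAt (fun t => ∑ a ∈ A, Real.exp (h a + t * y a) * f a)
      (∑ a ∈ A, Real.exp (h a + t * y a) * y a * f a) t :=
    HasDerivAt.fun_sum fun a _ => (hexp a).mul_const _
  have hden : HasDerivAt (fun t => ∑ a ∈ A, Real.exp (h a + t * y a))
      (∑ a ∈ A, Real.exp (h a + t * y a) * y a) t :=
    HasDerivAt.fun_sum fun a _ => hexp a
  have hne := (partition_pos hA fun a => h a + t * y a).ne'
  have := hnum.div hden hne
  refine this.congr_deriv ?_
  unfold gibbs
  have e : ∀ a, Real.exp (h a + t * y a) * (f a * y a) = Real.exp (h a + t * y a) * y a * f a :=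
    fun a => by ring
  simp only [e]
  field_simp

end Gibbs

/-! ### Gaussian integration by parts on the line and resampling of one coordinate -/

section Stein

/-- Gaussian integration by parts on the line. -/
theorem integral_mul_gaussianReal_eq_deriv {φ φ' : ℝ → ℝ} (hφ : ∀ t, HasDerivAt φ (φ' t) t)
    (hm : Measurable φ') {B B' : ℝ} (hB : ∀ t, |φ t| ≤ B) (hB' : ∀ t, |φ' t| ≤ B') :
    ∫ t, t * φ t ∂(gaussianReal 0 1) = ∫ t, φ' t ∂(gaussianReal 0 1) := by
  have hφc : Continuous φ := continuous_iff_continuousAt.2 fun t => (hφ t).continuousAt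
  rw [integral_gaussianReal_eq_integral_smul one_ne_zero,
    integral_gaussianReal_eq_integral_smul one_ne_zero]
  simp only [smul_eq_mul]
  set p := gaussianPDFReal 0 1 with hp
  have hpint : Integrable p := integrable_gaussianPDFReal 0 1
  have hpd : ∀ t, HasDerivAt p (-t * p t) t := fun t => by
    have h1 : HasDerivAt (fun t : ℝ => -(t ^ 2) / 2) (-t) t := by
      have := (((hasDerivAt_id t).pow 2).neg).div_const 2
      refine this.congr_deriv ?_
      simp; ring
    have h2 := (h1.exp).const_mul ((√(2 * Real.pi))⁻¹)
    have h3 : p = fun t => (√(2 * Real.pi))⁻¹ * Real.exp (-(t ^ 2) / 2) := by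
      funext t; simp [hp, gaussianPDFReal]
    rw [h3]
    refine h2.congr_deriv ?_
    ring
  have htp : Integrable fun t => t * p t := by
    have h : Integrable (fun t : ℝ => t) (gaussianReal 0 1) :=
      (memLp_id_gaussianReal (μ := 0) (v := 1) 1).integrable le_rfl
    rw [gaussianReal_of_var_ne_zero 0 one_ne_zero] at h
    rw [integrable_withDensity_iff (measurable_gaussianPDF 0 1)
      (ae_of_all _ fun _ => gaussianPDF_lt_top)] at h
    simpa [toReal_gaussianPDF, hp] using h
  have hi1 : Integrable (φ * fun t => -t * p t) := by
    have htp' : Integrable fun t => -t * p t := by simpa [neg_mul] using htp.neg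
    exact htp'.bdd_mul (c := B) hφc.aestronglyMeasurable
      (ae_of_all _ fun t => by simpa using hB t)
  have hi2 : Integrable (φ' * p) :=
    hpint.bdd_mul (c := B') hm.aestronglyMeasurable (ae_of_all _ fun t => by simpa using hB' t)
  have hi3 : Integrable (φ * p) :=
    hpint.bdd_mul (c := B) hφc.aestronglyMeasurable (ae_of_all _ fun t => by simpa using hB t)
  have := integral_mul_deriv_eq_deriv_mul_of_integrable (u := φ) (v := p)
    (fun t _ => hφ t) (fun t _ => hpd t) hi1 hi2 hi3
  have e1 : ∫ t, p t * (t * φ t) = -∫ t, φ t * (-t * p t) := by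
    rw [← integral_neg]; congr 1; funext t; ring
  rw [e1, this, neg_neg]
  congr 1; funext t; ring

variable {ι : Type} [Fintype ι]

instance : IsProbabilityMeasure (stdGaussianNoise ι) := by
  unfold stdGaussianNoise; infer_instance

/-- Resampling one coordinate preserves the product measure. -/
theorem measurePreserving_update [DecidableEq ι] (τ : ι) :
    MeasurePreserving (fun p : (ι → ℝ) × ℝ => Function.update p.1 τ p.2)
      ((stdGaussianNoise ι).prod (gaussianReal 0 1)) (stdGaussianNoise ι) := by
  have hmeas : Measurable (fun p : (ι → ℝ) × ℝ => Function.update p.1 τ p.2) := by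
    refine measurable_pi_lambda _ fun i => ?_
    by_cases h : i = τ
    · subst h; simpa using measurable_snd
    · simp only [Function.update_of_ne h]
      exact (measurable_pi_apply i).comp measurable_fst
  refine ⟨hmeas, ?_⟩
  symm
  refine Measure.pi_eq fun s hs => ?_
  rw [Measure.map_apply hmeas (MeasurableSet.univ_pi hs)]
  have : (fun p : (ι → ℝ) × ℝ => Function.update p.1 τ p.2) ⁻¹' Set.univ.pi s =
      (Set.univ.pi (Function.update s τ Set.univ)) ×ˢ s τ := by
    ext ⟨Z, t⟩
    simp only [Set.mem_preimage, Set.mem_pi, Set.mem_univ, true_implies, Set.mem_prod]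
    constructor
    · intro h
      refine ⟨fun i => ?_, by simpa using h τ⟩
      by_cases hi : i = τ
      · subst hi; simp
      · simpa [Function.update_of_ne hi] using h i
    · rintro ⟨h1, h2⟩ i
      by_cases hi : i = τ
      · subst hi; simpa using h2
      · simpa [Function.update_of_ne hi] using h1 i
  rw [this, Measure.prod_prod, stdGaussianNoise, Measure.pi_pi]
  rw [← Finset.mul_prod_erase _ _ (Finset.mem_univ τ), ← Finset.mul_prod_erase _ _
    (Finset.mem_univ τ)]
  simp only [Function.update_self, measure_univ, one_mul]
  rw [mul_comm]
  congr 1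
  refine Finset.prod_congr rfl fun i hi => ?_
  rw [Function.update_of_ne (Finset.ne_of_mem_erase hi)]

end Stein

/-! ### Gaussian Hamiltonians and integration by parts for Gibbs averages -/

section Hamiltonian

variable {Ω : Type*} {ι : Type} [Fintype ι]

/-- A Gaussian Hamiltonian: the energy of `a` is linear in the noise with coefficients `x a`, plus
a deterministic term. -/
def ham (x : Ω → ι → ℝ) (c : Ω → ℝ) (Z : ι → ℝ) (a : Ω) : ℝ := ∑ τ, Z τ * x a τ + c a

theorem integrable_coord (τ : ι) : Integrable (fun Z : ι → ℝ => Z τ) (stdGaussianNoise ι) := by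
  have h : Integrable (fun t : ℝ => t) (gaussianReal 0 1) :=
    (memLp_id_gaussianReal (μ := 0) (v := 1) 1).integrable le_rfl
  exact (measurePreserving_eval (fun _ : ι => gaussianReal 0 1) τ).integrable_comp_of_integrable h

theorem integral_coord (τ : ι) : ∫ Z : ι → ℝ, Z τ ∂(stdGaussianNoise ι) = 0 := by
  have := (measurePreserving_eval (fun _ : ι => gaussianReal 0 1) τ).map_eq
  have h2 : ∫ t, t ∂((Measure.pi fun _ : ι => gaussianReal 0 1).map (Function.eval τ)) =
      ∫ Z : ι → ℝ, Z τ ∂(stdGaussianNoise ι) :=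
    integral_map (measurable_pi_apply τ).aemeasurable aestronglyMeasurable_id
  rw [← h2, this, integral_id_gaussianReal]

theorem continuous_ham (x : Ω → ι → ℝ) (c : Ω → ℝ) (a : Ω) :
    Continuous fun Z => ham x c Z a := by
  unfold ham; fun_prop

theorem integrable_ham (x : Ω → ι → ℝ) (c : Ω → ℝ) (a : Ω) :
    Integrable (fun Z => ham x c Z a) (stdGaussianNoise ι) :=
  (integrable_finsetSum _ fun τ _ => (integrable_coord τ).mul_const _).add (integrable_const _)

theorem continuous_gibbs_ham {A : Finset Ω} (hA : A.Nonempty) (x : Ω → ι → ℝ) (c : Ω → ℝ)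
    {f : (ι → ℝ) → Ω → ℝ} (hf : ∀ a, Continuous fun Z => f Z a) :
    Continuous fun Z => gibbs A (ham x c Z) (f Z) := by
  unfold gibbs
  refine Continuous.div ?_ ?_ fun Z => (partition_pos hA _).ne'
  · exact continuous_finsetSum _ fun a _ => (continuous_ham x c a).rexp.mul (hf a)
  · exact continuous_finsetSum _ fun a _ => (continuous_ham x c a).rexp

theorem measurable_gibbs_ham {A : Finset Ω} (x : Ω → ι → ℝ) (c : Ω → ℝ)
    {f : (ι → ℝ) → Ω → ℝ} (hf : ∀ a, Measurable fun Z => f Z a) :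
    Measurable fun Z => gibbs A (ham x c Z) (f Z) := by
  unfold gibbs
  refine Measurable.div ?_ ?_
  · exact Finset.measurable_sum _ fun a _ => (continuous_ham x c a).rexp.measurable.mul (hf a)
  · exact Finset.measurable_sum _ fun a _ => (continuous_ham x c a).rexp.measurable

theorem integrable_gibbs_ham {A : Finset Ω} (x : Ω → ι → ℝ) (c : Ω → ℝ)
    {f : (ι → ℝ) → Ω → ℝ} (hf : ∀ a, Measurable fun Z => f Z a)
    (hi : ∀ a, Integrable (fun Z => f Z a) (stdGaussianNoise ι)) :
    Integrable (fun Z => gibbs A (ham x c Z) (f Z)) (stdGaussianNoise ι) := by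
  refine Integrable.mono' (integrable_finsetSum A fun a _ => (hi a).abs)
    (measurable_gibbs_ham x c hf).aestronglyMeasurable (ae_of_all _ fun Z => ?_)
  simpa using abs_gibbs_le A (ham x c Z) (f Z)

theorem integrable_lse_ham {A : Finset Ω} (hA : A.Nonempty) (x : Ω → ι → ℝ) (c : Ω → ℝ) :
    Integrable (fun Z => lse A (ham x c Z)) (stdGaussianNoise ι) := by
  have hc : Continuous fun Z => lse A (ham x c Z) := by
    unfold lse
    refine Continuous.log ?_ fun Z => (partition_pos hA _).ne'
    exact continuous_finsetSum _ fun a _ => (continuous_ham x c a).rexp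
  refine Integrable.mono' ((integrable_const (Real.log A.card)).add
    (integrable_finsetSum A fun a _ => (integrable_ham x c a).abs))
    hc.aestronglyMeasurable (ae_of_all _ fun Z => ?_)
  simpa using abs_lse_le hA (ham x c Z)

/-- Gaussian integration by parts in one coordinate for Gibbs averages. -/
theorem integral_coord_mul_gibbs {A : Finset Ω} (hA : A.Nonempty) (x : Ω → ι → ℝ) (c : Ω → ℝ)
    (τ : ι) (f : Ω → ℝ) :
    ∫ Z, Z τ * gibbs A (ham x c Z) f ∂(stdGaussianNoise ι) =
      ∫ Z, (gibbs A (ham x c Z) (fun a => f a * x a τ) -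
        gibbs A (ham x c Z) f * gibbs A (ham x c Z) (fun a => x a τ)) ∂(stdGaussianNoise ι) := by
  classical
  have hmp := measurePreserving_update τ
  set F : (ι → ℝ) → ℝ := fun Z => Z τ * gibbs A (ham x c Z) f with hF
  set G : (ι → ℝ) → ℝ := fun Z => gibbs A (ham x c Z) (fun a => f a * x a τ) -
        gibbs A (ham x c Z) f * gibbs A (ham x c Z) (fun a => x a τ) with hG
  have hgc : ∀ g : Ω → ℝ, Continuous fun Z => gibbs A (ham x c Z) g := fun g =>
    continuous_gibbs_ham hA x c fun a => continuous_const
  have hFc : Continuous F := (continuous_apply τ).mul (hgc f)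
  have hGc : Continuous G := (hgc _).sub ((hgc _).mul (hgc _))
  have hFi : Integrable F (stdGaussianNoise ι) :=
    (integrable_coord τ).mul_bdd (c := ∑ a ∈ A, |f a|) (hgc f).aestronglyMeasurable
      (ae_of_all _ fun Z => by simpa using abs_gibbs_le A (ham x c Z) f)
  set B' := (∑ a ∈ A, |f a * x a τ|) + (∑ a ∈ A, |f a|) * ∑ a ∈ A, |x a τ| with hB'
  have hGb : ∀ Z, |G Z| ≤ B' := fun Z => by
    have h1 := abs_gibbs_le A (ham x c Z) (fun a => f a * x a τ)
    have h2 := abs_gibbs_le A (ham x c Z) f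
    have h3 := abs_gibbs_le A (ham x c Z) (fun a => x a τ)
    refine (abs_sub _ _).trans (add_le_add h1 ?_)
    rw [abs_mul]
    gcongr
  have hGi : Integrable G (stdGaussianNoise ι) :=
    Integrable.mono' (integrable_const B') hGc.aestronglyMeasurable
      (ae_of_all _ fun Z => by simpa using hGb Z)
  -- Resampling the coordinate `τ` by an independent Gaussian reduces the identity to one variable,
  -- with the other coordinates frozen.
  rw [← hmp.map_eq, integral_map hmp.measurable.aemeasurable hFc.aestronglyMeasurable,
    integral_map hmp.measurable.aemeasurable hGc.aestronglyMeasurable,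
    integral_prod (fun p => F (Function.update p.1 τ p.2)) (hmp.integrable_comp_of_integrable hFi),
    integral_prod (fun p => G (Function.update p.1 τ p.2)) (hmp.integrable_comp_of_integrable hGi)]
  congr 1
  funext Z
  -- The energies are affine in the resampled coordinate, with slope `x a τ`.
  obtain ⟨h₀, hham⟩ : ∃ h₀ : Ω → ℝ, ∀ t, ham x c (Function.update Z τ t) =
      fun a => h₀ a + t * x a τ := by
    refine ⟨ham x c (Function.update Z τ 0), fun t => ?_⟩
    funext a
    unfold ham
    rw [← Finset.add_sum_erase _ _ (Finset.mem_univ τ),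
      ← Finset.add_sum_erase (f := fun i => Function.update Z τ 0 i * x a i) _
        (Finset.mem_univ τ)]
    have : ∀ i ∈ Finset.univ.erase τ, Function.update Z τ t i * x a i =
        Function.update Z τ 0 i * x a i := fun i hi => by
      rw [Function.update_of_ne (Finset.ne_of_mem_erase hi),
        Function.update_of_ne (Finset.ne_of_mem_erase hi)]
    rw [Finset.sum_congr rfl this]
    simp
    ring
  have hupd : Continuous fun t : ℝ => Function.update Z τ t := continuous_const.update τ continuous_id
  have := integral_mul_gaussianReal_eq_deriv (φ := fun t => gibbs A (ham x c (Function.update Z τ t)) f)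
    (φ' := fun t => G (Function.update Z τ t)) (fun t => ?_)
    (hGc.comp hupd).measurable (fun t => abs_gibbs_le A _ f) (fun t => hGb _)
  · simpa [hF] using this
  · have := hasDerivAt_gibbs hA h₀ (fun a => x a τ) f t
    simp only [hG, hham]
    exact this

/-- The Gibbs average of a function of two independent replicas. -/
def gibbs₂ (A : Finset Ω) (X : Ω → ℝ) (F : Ω → Ω → ℝ) : ℝ :=
  gibbs A X fun a => gibbs A X fun b => F a b

theorem gibbs₂_mono {A : Finset Ω} (X : Ω → ℝ) {F G : Ω → Ω → ℝ}
    (h : ∀ a ∈ A, ∀ b ∈ A, F a b ≤ G a b) : gibbs₂ A X F ≤ gibbs₂ A X G :=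
  gibbs_mono X fun a ha => gibbs_mono X fun b hb => h a ha b hb

theorem integrable_gibbs₂_ham {A : Finset Ω} (x : Ω → ι → ℝ) (c : Ω → ℝ) (F : Ω → Ω → ℝ) :
    Integrable (fun Z => gibbs₂ A (ham x c Z) F) (stdGaussianNoise ι) := by
  have hm : ∀ a, Measurable fun Z => gibbs A (ham x c Z) (fun b => F a b) := fun a =>
    measurable_gibbs_ham x c fun b => measurable_const
  refine integrable_gibbs_ham x c hm fun a => integrable_gibbs_ham x c (fun b => measurable_const)
    fun b => integrable_const _

/-- Gaussian integration by parts for Gibbs averages of linear forms in the noise. -/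
theorem integral_gibbs_linear {A : Finset Ω} (hA : A.Nonempty) (x : Ω → ι → ℝ) (c : Ω → ℝ)
    (y : Ω → ι → ℝ) :
    ∫ Z, gibbs A (ham x c Z) (fun a => ∑ τ, Z τ * y a τ) ∂(stdGaussianNoise ι) =
      ∫ Z, gibbs₂ A (ham x c Z) (fun a b => ∑ τ, y a τ * (x a τ - x b τ))
        ∂(stdGaussianNoise ι) := by
  have hint : ∀ f : Ω → ℝ, Integrable (fun Z => gibbs A (ham x c Z) f) (stdGaussianNoise ι) :=
    fun f => integrable_gibbs_ham x c (fun a => measurable_const) fun a => integrable_const _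
  have h1 : ∀ Z, gibbs A (ham x c Z) (fun a => ∑ τ, Z τ * y a τ) =
      ∑ τ, Z τ * gibbs A (ham x c Z) (fun a => y a τ) := fun Z => by
    rw [gibbs_sum]
    exact Finset.sum_congr rfl fun τ _ => gibbs_const_mul _ _ _ _
  -- The second replica linearizes the product of Gibbs averages in the covariance produced
  -- coordinate by coordinate.
  have h2 : ∀ Z, gibbs₂ A (ham x c Z) (fun a b => ∑ τ, y a τ * (x a τ - x b τ)) =
      ∑ τ, (gibbs A (ham x c Z) (fun a => y a τ * x a τ) -
        gibbs A (ham x c Z) (fun a => y a τ) * gibbs A (ham x c Z) (fun a => x a τ)) := fun Z => by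
    unfold gibbs₂
    simp_rw [gibbs_sum, gibbs_const_mul, gibbs_sub, gibbs_const hA, mul_sub, gibbs_sub,
      gibbs_mul_const]
  simp_rw [h1, h2]
  rw [integral_finsetSum, integral_finsetSum]
  · exact Finset.sum_congr rfl fun τ _ => integral_coord_mul_gibbs hA x c τ _
  · intro τ _
    refine (hint _).sub ?_
    exact (hint _).mul_bdd (c := ∑ a ∈ A, |x a τ|) (hint _).aestronglyMeasurable
      (ae_of_all _ fun Z => by simpa using abs_gibbs_le A (ham x c Z) (fun a => x a τ))
  · intro τ _
    exact (integrable_coord τ).mul_bdd (c := ∑ a ∈ A, |y a τ|) (hint _).aestronglyMeasurable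
      (ae_of_all _ fun Z => by simpa using abs_gibbs_le A (ham x c Z) (fun a => y a τ))

end Hamiltonian

/-! ### Gaussian linear forms: overshoots, maxima, independence -/

section LinearForms

variable {ι : Type} [Fintype ι]

theorem integrable_linear (y : ι → ℝ) :
    Integrable (fun Z : ι → ℝ => ∑ τ, Z τ * y τ) (stdGaussianNoise ι) :=
  integrable_finsetSum _ fun τ _ => (integrable_coord τ).mul_const _

theorem integral_linear (y : ι → ℝ) :
    ∫ Z : ι → ℝ, ∑ τ, Z τ * y τ ∂(stdGaussianNoise ι) = 0 := by
  rw [integral_finsetSum _ fun τ _ => (integrable_coord τ).mul_const _]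
  simp [integral_mul_const, integral_coord]

theorem integrable_exp_linear (y : ι → ℝ) :
    Integrable (fun Z : ι → ℝ => Real.exp (∑ τ, Z τ * y τ)) (stdGaussianNoise ι) := by
  simp only [Real.exp_sum]
  refine Integrable.fintype_prod (f := fun τ t => Real.exp (t * y τ)) fun τ => ?_
  simpa [mul_comm] using integrable_exp_mul_gaussianReal (μ := 0) (v := 1) (y τ)

theorem integral_exp_linear (y : ι → ℝ) :
    ∫ Z : ι → ℝ, Real.exp (∑ τ, Z τ * y τ) ∂(stdGaussianNoise ι) =
      Real.exp ((∑ τ, y τ ^ 2) / 2) := by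
  simp only [Real.exp_sum]
  rw [stdGaussianNoise, integral_fintype_prod_eq_prod (fun τ t => Real.exp (t * y τ))]
  have h : ∀ τ, ∫ t, Real.exp (t * y τ) ∂(gaussianReal 0 1) = Real.exp (y τ ^ 2 / 2) := fun τ => by
    have := congrFun (mgf_fun_id_gaussianReal (μ := 0) (v := 1)) (y τ)
    simp only [mgf] at this
    simpa [mul_comm] using this
  rw [Finset.prod_congr rfl fun τ _ => h τ, ← Real.exp_sum, Finset.sum_div]

/-- The exponential bound for the expected overshoot of a Gaussian linear form. -/
theorem integral_linear_sub_posPart_le (y : ι → ℝ) {θ : ℝ} (hθ : 0 < θ) (b : ℝ) :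
    ∫ Z : ι → ℝ, max (∑ τ, Z τ * y τ - b) 0 ∂(stdGaussianNoise ι) ≤
      θ⁻¹ * Real.exp (θ ^ 2 * (∑ τ, y τ ^ 2) / 2 - θ * b) := by
  have hlin : ∀ Z : ι → ℝ, ∑ τ, Z τ * (θ * y τ) = θ * ∑ τ, Z τ * y τ := fun Z => by
    rw [Finset.mul_sum]; exact Finset.sum_congr rfl fun τ _ => by ring
  -- The overshoot is dominated by an exponential through `u ≤ exp u` with `u = θ * (x - b)`, which
  -- leaves a Gaussian exponential moment.
  have h1 : ∀ Z : ι → ℝ, max (∑ τ, Z τ * y τ - b) 0 ≤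
      θ⁻¹ * Real.exp (-(θ * b)) * Real.exp (∑ τ, Z τ * (θ * y τ)) := fun Z => by
    rw [hlin, mul_assoc, ← Real.exp_add]
    refine max_le ?_ (by positivity)
    have := Real.add_one_le_exp (-(θ * b) + θ * ∑ τ, Z τ * y τ)
    rw [inv_mul_eq_div, le_div_iff₀ hθ]
    linarith
  refine (integral_mono (((integrable_linear y).sub (integrable_const b)).pos_part)
    ((integrable_exp_linear _).const_mul _) h1).trans_eq ?_
  rw [integral_const_mul, integral_exp_linear, mul_assoc, ← Real.exp_add]
  congr 2
  have : ∑ τ, (θ * y τ) ^ 2 = θ ^ 2 * ∑ τ, y τ ^ 2 := by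
    rw [Finset.mul_sum]; exact Finset.sum_congr rfl fun τ _ => by ring
  rw [this]; ring

theorem integrable_abs_linear_sub_posPart (y : ι → ℝ) (b : ℝ) :
    Integrable (fun Z : ι → ℝ => max (|∑ τ, Z τ * y τ| - b) 0) (stdGaussianNoise ι) :=
  (((integrable_linear y).abs).sub (integrable_const b)).pos_part

theorem integral_abs_linear_sub_posPart_le (y : ι → ℝ) {θ : ℝ} (hθ : 0 < θ) {b : ℝ} :
    ∫ Z : ι → ℝ, max (|∑ τ, Z τ * y τ| - b) 0 ∂(stdGaussianNoise ι) ≤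
      2 * (θ⁻¹ * Real.exp (θ ^ 2 * (∑ τ, y τ ^ 2) / 2 - θ * b)) := by
  have h1 := integral_linear_sub_posPart_le y hθ b
  have h2 := integral_linear_sub_posPart_le (fun τ => -y τ) hθ b
  simp only [neg_sq] at h2
  have hneg : ∀ Z : ι → ℝ, ∑ τ, Z τ * -y τ = -∑ τ, Z τ * y τ := fun Z => by simp
  have hi : ∀ w : ι → ℝ, Integrable (fun Z : ι → ℝ => max (∑ τ, Z τ * w τ - b) 0)
    (stdGaussianNoise ι) := fun w => ((integrable_linear w).sub (integrable_const b)).pos_part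
  calc _ ≤ ∫ Z : ι → ℝ, (max (∑ τ, Z τ * y τ - b) 0 + max (∑ τ, Z τ * -y τ - b) 0)
        ∂(stdGaussianNoise ι) := by
        refine integral_mono (integrable_abs_linear_sub_posPart y b) ((hi y).add (hi _)) fun Z => ?_
        simp only [hneg]
        rcases abs_cases (∑ τ, Z τ * y τ) with ⟨h, _⟩ | ⟨h, _⟩ <;> rw [h]
        · exact le_add_of_nonneg_right (le_max_right _ _)
        · exact le_add_of_nonneg_left (le_max_right _ _)
    _ ≤ _ := by
        rw [integral_add (hi y) (hi _)]
        linarith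

theorem iIndepFun_coord : iIndepFun (fun (τ : ι) (Z : ι → ℝ) => Z τ) (stdGaussianNoise ι) :=
  iIndepFun_pi (μ := fun _ : ι => gaussianReal 0 1) (X := fun _ t => t)
    fun _ => aemeasurable_id

theorem map_coord (τ : ι) : (stdGaussianNoise ι).map (fun Z => Z τ) = gaussianReal 0 1 :=
  (measurePreserving_eval (fun _ : ι => gaussianReal 0 1) τ).map_eq

theorem hasGaussianLaw_coord (τ : ι) :
    HasGaussianLaw (fun Z : ι → ℝ => Z τ) (stdGaussianNoise ι) :=
  ⟨by rw [map_coord]; infer_instance⟩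

theorem covariance_coord [DecidableEq ι] (τ τ' : ι) :
    cov[fun Z : ι → ℝ => Z τ, fun Z => Z τ'; stdGaussianNoise ι] = if τ = τ' then 1 else 0 := by
  split_ifs with h
  · subst h
    rw [covariance_self (measurable_pi_apply τ).aemeasurable]
    have := variance_map (X := fun t : ℝ => t) (Y := fun Z : ι → ℝ => Z τ)
      (μ := stdGaussianNoise ι) (by fun_prop) (measurable_pi_apply τ).aemeasurable
    rw [map_coord, variance_fun_id_gaussianReal] at this
    simpa [Function.comp_def] using this.symm
  · exact (iIndepFun_coord.indepFun h).covariance_eq_zero (hasGaussianLaw_coord τ).memLp_two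
      (hasGaussianLaw_coord τ').memLp_two

theorem covariance_linear (y y' : ι → ℝ) :
    cov[fun Z : ι → ℝ => ∑ τ, Z τ * y τ, fun Z => ∑ τ, Z τ * y' τ; stdGaussianNoise ι] =
      ∑ τ, y τ * y' τ := by
  classical
  rw [covariance_fun_sum_fun_sum (fun τ => (hasGaussianLaw_coord τ).memLp_two.mul_const _)
    (fun τ => (hasGaussianLaw_coord τ).memLp_two.mul_const _)]
  simp only [covariance_mul_const_left, covariance_mul_const_right, covariance_coord]
  simp

theorem hasGaussianLaw_linear_family {κ : Type*} [Fintype κ] (y : κ → ι → ℝ) :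
    HasGaussianLaw (fun (Z : ι → ℝ) (x : κ) => ∑ τ, Z τ * y x τ) (stdGaussianNoise ι) := by
  have h : HasGaussianLaw (fun (Z : ι → ℝ) => (Z · : ι → ℝ)) (stdGaussianNoise ι) :=
    iIndepFun_coord.hasGaussianLaw hasGaussianLaw_coord
  have hc : Continuous fun (Z : ι → ℝ) (x : κ) => ∑ τ, Z τ * y x τ := by fun_prop
  let L : (ι → ℝ) →L[ℝ] (κ → ℝ) :=
    ⟨{ toFun := fun Z x => ∑ τ, Z τ * y x τ
       map_add' := fun Z Z' => by
        funext x; simp [add_mul, Finset.sum_add_distrib]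
       map_smul' := fun r Z => by
        funext x; simp [mul_assoc, Finset.mul_sum] }, hc⟩
  exact h.map_fun L

theorem map_linear {κ : Type*} [Fintype κ] (y : κ → ι → ℝ) (x : κ) (hy : ∑ τ, y x τ ^ 2 = 1) :
    (stdGaussianNoise ι).map (fun Z => ∑ τ, Z τ * y x τ) = gaussianReal 0 1 := by
  have h := ((hasGaussianLaw_linear_family y).eval x).map_eq_gaussianReal
  rw [h, integral_linear]
  have h2 := covariance_linear (y x) (y x)
  rw [covariance_self (integrable_linear _).aestronglyMeasurable.aemeasurable] at h2
  rw [h2]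
  simp only [← sq, hy]
  simp

/-- On `[t, t + 1]` the density is at least its value at `t + 1`, and `√(2π) ≤ 3`. The loss from `t`
to `t + 1` is harmless when `t` is of order `√(log n)`. -/
theorem gaussianReal_Ici_ge {t : ℝ} (ht : 0 ≤ t) :
    Real.exp (-(t + 1) ^ 2 / 2) / 3 ≤ (gaussianReal 0 1).real (Set.Ici t) := by
  have h1 : (gaussianReal 0 1).real (Set.Icc t (t + 1)) ≤ (gaussianReal 0 1).real (Set.Ici t) :=
    measureReal_mono Set.Icc_subset_Ici_self
  refine le_trans ?_ h1
  rw [measureReal_def, gaussianReal_apply_eq_integral 0 one_ne_zero, ENNReal.toReal_ofReal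
    (integral_nonneg fun x => gaussianPDFReal_nonneg _ _ _)]
  have h2 : ∀ x ∈ Set.Icc t (t + 1), Real.exp (-(t + 1) ^ 2 / 2) / 3 ≤ gaussianPDFReal 0 1 x := by
    intro x hx
    simp only [gaussianPDFReal, NNReal.coe_one, mul_one, sub_zero]
    rw [div_eq_inv_mul]
    have hpi : √(2 * Real.pi) ≤ 3 := by
      rw [Real.sqrt_le_left (by norm_num)]
      have := Real.pi_lt_d2
      norm_num at *; linarith
    have hpi0 : 0 < √(2 * Real.pi) := by positivity
    gcongr
    · linarith [hx.1]
    · exact hx.2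
  have h3 := setIntegral_mono_on (μ := volume) (s := Set.Icc t (t + 1))
    (f := fun _ => Real.exp (-(t + 1) ^ 2 / 2) / 3) (by simp)
    (integrable_gaussianPDFReal 0 1).integrableOn measurableSet_Icc h2
  simpa using h3

/-- From `|t| ≤ (1 + t ^ 2) / 2` and unit variance. -/
theorem integral_abs_gaussianReal_le : ∫ t, |t| ∂(gaussianReal 0 1) ≤ 1 := by
  have hm := memLp_id_gaussianReal (μ := 0) (v := 1) 2
  have hsq : Integrable (fun t : ℝ => t ^ 2) (gaussianReal 0 1) := by simpa using hm.integrable_sq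
  have h2 : ∫ t, t ^ 2 ∂(gaussianReal 0 1) = 1 := by
    have h := variance_fun_id_gaussianReal (μ := 0) (v := 1)
    rw [variance_of_integral_eq_zero (by fun_prop) (by simp [integral_id_gaussianReal])] at h
    simpa using h
  have hi : Integrable (fun t : ℝ => |t|) (gaussianReal 0 1) :=
    ((memLp_id_gaussianReal (μ := 0) (v := 1) 1).integrable le_rfl).abs
  calc _ ≤ ∫ t, (1 + t ^ 2) / 2 ∂(gaussianReal 0 1) := by
        refine integral_mono hi (((integrable_const _).add hsq).div_const _) fun t => ?_
        have := sq_abs t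
        nlinarith [sq_nonneg (|t| - 1)]
    _ = 1 := by
        rw [integral_div, integral_add (integrable_const _) hsq, h2]
        simp

theorem integrable_finset_sup' {κ α : Type*} [MeasurableSpace α] {μ : Measure α} {D : Finset κ}
    (hD : D.Nonempty) {f : κ → α → ℝ} (hf : ∀ x ∈ D, Integrable (f x) μ) :
    Integrable (fun a => D.sup' hD fun x => f x a) μ := by
  have : (fun a => D.sup' hD fun x => f x a) = D.sup' hD f := by
    funext a; rw [Finset.sup'_apply]
  rw [this]
  exact Finset.sup'_induction hD f (p := fun g => Integrable g μ)
    (fun _ h₁ _ h₂ => h₁.sup h₂) hf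

/-- A lower bound for the expected maximum of independent standard Gaussian linear forms. -/
theorem integral_sup'_linear_ge_of_orthonormal {κ : Type*} {D : Finset κ} (hD : D.Nonempty)
    (y : κ → ι → ℝ)
    (hself : ∀ x ∈ D, ∑ τ, y x τ ^ 2 = 1)
    (horth : ∀ x ∈ D, ∀ x' ∈ D, x ≠ x' → ∑ τ, y x τ * y x' τ = 0) {t : ℝ} (ht : 0 ≤ t) :
    t * (1 - Real.exp (-(D.card * (Real.exp (-(t + 1) ^ 2 / 2) / 3)))) - 1 ≤
      ∫ Z : ι → ℝ, D.sup' hD (fun x => ∑ τ, Z τ * y x τ) ∂(stdGaussianNoise ι) := by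
  classical
  set P := stdGaussianNoise ι
  let G : D → (ι → ℝ) → ℝ := fun x Z => ∑ τ, Z τ * y x τ
  have hGm : ∀ x, Measurable (G x) := fun x => by fun_prop
  have hind : iIndepFun G P := by
    refine HasGaussianLaw.iIndepFun_of_covariance_eq_zero
      (hasGaussianLaw_linear_family fun x : D => y x) fun x x' hxx' => ?_
    rw [covariance_linear]
    exact horth x x.2 x' x'.2 fun h => hxx' (Subtype.ext h)
  have hlaw : ∀ x : D, P.map (G x) = gaussianReal 0 1 := fun x =>
    map_linear (fun x : D => y x) x (hself x x.2)
  -- On `E` every form stays below `t`. Uncorrelated jointly Gaussian forms are independent, so the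
  -- probability of `E` is a power.
  let E : Set (ι → ℝ) := ⋂ x : D, G x ⁻¹' Set.Iio t
  have hEm : MeasurableSet E := MeasurableSet.iInter fun x => hGm x measurableSet_Iio
  set p := (gaussianReal 0 1).real (Set.Ici t)
  have hp := gaussianReal_Ici_ge ht
  have hPE : P.real E ≤ Real.exp (-(D.card * (Real.exp (-(t + 1) ^ 2 / 2) / 3))) := by
    have h1 : P E = ∏ x : D, P (G x ⁻¹' Set.Iio t) :=
      hind.meas_iInter fun x => ⟨_, measurableSet_Iio, rfl⟩
    have h2 : ∀ x : D, (P (G x ⁻¹' Set.Iio t)).toReal = 1 - p := fun x => by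
      rw [← Measure.map_apply (hGm x) measurableSet_Iio, hlaw]
      have := probReal_compl_eq_one_sub (μ := gaussianReal 0 1) (measurableSet_Ici (a := t))
      rw [Set.compl_Ici] at this
      exact this
    rw [measureReal_def, h1, ENNReal.toReal_prod, Finset.prod_congr rfl fun x _ => h2 x]
    simp only [Finset.prod_const, Finset.card_univ, Fintype.card_coe]
    have hp1 : p ≤ 1 := measureReal_le_one
    calc (1 - p) ^ D.card ≤ (Real.exp (-p)) ^ D.card := by
          refine pow_le_pow_left₀ (by linarith) ?_ _
          linarith [Real.add_one_le_exp (-p)]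
      _ = Real.exp (-(D.card * p)) := by rw [← Real.exp_nat_mul]; ring_nf
      _ ≤ _ := by gcongr
  obtain ⟨x₀, hx₀⟩ := hD
  have hD : D.Nonempty := ⟨x₀, hx₀⟩
  -- Off `E` the maximum is at least `t`. On `E` it is still at least one fixed form, whose absolute
  -- value costs at most `1` on average.
  have hpt : ∀ Z, Eᶜ.indicator (fun _ => t) Z - |G ⟨x₀, hx₀⟩ Z| ≤
      D.sup' hD (fun x => ∑ τ, Z τ * y x τ) := fun Z => by
    by_cases hZ : Z ∈ E
    · have : Z ∉ Eᶜ := fun h => h hZ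
      rw [Set.indicator_of_notMem this]
      have h1 := Finset.le_sup' (fun x => ∑ τ, Z τ * y x τ) hx₀
      have h2 := neg_abs_le (G ⟨x₀, hx₀⟩ Z)
      have h3 : G ⟨x₀, hx₀⟩ Z = ∑ τ, Z τ * y x₀ τ := rfl
      linarith
    · have hZ' : Z ∈ Eᶜ := hZ
      rw [Set.indicator_of_mem hZ']
      simp only [E, Set.mem_iInter, not_forall, Set.mem_preimage, Set.mem_Iio, not_lt] at hZ
      obtain ⟨x, hx⟩ := hZ
      have h1 := Finset.le_sup' (fun x => ∑ τ, Z τ * y x τ) x.2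
      have h2 := abs_nonneg (G ⟨x₀, hx₀⟩ Z)
      have h3 : G x Z = ∑ τ, Z τ * y x τ := rfl
      linarith
  have hi1 : Integrable (Eᶜ.indicator fun _ => t) P :=
    (integrable_const t).indicator hEm.compl
  have hi2 : Integrable (fun Z => |G ⟨x₀, hx₀⟩ Z|) P := (integrable_linear _).abs
  have hi3 : Integrable (fun Z => D.sup' hD fun x => ∑ τ, Z τ * y x τ) P :=
    integrable_finset_sup' hD fun x _ => integrable_linear _
  have habs : ∫ Z, |G ⟨x₀, hx₀⟩ Z| ∂P ≤ 1 := by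
    have := integral_map (μ := P) (φ := G ⟨x₀, hx₀⟩) (hGm _).aemeasurable
      (f := fun t : ℝ => |t|) (by fun_prop)
    rw [← this, hlaw]
    exact integral_abs_gaussianReal_le
  have hmono := integral_mono (hi1.sub hi2) hi3 hpt
  rw [integral_sub' hi1 hi2, integral_indicator_const _ hEm.compl,
    probReal_compl_eq_one_sub hEm, smul_eq_mul] at hmono
  have : (1 - Real.exp (-(D.card * (Real.exp (-(t + 1) ^ 2 / 2) / 3)))) * t ≤
      (1 - P.real E) * t := by gcongr
  linarith

theorem integral_sup'_linear_ge {κ : Type*} {D : Finset κ} (hD : D.Nonempty)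
    (y : κ → ι → ℝ) {s : ℝ} (hs : 0 < s)
    (hself : ∀ x ∈ D, ∑ τ, y x τ ^ 2 = s)
    (horth : ∀ x ∈ D, ∀ x' ∈ D, x ≠ x' → ∑ τ, y x τ * y x' τ = 0) {t : ℝ} (ht : 0 ≤ t) :
    √s * (t * (1 - Real.exp (-(D.card * (Real.exp (-(t + 1) ^ 2 / 2) / 3)))) - 1) ≤
      ∫ Z : ι → ℝ, D.sup' hD (fun x => ∑ τ, Z τ * y x τ) ∂(stdGaussianNoise ι) := by
  have hs0 : 0 < √s := Real.sqrt_pos.2 hs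
  have h := integral_sup'_linear_ge_of_orthonormal hD (fun x τ => y x τ / √s)
    (fun x hx => by
      simp only [div_pow, ← Finset.sum_div, Real.sq_sqrt hs.le]
      rw [hself x hx, div_self hs.ne'])
    (fun x hx x' hx' hne => by
      simp only [div_mul_div_comm, ← Finset.sum_div]
      rw [horth x hx x' hx' hne, zero_div]) ht
  have e : ∀ Z : ι → ℝ, √s * D.sup' hD (fun x => ∑ τ, Z τ * (y x τ / √s)) =
      D.sup' hD (fun x => ∑ τ, Z τ * y x τ) := fun Z => by
    rw [Finset.mul₀_sup' hs0.le]
    congr 1; funext x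
    rw [Finset.mul_sum]
    exact Finset.sum_congr rfl fun τ _ => by field_simp
  calc _ ≤ √s * ∫ Z : ι → ℝ, D.sup' hD (fun x => ∑ τ, Z τ * (y x τ / √s))
        ∂(stdGaussianNoise ι) := by gcongr
    _ = _ := by rw [← integral_const_mul]; simp only [e]

/-- Functions of disjoint sets of coordinates are uncorrelated. -/
theorem integral_mul_of_disjoint_coord [DecidableEq ι] {S T : Finset ι} (hST : Disjoint S T)
    {f g : (ι → ℝ) → ℝ} (hf : Measurable f) (hg : Measurable g)
    (hfS : ∀ Z Z', (∀ τ ∈ S, Z τ = Z' τ) → f Z = f Z')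
    (hgT : ∀ Z Z', (∀ τ ∈ T, Z τ = Z' τ) → g Z = g Z') :
    ∫ Z, f Z * g Z ∂(stdGaussianNoise ι) =
      (∫ Z, f Z ∂(stdGaussianNoise ι)) * ∫ Z, g Z ∂(stdGaussianNoise ι) := by
  have h0 := (iIndepFun_coord (ι := ι)).indepFun_finset S T hST fun τ => measurable_pi_apply τ
  -- Extension by zero makes `f` and `g` factor through the restrictions to `S` and `T`, which are
  -- independent.
  let ext : ∀ U : Finset ι, (U → ℝ) → ι → ℝ := fun U z τ => if h : τ ∈ U then z ⟨τ, h⟩ else 0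
  have hext : ∀ U, Measurable (ext U) := fun U => by
    refine measurable_pi_lambda _ fun τ => ?_
    by_cases h : τ ∈ U
    · simpa [ext, h] using measurable_pi_apply _
    · simp [ext, h]
  have hind := h0.comp (hf.comp (hext S)) (hg.comp (hext T))
  have e1 : (f ∘ ext S) ∘ (fun (a : ι → ℝ) (i : S) => a i) = f := by
    funext Z
    exact hfS _ _ fun τ hτ => by simp [ext, hτ]
  have e2 : (g ∘ ext T) ∘ (fun (a : ι → ℝ) (i : T) => a i) = g := by
    funext Z
    exact hgT _ _ fun τ hτ => by simp [ext, hτ]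
  rw [e1, e2] at hind
  exact hind.integral_fun_mul_eq_mul_integral hf.aestronglyMeasurable hg.aestronglyMeasurable

end LinearForms

/-! ### Overlaps and covariance kernels of the interpolating Hamiltonian -/

section Kernels

variable {n : ℕ}

/-- The overlap of two vectors. -/
def overlap (w w' : Fin n → ℝ) : ℝ := ∑ p, w p * w' p

/-- The coefficient vector of the diagonal noise entry at `i`. -/
def diagCoef (i : Fin n) (τ : Fin n × Fin n × Fin n) : ℝ := if τ = (i, i, i) then 1 else 0

theorem sum_tensorCube_mul (w w' : Fin n → ℝ) :
    ∑ τ, tensorCube w τ * tensorCube w' τ = overlap w w' ^ 3 := by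
  simp only [tensorCube, Fintype.sum_prod_type]
  rw [pow_three, overlap, Finset.sum_mul_sum, Finset.sum_mul]
  refine Finset.sum_congr rfl fun p _ => ?_
  rw [Finset.mul_sum]
  refine Finset.sum_congr rfl fun q _ => ?_
  rw [Finset.mul_sum]
  exact Finset.sum_congr rfl fun r _ => by ring

theorem sum_mul_diagCoef (y : Fin n × Fin n × Fin n → ℝ) (i : Fin n) :
    ∑ τ, y τ * diagCoef i τ = y (i, i, i) := by
  simp [diagCoef]

/-- Every coefficient vector of the interpolation combines a tensor cube, the cube with the site `i`
removed and the diagonal entry, so all kernels reduce to cubed overlaps and entries at `i`. -/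
theorem sum_comb_mul (i : Fin n) (w u w' u' : Fin n → ℝ) (α₁ α₂ α₃ β₁ β₂ β₃ : ℝ) :
    ∑ τ, (α₁ * tensorCube w τ + α₂ * tensorCube u τ + α₃ * diagCoef i τ) *
        (β₁ * tensorCube w' τ + β₂ * tensorCube u' τ + β₃ * diagCoef i τ) =
      α₁ * β₁ * overlap w w' ^ 3 + α₁ * β₂ * overlap w u' ^ 3 + α₁ * β₃ * w i ^ 3 +
      (α₂ * β₁ * overlap u w' ^ 3 + α₂ * β₂ * overlap u u' ^ 3 + α₂ * β₃ * u i ^ 3) +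
      (α₃ * β₁ * w' i ^ 3 + α₃ * β₂ * u' i ^ 3 + α₃ * β₃) := by
  have hd : ∀ v : Fin n → ℝ, ∑ τ, tensorCube v τ * diagCoef i τ = v i ^ 3 := fun v => by
    rw [sum_mul_diagCoef]; simp [tensorCube]; ring
  have hdd : ∑ τ, diagCoef i τ * diagCoef i τ = 1 := by
    rw [sum_mul_diagCoef]; simp [diagCoef]
  rw [← sum_tensorCube_mul, ← sum_tensorCube_mul, ← sum_tensorCube_mul, ← sum_tensorCube_mul,
    ← hd w, ← hd u, ← hd w', ← hd u']
  rw [show α₃ * β₃ = α₃ * β₃ * ∑ τ, diagCoef i τ * diagCoef i τ by rw [hdd, mul_one]]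
  simp only [Finset.mul_sum, ← Finset.sum_add_distrib]
  exact Finset.sum_congr rfl fun τ _ => by ring

/-- The vector `w` with the entry at `i` removed. -/
def removeSite (i : Fin n) (w : Fin n → ℝ) : Fin n → ℝ := Function.update w i 0

@[simp] theorem removeSite_self (i : Fin n) (w : Fin n → ℝ) : removeSite i w i = 0 := by
  simp [removeSite]

theorem removeSite_of_ne {i p : Fin n} (h : p ≠ i) (w : Fin n → ℝ) : removeSite i w p = w p := by
  simp [removeSite, h]

theorem overlap_comm (w w' : Fin n → ℝ) : overlap w w' = overlap w' w := by
  simp only [overlap, mul_comm]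

theorem overlap_eq_add (i : Fin n) (w w' : Fin n → ℝ) :
    overlap w w' = overlap (removeSite i w) (removeSite i w') + w i * w' i := by
  unfold overlap
  rw [← Finset.add_sum_erase _ _ (Finset.mem_univ i), ← Finset.add_sum_erase
    (f := fun p => removeSite i w p * removeSite i w' p) _ (Finset.mem_univ i)]
  rw [Finset.sum_congr rfl fun p hp => by
    rw [← removeSite_of_ne (Finset.ne_of_mem_erase hp) w,
      ← removeSite_of_ne (Finset.ne_of_mem_erase hp) w']]
  simp
  ring

theorem removeSite_removeSite (i : Fin n) (w : Fin n → ℝ) :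
    removeSite i (removeSite i w) = removeSite i w := by
  simp [removeSite]

theorem overlap_removeSite_right (i : Fin n) (w w' : Fin n → ℝ) :
    overlap w (removeSite i w') = overlap (removeSite i w) (removeSite i w') := by
  rw [overlap_eq_add i, removeSite_removeSite]; simp

theorem overlap_removeSite_left (i : Fin n) (w w' : Fin n → ℝ) :
    overlap (removeSite i w) w' = overlap (removeSite i w) (removeSite i w') := by
  rw [overlap_comm, overlap_removeSite_right, overlap_comm]

/-- The coefficients of the noise entries with some but not all indices equal to `i`. -/
def mixedCoef (i : Fin n) (w : Fin n → ℝ) (τ : Fin n × Fin n × Fin n) : ℝ :=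
  1 * tensorCube w τ + -1 * tensorCube (removeSite i w) τ + -(w i ^ 3) * diagCoef i τ

/-- The coefficients of the interpolating Hamiltonian: the entries avoiding `i` at scale `lam`,
the mixed ones at scale `s * lam` and the diagonal one at scale `lam * K`. -/
def siteCoef (lam K s : ℝ) (i : Fin n) (w : Fin n → ℝ) (τ : Fin n × Fin n × Fin n) : ℝ :=
  s * lam * tensorCube w τ + (lam - s * lam) * tensorCube (removeSite i w) τ +
    (lam * K * w i - s * lam * w i ^ 3) * diagCoef i τ

/-- With `R` the overlap off `i` and `κ = w i * w' i`, the mixed entries account for `(R + κ) ^ 3 -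
R ^ 3 - κ ^ 3 = 3 * R ^ 2 * κ + 3 * R * κ ^ 2`. They are orthogonal to the entries avoiding `i` and
to the diagonal one, so only the scale `s * lam` survives. -/
theorem sum_mixedCoef_mul_siteCoef (lam K s : ℝ) (i : Fin n) (w w' : Fin n → ℝ) :
    ∑ τ, mixedCoef i w τ * siteCoef lam K s i w' τ =
      s * lam * (3 * overlap (removeSite i w) (removeSite i w') ^ 2 * (w i * w' i) +
        3 * overlap (removeSite i w) (removeSite i w') * (w i * w' i) ^ 2) := by
  unfold mixedCoef siteCoef
  rw [sum_comb_mul, overlap_removeSite_right i w w', overlap_removeSite_left i w w',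
    overlap_eq_add i w w']
  simp
  ring

theorem sum_tensorCube_removeSite_mul_siteCoef (lam K s : ℝ) (i : Fin n) (w w' : Fin n → ℝ) :
    ∑ τ, tensorCube (removeSite i w) τ * siteCoef lam K s i w' τ =
      lam * overlap (removeSite i w) (removeSite i w') ^ 3 := by
  have := sum_comb_mul i w (removeSite i w) w' (removeSite i w') 0 1 0 (s * lam)
    (lam - s * lam) (lam * K * w' i - s * lam * w' i ^ 3)
  simp only [zero_mul, one_mul, zero_add, add_zero, removeSite_self, overlap_removeSite_left i w w']
    at this
  unfold siteCoef
  rw [this]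
  ring

theorem siteCoef_diag (lam K s : ℝ) (i : Fin n) (w : Fin n → ℝ) :
    siteCoef lam K s i w (i, i, i) = lam * K * w i := by
  simp [siteCoef, tensorCube, diagCoef]
  ring

theorem siteCoef_sub (lam K s h : ℝ) (i : Fin n) (w : Fin n → ℝ) (τ : Fin n × Fin n × Fin n) :
    siteCoef lam K (s - h) i w τ = siteCoef lam K s i w τ - h * lam * mixedCoef i w τ := by
  unfold siteCoef mixedCoef; ring

/-- A vector has entries in `{-1, 0, 1}`. -/
def IsTernary (w : Fin n → ℝ) : Prop := ∀ p, w p = 0 ∨ w p = 1 ∨ w p = -1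

theorem IsTernary.sq_eq_abs {w : Fin n → ℝ} (hw : IsTernary w) (p : Fin n) : w p ^ 2 = |w p| := by
  rcases hw p with h | h | h <;> rw [h] <;> norm_num

theorem IsTernary.removeSite {w : Fin n → ℝ} (hw : IsTernary w) (i : Fin n) :
    IsTernary (removeSite i w) := fun p => by
  by_cases h : p = i
  · subst h; simp
  · rw [removeSite_of_ne h]; exact hw p

theorem IsTernary.overlap_le {w w' : Fin n → ℝ} (hw : IsTernary w) (hw' : IsTernary w') :
    overlap w w' ≤ overlap w w := by
  refine Finset.sum_le_sum fun p _ => ?_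
  rcases hw p with h | h | h <;> rcases hw' p with h' | h' | h' <;> rw [h, h'] <;> norm_num

theorem IsTernary.neg_overlap_le {w w' : Fin n → ℝ} (hw : IsTernary w) (hw' : IsTernary w') :
    -overlap w w' ≤ overlap w w := by
  rw [overlap, overlap, ← Finset.sum_neg_distrib]
  refine Finset.sum_le_sum fun p _ => ?_
  rcases hw p with h | h | h <;> rcases hw' p with h' | h' | h' <;> rw [h, h'] <;> norm_num

/-- The energy-entropy bound on the covariance of the mixed terms. -/
theorem mixed_kernel_le {B R K κ : ℝ} (hB : 1 ≤ B) (hBK : B ≤ 2 * K) (hRB : R ≤ B) (hBR : -R ≤ B)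
    (hκ : κ = 0 ∨ κ = 1 ∨ κ = -1) :
    3 * (B ^ 2 - R ^ 2 * κ) + 3 * (B - R * κ ^ 2) ≤
      (3 / B + 6 / B ^ 2) * (B ^ 3 - R ^ 3) + 24 * K ^ 2 * (1 - κ) := by
  have hB0 : 0 < B := by linarith
  -- Here `B ^ 3 - R ^ 3 - B * (B ^ 2 - R ^ 2) = R ^ 2 * (B - R)`. This is the source of the leading
  -- coefficient `3 / B`, hence of the decisive constant `3 / 2`.
  have h1 : B ^ 2 - R ^ 2 ≤ 1 / B * (B ^ 3 - R ^ 3) := by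
    rw [one_div, inv_mul_eq_div, le_div_iff₀ hB0]
    nlinarith [mul_nonneg (sq_nonneg R) (sub_nonneg.2 hRB)]
  have h2 : B - R ≤ 2 / B ^ 2 * (B ^ 3 - R ^ 3) := by
    rw [div_mul_eq_mul_div, le_div_iff₀ (by positivity)]
    nlinarith [mul_nonneg (sub_nonneg.2 hRB) (sq_nonneg (B + 2 * R)),
      mul_nonneg (sub_nonneg.2 hRB) (sq_nonneg B), mul_nonneg (sub_nonneg.2 hRB) (sq_nonneg R)]
  have h3 : R ^ 2 ≤ B ^ 2 := by nlinarith
  have h4 : B ^ 2 ≤ 4 * K ^ 2 := by nlinarith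
  have h5 : (3 / B + 6 / B ^ 2) * (B ^ 3 - R ^ 3) =
      3 * (1 / B * (B ^ 3 - R ^ 3)) + 3 * (2 / B ^ 2 * (B ^ 3 - R ^ 3)) := by ring
  rw [h5]
  have h6 : B ≤ B ^ 2 := by nlinarith
  -- For `κ = 1` the two comparisons above suffice. For `κ = 0` or `κ = -1` the left side is at most
  -- `6 * B ^ 2` or `12 * B ^ 2`, which the term with `24 * K ^ 2` absorbs since `B ≤ 2 * K`.
  rcases hκ with rfl | rfl | rfl <;> nlinarith

end Kernels

/-! ### Amplifying the diagonal entry and bounding Gibbs energies at one site -/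

section SiteStep

variable {n : ℕ}

/-- The deterministic energy given up when the mixed terms at `i` are switched off. -/
def siteBonus (lam K ρ r : ℝ) (i : Fin n) (w : Fin n → ℝ) : ℝ :=
  lam * (w i ^ 2 * ((3 * overlap (removeSite i w) (removeSite i w) + 6) * ρ + 24 * K * r))

theorem gibbs₂_swap {Ω : Type*} (A : Finset Ω) (X : Ω → ℝ) (F : Ω → Ω → ℝ) :
    gibbs₂ A X F = gibbs₂ A X fun a b => F b a := by
  unfold gibbs₂ gibbs
  congr 1
  simp only [← mul_div_assoc, Finset.mul_sum, ← Finset.sum_div]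
  rw [Finset.sum_comm]
  congr 1
  exact Finset.sum_congr rfl fun a _ => Finset.sum_congr rfl fun b _ => by ring

theorem gibbs₂_add {Ω : Type*} (A : Finset Ω) (X : Ω → ℝ) (F G : Ω → Ω → ℝ) :
    gibbs₂ A X (fun a b => F a b + G a b) = gibbs₂ A X F + gibbs₂ A X G := by
  simp only [gibbs₂, gibbs_add]

theorem gibbs₂_const_mul {Ω : Type*} (A : Finset Ω) (X : Ω → ℝ) (r : ℝ) (F : Ω → Ω → ℝ) :
    gibbs₂ A X (fun a b => r * F a b) = r * gibbs₂ A X F := by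
  simp only [gibbs₂, gibbs_const_mul]

/-- Symmetrizing in the two replicas gives half the average of `(f a - f b) ^ 2`, that is, the Gibbs
variance of `f`. -/
theorem gibbs₂_mul_sub_nonneg {Ω : Type*} (A : Finset Ω) (X f : Ω → ℝ) :
    0 ≤ gibbs₂ A X fun a b => f a * (f a - f b) := by
  have h1 : gibbs₂ A X (fun a b => f a * (f a - f b)) + gibbs₂ A X (fun a b => f a * (f a - f b)) =
      gibbs₂ A X fun a b => (f a - f b) ^ 2 := by
    nth_rw 2 [gibbs₂_swap]
    rw [← gibbs₂_add]
    congr 1; funext a b; ring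
  have h2 : 0 ≤ gibbs₂ A X fun a b => (f a - f b) ^ 2 :=
    gibbs_nonneg X fun a _ => gibbs_nonneg X fun b _ => sq_nonneg _
  linarith

/-- Amplifying one noise coordinate increases the expected log-partition function. -/
theorem integral_lse_le_of_amplify {Ω : Type*} {ι : Type} [Fintype ι] [DecidableEq ι]
    {A : Finset Ω} (hA : A.Nonempty)
    (x x' : Ω → ι → ℝ) (c : Ω → ℝ) (τ₀ : ι) {K : ℝ} (hK : 1 ≤ K)
    (hne : ∀ a ∈ A, ∀ τ, τ ≠ τ₀ → x' a τ = x a τ) (h0 : ∀ a ∈ A, x' a τ₀ = K * x a τ₀) :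
    ∫ Z, lse A (ham x c Z) ∂(stdGaussianNoise ι) ≤
      ∫ Z, lse A (ham x' c Z) ∂(stdGaussianNoise ι) := by
  let y : Ω → ι → ℝ := fun a τ => if τ = τ₀ then (K - 1) * x a τ₀ else 0
  have hint : Integrable (fun Z => gibbs A (ham x c Z) fun a => ∑ τ, Z τ * y a τ)
      (stdGaussianNoise ι) :=
    integrable_gibbs_ham x c (fun a => (by fun_prop : Measurable fun Z : ι → ℝ => ∑ τ, Z τ * y a τ))
      fun a => integrable_linear _
  have hpt : ∀ Z, lse A (ham x c Z) + gibbs A (ham x c Z) (fun a => ∑ τ, Z τ * y a τ) ≤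
      lse A (ham x' c Z) := fun Z => by
    refine le_trans (le_of_eq ?_) (lse_add_gibbs_le hA (ham x c Z) (ham x' c Z))
    congr 1
    refine gibbs_congr _ fun a ha => ?_
    have : ∀ τ, Z τ * y a τ = Z τ * x' a τ - Z τ * x a τ := fun τ => by
      by_cases h : τ = τ₀
      · subst h; simp [y, h0 a ha]; ring
      · simp [y, h, hne a ha τ h]
    rw [Finset.sum_congr rfl fun τ _ => this τ, Finset.sum_sub_distrib]
    simp [ham]
  have h1 := integral_mono ((integrable_lse_ham hA x c).add hint) (integrable_lse_ham hA x' c) hpt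
  rw [integral_add' (integrable_lse_ham hA x c) hint, integral_gibbs_linear hA] at h1
  -- After integration by parts the first-order effect of the amplification is `K - 1` times a Gibbs
  -- variance.
  have h2 : 0 ≤ ∫ Z, gibbs₂ A (ham x c Z) (fun a b => ∑ τ, y a τ * (x a τ - x b τ))
      ∂(stdGaussianNoise ι) := by
    refine integral_nonneg fun Z => ?_
    have : (fun a b => ∑ τ, y a τ * (x a τ - x b τ)) =
        fun a b => (K - 1) * (x a τ₀ * (x a τ₀ - x b τ₀)) := by
      funext a b; simp [y]; ring
    simp only [this, gibbs₂_const_mul, Pi.zero_apply]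
    exact mul_nonneg (by linarith) (gibbs₂_mul_sub_nonneg A _ fun a => x a τ₀)
  linarith

variable {lam K ρ r : ℝ} {i : Fin n} {A : Finset (Fin n → ℝ)}

local notation "𝐙" => stdGaussianNoise (Fin n × Fin n × Fin n)

theorem integrable_tail (i : Fin n) :
    Integrable (fun Z : Fin n × Fin n × Fin n → ℝ => max (|Z (i, i, i)| - r) 0) 𝐙 :=
  ((integrable_coord _).abs.sub (integrable_const r)).pos_part

/-- The exponential overshoot bound with `θ = b = r` gives `2 * r⁻¹ * exp (-r ^ 2 / 2)`; thus `r` of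
order `√(2 log K)` makes the tail negligible even after multiplication by `K`. -/
theorem integral_tail_le (hr : 1 ≤ r) (hKr : K * Real.exp (-r ^ 2 / 2) ≤ 1) (hK : 0 ≤ K)
    (i : Fin n) :
    K * ∫ Z, max (|Z (i, i, i)| - r) 0 ∂𝐙 ≤ 2 := by
  have h := integral_abs_linear_sub_posPart_le (ι := Fin n × Fin n × Fin n) (diagCoef i)
    (θ := r) (by linarith) (b := r)
  simp only [sum_mul_diagCoef] at h
  have h1 : ∑ τ, diagCoef i τ ^ 2 = 1 := by
    simp only [sq, sum_mul_diagCoef]; simp [diagCoef]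
  rw [h1, show r ^ 2 * 1 / 2 - r * r = -r ^ 2 / 2 by ring] at h
  have hrinv : r⁻¹ ≤ 1 := inv_le_one_of_one_le₀ hr
  have hr0 : 0 < r⁻¹ := by positivity
  calc _ ≤ K * (2 * (r⁻¹ * Real.exp (-r ^ 2 / 2))) := by gcongr
    _ = 2 * r⁻¹ * (K * Real.exp (-r ^ 2 / 2)) := by ring
    _ ≤ 2 * 1 * 1 := by gcongr
    _ = 2 := by norm_num

/-- The Gibbs average of the diagonal noise on the event that `i` is occupied. -/
theorem integral_gibbs_abs_diag_le (hA : A.Nonempty) (hter : ∀ w ∈ A, IsTernary w)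
    (hK : 0 ≤ K) (hr : 1 ≤ r) (hKr : K * Real.exp (-r ^ 2 / 2) ≤ 1)
    (x : (Fin n → ℝ) → Fin n × Fin n × Fin n → ℝ) (c : (Fin n → ℝ) → ℝ) :
    K * ∫ Z, gibbs A (ham x c Z) (fun w => |Z (i, i, i)| * w i ^ 2) ∂𝐙 ≤
      K * r * ∫ Z, gibbs A (ham x c Z) (fun w => w i ^ 2) ∂𝐙 + 2 := by
  have hi1 : Integrable (fun Z => gibbs A (ham x c Z) (fun w => w i ^ 2)) 𝐙 :=
    integrable_gibbs_ham x c (fun _ => measurable_const) fun _ => integrable_const _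
  have hi2 : Integrable (fun Z => gibbs A (ham x c Z) (fun w => |Z (i, i, i)| * w i ^ 2)) 𝐙 :=
    integrable_gibbs_ham x c (fun a => (by fun_prop :
      Measurable fun Z : Fin n × Fin n × Fin n → ℝ => |Z (i, i, i)| * a i ^ 2))
      fun _ => (integrable_coord _).abs.mul_const _
  have hpt : ∀ Z, gibbs A (ham x c Z) (fun w => |Z (i, i, i)| * w i ^ 2) ≤
      r * gibbs A (ham x c Z) (fun w => w i ^ 2) + max (|Z (i, i, i)| - r) 0 := fun Z => by
    have : gibbs A (ham x c Z) (fun w => |Z (i, i, i)| * w i ^ 2) ≤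
        gibbs A (ham x c Z) (fun w => r * w i ^ 2 + max (|Z (i, i, i)| - r) 0) := by
      refine gibbs_mono _ fun w hw => ?_
      have h1 := le_max_left (|Z (i, i, i)| - r) 0
      have h2 := le_max_right (|Z (i, i, i)| - r) 0
      have h3 : w i ^ 2 = 0 ∨ w i ^ 2 = 1 := by
        rcases hter w hw i with h | h | h <;> rw [h] <;> norm_num
      rcases h3 with h | h <;> rw [h] <;> linarith
    rwa [gibbs_add, gibbs_const_mul _ _ (fun w : Fin n → ℝ => w i ^ 2) r, gibbs_const hA] at this
  have h1 := integral_mono hi2 ((hi1.const_mul r).add (integrable_tail i)) hpt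
  rw [integral_add' (hi1.const_mul r) (integrable_tail i), integral_const_mul] at h1
  have h2 := integral_tail_le hr hKr hK i
  nlinarith

/-- The Gibbs average of the energy of the entries avoiding `i`, weighted on configurations
occupying `i`. -/
theorem integral_gibbs_weighted_energy_le (hter : ∀ w ∈ A, IsTernary w)
    (hρ : 1 ≤ ρ)
    (hB : ∀ w ∈ A, w i ≠ 0 → 1 ≤ overlap (removeSite i w) (removeSite i w))
    (hcount : ∑ w ∈ A, w i ^ 2 * Real.exp (-(ρ ^ 2 / 2) *
      overlap (removeSite i w) (removeSite i w)) ≤ 16)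
    (x : (Fin n → ℝ) → Fin n × Fin n × Fin n → ℝ) (c : (Fin n → ℝ) → ℝ) :
    ∫ Z, gibbs A (ham x c Z) (fun w => w i ^ 2 *
        (3 / overlap (removeSite i w) (removeSite i w) +
          6 / overlap (removeSite i w) (removeSite i w) ^ 2) *
        ∑ τ, Z τ * tensorCube (removeSite i w) τ) ∂𝐙 ≤
      ∫ Z, gibbs A (ham x c Z) (fun w => w i ^ 2 *
        ((3 * overlap (removeSite i w) (removeSite i w) + 6) * ρ)) ∂𝐙 + 144 := by
  set b : (Fin n → ℝ) → ℝ := fun w => overlap (removeSite i w) (removeSite i w) with hb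
  -- Overshoot of the energy divided by `b w`, above the level `b w * ρ`. The rescaled energy has
  -- variance `b w`, so the bound with `θ = ρ` is `exp (-ρ ^ 2 * b w / 2)`, exactly the weight
  -- summed in `hcount`: the energy tail beats the entropy.
  let e : (Fin n → ℝ) → (Fin n × Fin n × Fin n → ℝ) → ℝ := fun w Z =>
    max (∑ τ, Z τ * ((b w)⁻¹ * tensorCube (removeSite i w) τ) - b w * ρ) 0
  have hei : ∀ w, Integrable (e w) 𝐙 := fun w =>
    ((integrable_linear _).sub (integrable_const _)).pos_part
  have hpt : ∀ Z, gibbs A (ham x c Z) (fun w => w i ^ 2 *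
        (3 / b w + 6 / b w ^ 2) * ∑ τ, Z τ * tensorCube (removeSite i w) τ) ≤
      gibbs A (ham x c Z) (fun w => w i ^ 2 * ((3 * b w + 6) * ρ)) +
        ∑ w ∈ A, 9 * (w i ^ 2 * e w Z) := fun Z => by
    have h1 : gibbs A (ham x c Z) (fun w => w i ^ 2 *
        (3 / b w + 6 / b w ^ 2) * ∑ τ, Z τ * tensorCube (removeSite i w) τ) ≤
        gibbs A (ham x c Z) (fun w => w i ^ 2 * ((3 * b w + 6) * ρ) + 9 * (w i ^ 2 * e w Z)) := by
      refine gibbs_mono _ fun w hw => ?_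
      by_cases hwi : w i = 0
      · simp [hwi]
      have hwi2 : w i ^ 2 = 1 := by
        rcases hter w hw i with h | h | h
        · exact absurd h hwi
        · rw [h]; norm_num
        · rw [h]; norm_num
      have hb1 := hB w hw hwi
      have hb0 : 0 < b w := by linarith
      have hsum : ∑ τ, Z τ * ((b w)⁻¹ * tensorCube (removeSite i w) τ) =
          (b w)⁻¹ * ∑ τ, Z τ * tensorCube (removeSite i w) τ := by
        rw [Finset.mul_sum]; exact Finset.sum_congr rfl fun τ _ => by ring
      set H := ∑ τ, Z τ * tensorCube (removeSite i w) τ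
      have he : (b w)⁻¹ * H - b w * ρ ≤ e w Z := by
        simp only [e, hsum]; exact le_max_left _ _
      have he0 : 0 ≤ e w Z := le_max_right _ _
      rw [hwi2]
      have h3 : (3 / b w + 6 / b w ^ 2) * H = (3 + 6 / b w) * ((b w)⁻¹ * H) := by
        field_simp
      have h4 : 6 / b w ≤ 6 := div_le_self (by norm_num) hb1
      have h5 : 0 < 6 / b w := by positivity
      have h6 : (3 + 6 / b w) * (b w * ρ) = (3 * b w + 6) * ρ := by field_simp
      have h7 : (3 + 6 / b w) * ((b w)⁻¹ * H) ≤ (3 + 6 / b w) * (b w * ρ + e w Z) := by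
        gcongr; linarith
      -- The factor `9` comes from `b w ≥ 1`; with the entropy sum `16` it gives `144 = 9 * 16`.
      have h8 : (3 + 6 / b w) * e w Z ≤ 9 * e w Z := by gcongr; linarith
      linarith
    rw [gibbs_add] at h1
    refine h1.trans (add_le_add le_rfl ?_)
    exact gibbs_le_sum _ fun w _ => mul_nonneg (by norm_num) (mul_nonneg (sq_nonneg _)
      (le_max_right _ _))
  have hi1 : Integrable (fun Z => gibbs A (ham x c Z) (fun w => w i ^ 2 *
        (3 / b w + 6 / b w ^ 2) * ∑ τ, Z τ * tensorCube (removeSite i w) τ)) 𝐙 :=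
    integrable_gibbs_ham x c (fun w => (by fun_prop :
      Measurable fun Z : Fin n × Fin n × Fin n → ℝ => w i ^ 2 *
        (3 / b w + 6 / b w ^ 2) * ∑ τ, Z τ * tensorCube (removeSite i w) τ))
      fun w => (integrable_linear _).const_mul _
  have hi2 : Integrable (fun Z => gibbs A (ham x c Z)
      (fun w => w i ^ 2 * ((3 * b w + 6) * ρ))) 𝐙 :=
    integrable_gibbs_ham x c (fun _ => measurable_const) fun _ => integrable_const _
  have hi3 : Integrable (fun Z => ∑ w ∈ A, 9 * (w i ^ 2 * e w Z)) 𝐙 :=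
    integrable_finsetSum _ fun w _ => ((hei w).const_mul _).const_mul _
  refine (integral_mono hi1 (hi2.add hi3) hpt).trans ?_
  rw [integral_add' hi2 hi3, integral_finsetSum _ fun w _ => ((hei w).const_mul _).const_mul _]
  gcongr
  calc ∑ w ∈ A, ∫ Z, 9 * (w i ^ 2 * e w Z) ∂𝐙 ≤
      ∑ w ∈ A, 9 * (w i ^ 2 * Real.exp (-(ρ ^ 2 / 2) * b w)) := by
        refine Finset.sum_le_sum fun w hw => ?_
        rw [integral_const_mul, integral_const_mul]
        by_cases hwi : w i = 0
        · simp [hwi]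
        have hb0 : 0 < b w := by linarith [hB w hw hwi]
        gcongr
        refine (integral_linear_sub_posPart_le _ (θ := ρ) (by linarith) _).trans ?_
        have h1 : ∑ τ, ((b w)⁻¹ * tensorCube (removeSite i w) τ) ^ 2 = b w := by
          have : ∀ τ, ((b w)⁻¹ * tensorCube (removeSite i w) τ) ^ 2 = ((b w)⁻¹) ^ 2 *
            (tensorCube (removeSite i w) τ * tensorCube (removeSite i w) τ) := fun τ => by ring
          rw [Finset.sum_congr rfl fun τ _ => this τ, ← Finset.mul_sum, sum_tensorCube_mul]
          change ((b w)⁻¹) ^ 2 * b w ^ 3 = b w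
          field_simp
        rw [h1]
        have h2 : ρ⁻¹ ≤ 1 := inv_le_one_of_one_le₀ hρ
        calc _ ≤ 1 * Real.exp (ρ ^ 2 * b w / 2 - ρ * (b w * ρ)) := by gcongr
          _ = _ := by rw [one_mul]; congr 1; ring
    _ = 9 * ∑ w ∈ A, w i ^ 2 * Real.exp (-(ρ ^ 2 / 2) * b w) := by rw [Finset.mul_sum]
    _ ≤ 144 := by linarith

end SiteStep

/-! ### Switching off the mixed noise entries at one site -/

section SiteInterpolation

variable {n : ℕ} {lam K ρ r : ℝ} {i : Fin n} {A : Finset (Fin n → ℝ)}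

local notation "𝐙" => stdGaussianNoise (Fin n × Fin n × Fin n)

/-- The left side is the derivative in `s` of the expected log-partition function. Integration by
parts turns it into a replica kernel; the kernel is dominated by those of two other linear forms,
and integration by parts in reverse returns Gibbs averages of these forms, which are bounded by
their typical maxima. The factor `s` survives, and its sum over `[0, 1]` later produces the half.
The error is `192 = 144 + 24 * 2`. -/
theorem integral_gibbs_mixed_le (hA : A.Nonempty) (hter : ∀ w ∈ A, IsTernary w) (hK : 1 ≤ K)
    (hlam : 0 ≤ lam) (hr : 1 ≤ r) (hKr : K * Real.exp (-r ^ 2 / 2) ≤ 1) (hρ : 1 ≤ ρ)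
    (hB : ∀ w ∈ A, w i ≠ 0 → 1 ≤ overlap (removeSite i w) (removeSite i w))
    (hBK : ∀ w ∈ A, w i ≠ 0 → overlap (removeSite i w) (removeSite i w) ≤ 2 * K)
    (hcount : ∑ w ∈ A, w i ^ 2 * Real.exp (-(ρ ^ 2 / 2) *
      overlap (removeSite i w) (removeSite i w)) ≤ 16)
    (c : (Fin n → ℝ) → ℝ) {s : ℝ} (hs : 0 ≤ s) :
    lam * ∫ Z, gibbs A (ham (siteCoef lam K s i) c Z) (fun w => ∑ τ, Z τ * mixedCoef i w τ) ∂𝐙 ≤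
      s * (∫ Z, gibbs A (ham (siteCoef lam K s i) c Z) (siteBonus lam K ρ r i) ∂𝐙 +
        192 * lam) := by
  set x := siteCoef lam K s i with hx
  set b : (Fin n → ℝ) → ℝ := fun w => overlap (removeSite i w) (removeSite i w) with hb
  let φ : (Fin n → ℝ) → ℝ := fun w => w i ^ 2 * (3 / b w + 6 / b w ^ 2)
  have hsq : ∀ w ∈ A, w i ≠ 0 → w i ^ 2 = 1 := fun w hw hwi => by
    rcases hter w hw i with h | h | h
    · exact absurd h hwi
    · rw [h]; norm_num
    · rw [h]; norm_num
  -- `F₁` is the kernel of the weighted energy of the entries avoiding `i`; `F₂` is that of `w i * Z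
  -- (i, i, i)`. As the diagonal entry has scale `lam * K`, the coefficient `24 * K` in front of
  -- `F₂` already yields the required `24 * K ^ 2`. The amplification thus lowers the price of
  -- disagreement at `i` from order `K ^ 2 * r` to `K * r`.
  let F₁ : (Fin n → ℝ) → (Fin n → ℝ) → ℝ := fun w w' =>
    ∑ τ, (φ w * tensorCube (removeSite i w) τ) * (x w τ - x w' τ)
  let F₂ : (Fin n → ℝ) → (Fin n → ℝ) → ℝ := fun w w' =>
    ∑ τ, (w i * diagCoef i τ) * (x w τ - x w' τ)
  have hF₁ : ∀ w w', F₁ w w' = lam * (φ w * (b w ^ 3 -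
      overlap (removeSite i w) (removeSite i w') ^ 3)) := fun w w' => by
    have : ∀ τ, (φ w * tensorCube (removeSite i w) τ) * (x w τ - x w' τ) =
      φ w * (tensorCube (removeSite i w) τ * x w τ) -
        φ w * (tensorCube (removeSite i w) τ * x w' τ) := fun τ => by ring
    simp only [F₁]
    rw [Finset.sum_congr rfl fun τ _ => this τ, Finset.sum_sub_distrib, ← Finset.mul_sum,
      ← Finset.mul_sum, hx, sum_tensorCube_removeSite_mul_siteCoef,
      sum_tensorCube_removeSite_mul_siteCoef]
    simp only [hb]; ring
  have hF₂ : ∀ w w', F₂ w w' = lam * K * (w i ^ 2 - w i * w' i) := fun w w' => by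
    have : ∀ τ, (w i * diagCoef i τ) * (x w τ - x w' τ) =
      w i * (x w τ * diagCoef i τ) - w i * (x w' τ * diagCoef i τ) := fun τ => by ring
    simp only [F₂]
    rw [Finset.sum_congr rfl fun τ _ => this τ, Finset.sum_sub_distrib, ← Finset.mul_sum,
      ← Finset.mul_sum, sum_mul_diagCoef, sum_mul_diagCoef, hx, siteCoef_diag, siteCoef_diag]
    ring
  have hpt : ∀ w ∈ A, ∀ w' ∈ A, ∑ τ, mixedCoef i w τ * (x w τ - x w' τ) ≤
      s * (F₁ w w' + 24 * K * F₂ w w') := fun w hw w' hw' => by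
    have e : ∑ τ, mixedCoef i w τ * (x w τ - x w' τ) = s * lam *
        (3 * (b w ^ 2 * (w i * w i) - overlap (removeSite i w) (removeSite i w') ^ 2 *
          (w i * w' i)) + 3 * (b w * (w i * w i) ^ 2 -
          overlap (removeSite i w) (removeSite i w') * (w i * w' i) ^ 2)) := by
      simp only [mul_sub, Finset.sum_sub_distrib, hx, sum_mixedCoef_mul_siteCoef]
      simp only [hb]; ring
    rw [e, hF₁, hF₂]
    by_cases hwi : w i = 0
    · simp [hwi, φ]
    have h1 := hsq w hw hwi
    have h2 : w i * w i = 1 := by rw [← sq]; exact h1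
    have hκ : w i * w' i = 0 ∨ w i * w' i = 1 ∨ w i * w' i = -1 := by
      rcases hter w hw i with h | h | h <;> rcases hter w' hw' i with h' | h' | h' <;>
        rw [h, h'] <;> norm_num
    have key := mixed_kernel_le (hB w hw hwi) (hBK w hw hwi)
      (((hter w hw).removeSite i).overlap_le ((hter w' hw').removeSite i))
      (((hter w hw).removeSite i).neg_overlap_le ((hter w' hw').removeSite i)) hκ
    simp only [φ, h1, h2]
    have hsl : 0 ≤ s * lam := mul_nonneg hs hlam
    refine (mul_le_mul_of_nonneg_left ?_ hsl).trans_eq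
      (b := s * lam * ((3 / b w + 6 / b w ^ 2) * (b w ^ 3 -
        overlap (removeSite i w) (removeSite i w') ^ 3) + 24 * K ^ 2 * (1 - w i * w' i))) (by ring)
    simpa using key
  have hi₁ := integrable_gibbs₂_ham (A := A) x c F₁
  have hi₂ := integrable_gibbs₂_ham (A := A) x c F₂
  have hconst : ∀ f : (Fin n → ℝ) → ℝ, Integrable (fun Z => gibbs A (ham x c Z) f) 𝐙 := fun f =>
    integrable_gibbs_ham x c (fun _ => measurable_const) fun _ => integrable_const _
  have h1 : ∫ Z, gibbs A (ham x c Z) (fun w => ∑ τ, Z τ * mixedCoef i w τ) ∂𝐙 ≤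
      s * (∫ Z, gibbs₂ A (ham x c Z) F₁ ∂𝐙 + 24 * K * ∫ Z, gibbs₂ A (ham x c Z) F₂ ∂𝐙) := by
    rw [integral_gibbs_linear hA]
    rw [← integral_const_mul, ← integral_add hi₁ (hi₂.const_mul _), ← integral_const_mul]
    refine integral_mono (integrable_gibbs₂_ham x c _) ((hi₁.add (hi₂.const_mul _)).const_mul _)
      fun Z => ?_
    refine (gibbs₂_mono _ hpt).trans_eq ?_
    rw [gibbs₂_const_mul, gibbs₂_add, gibbs₂_const_mul]
  -- Integration by parts is read backwards: the kernel becomes an energy average.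
  have h2 : ∫ Z, gibbs₂ A (ham x c Z) F₁ ∂𝐙 ≤
      ∫ Z, gibbs A (ham x c Z) (fun w => w i ^ 2 * ((3 * b w + 6) * ρ)) ∂𝐙 + 144 := by
    rw [← integral_gibbs_linear hA]
    refine le_trans (le_of_eq ?_) (integral_gibbs_weighted_energy_le hter hρ hB hcount x c)
    congr 1; funext Z
    refine gibbs_congr _ fun w _ => ?_
    rw [Finset.mul_sum]
    exact Finset.sum_congr rfl fun τ _ => by simp only [φ, hb]; ring
  have h3 : ∫ Z, gibbs₂ A (ham x c Z) F₂ ∂𝐙 ≤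
      ∫ Z, gibbs A (ham x c Z) (fun w => |Z (i, i, i)| * w i ^ 2) ∂𝐙 := by
    rw [← integral_gibbs_linear hA]
    refine integral_mono ?_ ?_ fun Z => ?_
    · exact integrable_gibbs_ham x c (fun w => (by fun_prop :
        Measurable fun Z : Fin n × Fin n × Fin n → ℝ => ∑ τ, Z τ * (w i * diagCoef i τ)))
        fun _ => integrable_linear _
    · exact integrable_gibbs_ham x c (fun a => (by fun_prop :
        Measurable fun Z : Fin n × Fin n × Fin n → ℝ => |Z (i, i, i)| * a i ^ 2))
        fun _ => (integrable_coord _).abs.mul_const _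
    · refine gibbs_mono _ fun w hw => ?_
      have : ∑ τ, Z τ * (w i * diagCoef i τ) = w i * Z (i, i, i) := by
        rw [← sum_mul_diagCoef Z i, Finset.mul_sum]
        exact Finset.sum_congr rfl fun τ _ => by ring
      rw [this, (hter w hw).sq_eq_abs, mul_comm |Z (i, i, i)|, ← abs_mul]
      exact le_abs_self _
  have h4 := integral_gibbs_abs_diag_le (i := i) hA hter (by linarith) hr hKr x c
  have h5 : ∫ Z, gibbs A (ham x c Z) (siteBonus lam K ρ r i) ∂𝐙 =
      lam * (∫ Z, gibbs A (ham x c Z) (fun w => w i ^ 2 * ((3 * b w + 6) * ρ)) ∂𝐙 +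
        24 * (K * r * ∫ Z, gibbs A (ham x c Z) (fun w => w i ^ 2) ∂𝐙)) := by
    rw [← integral_const_mul (K * r), ← integral_const_mul 24,
      ← integral_add (hconst _) (((hconst _).const_mul _).const_mul _), ← integral_const_mul]
    congr 1; funext Z
    rw [← gibbs_const_mul, ← gibbs_const_mul, ← gibbs_add, ← gibbs_const_mul]
    refine gibbs_congr _ fun w _ => ?_
    simp only [siteBonus, hb]; ring
  rw [h5]
  have h6 : 24 * K * ∫ Z, gibbs₂ A (ham x c Z) F₂ ∂𝐙 ≤
      24 * (K * ∫ Z, gibbs A (ham x c Z) (fun w => |Z (i, i, i)| * w i ^ 2) ∂𝐙) := by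
    rw [mul_assoc]
    have : 0 ≤ K := by linarith
    gcongr
  calc _ ≤ lam * (s * (∫ Z, gibbs₂ A (ham x c Z) F₁ ∂𝐙 +
        24 * K * ∫ Z, gibbs₂ A (ham x c Z) F₂ ∂𝐙)) := by gcongr
    _ = s * (lam * (∫ Z, gibbs₂ A (ham x c Z) F₁ ∂𝐙 +
        24 * K * ∫ Z, gibbs₂ A (ham x c Z) F₂ ∂𝐙)) := by ring
    _ ≤ s * (lam * (∫ Z, gibbs A (ham x c Z) (fun w => w i ^ 2 * ((3 * b w + 6) * ρ)) ∂𝐙 +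
        24 * (K * r * ∫ Z, gibbs A (ham x c Z) (fun w => w i ^ 2) ∂𝐙) + 192)) := by
        refine mul_le_mul_of_nonneg_left (mul_le_mul_of_nonneg_left ?_ hlam) hs
        linarith
    _ = _ := by ring

/-- Convexity alone suffices: the tangent at `s` lies below the log-partition function at `s - h`,
so no second derivative is needed. The bonus is charged at the upper end `s` of the step, whence `h
^ 2 * l * (l + 1) / 2` rather than `(l * h) ^ 2 / 2` after summation. -/
theorem integral_lse_site_step (hA : A.Nonempty) (hter : ∀ w ∈ A, IsTernary w) (hK : 1 ≤ K)
    (hlam : 0 ≤ lam) (hr : 1 ≤ r) (hKr : K * Real.exp (-r ^ 2 / 2) ≤ 1) (hρ : 1 ≤ ρ)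
    (hB : ∀ w ∈ A, w i ≠ 0 → 1 ≤ overlap (removeSite i w) (removeSite i w))
    (hBK : ∀ w ∈ A, w i ≠ 0 → overlap (removeSite i w) (removeSite i w) ≤ 2 * K)
    (hcount : ∑ w ∈ A, w i ^ 2 * Real.exp (-(ρ ^ 2 / 2) *
      overlap (removeSite i w) (removeSite i w)) ≤ 16)
    (c : (Fin n → ℝ) → ℝ) {s h : ℝ} (hs : 0 ≤ s) (hh : 0 ≤ h) :
    ∫ Z, lse A (ham (siteCoef lam K s i) c Z) ∂𝐙 ≤
      ∫ Z, lse A (ham (siteCoef lam K (s - h) i)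
        (fun w => c w + h * s * siteBonus lam K ρ r i w) Z) ∂𝐙 + 192 * lam * (h * s) := by
  have hmain := integral_gibbs_mixed_le hA hter hK hlam hr hKr hρ hB hBK hcount c hs
  set x := siteCoef lam K s i with hx
  set x' := siteCoef lam K (s - h) i
  set c' := fun w => c w + h * s * siteBonus lam K ρ r i w
  have hi1 : Integrable (fun Z => gibbs A (ham x c Z)
      (fun w => ∑ τ, Z τ * mixedCoef i w τ)) 𝐙 :=
    integrable_gibbs_ham x c (fun w => (by fun_prop :
      Measurable fun Z : Fin n × Fin n × Fin n → ℝ => ∑ τ, Z τ * mixedCoef i w τ))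
      fun _ => integrable_linear _
  have hi2 : Integrable (fun Z => gibbs A (ham x c Z) (siteBonus lam K ρ r i)) 𝐙 :=
    integrable_gibbs_ham x c (fun _ => measurable_const) fun _ => integrable_const _
  have hpt : ∀ Z, lse A (ham x c Z) + (h * s * gibbs A (ham x c Z) (siteBonus lam K ρ r i) -
      h * lam * gibbs A (ham x c Z) (fun w => ∑ τ, Z τ * mixedCoef i w τ)) ≤
      lse A (ham x' c' Z) := fun Z => by
    refine le_trans (le_of_eq ?_) (lse_add_gibbs_le hA (ham x c Z) (ham x' c' Z))
    congr 1
    rw [← gibbs_const_mul, ← gibbs_const_mul, ← gibbs_sub]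
    refine gibbs_congr _ fun w _ => ?_
    simp only [ham, x', siteCoef_sub, mul_sub, Finset.sum_sub_distrib, c', Finset.mul_sum]
    have : ∑ τ, Z τ * (h * lam * mixedCoef i w τ) = ∑ τ, h * lam * (Z τ * mixedCoef i w τ) :=
      Finset.sum_congr rfl fun τ _ => by ring
    rw [this]; ring
  have hi3 := (hi2.const_mul (h * s)).sub (hi1.const_mul (h * lam))
  have := integral_mono ((integrable_lse_ham hA x c).add hi3) (integrable_lse_ham hA x' c') hpt
  rw [integral_add' (integrable_lse_ham hA x c) hi3,
    integral_sub' (hi2.const_mul (h * s)) (hi1.const_mul (h * lam)), integral_const_mul,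
    integral_const_mul] at this
  have h2 := mul_le_mul_of_nonneg_left hmain hh
  nlinarith

/-- Switching off the mixed terms in `L` steps. -/
theorem integral_lse_site_interpolate (hA : A.Nonempty) (hter : ∀ w ∈ A, IsTernary w) (hK : 1 ≤ K)
    (hlam : 0 ≤ lam) (hr : 1 ≤ r) (hKr : K * Real.exp (-r ^ 2 / 2) ≤ 1) (hρ : 1 ≤ ρ)
    (hB : ∀ w ∈ A, w i ≠ 0 → 1 ≤ overlap (removeSite i w) (removeSite i w))
    (hBK : ∀ w ∈ A, w i ≠ 0 → overlap (removeSite i w) (removeSite i w) ≤ 2 * K)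
    (hcount : ∑ w ∈ A, w i ^ 2 * Real.exp (-(ρ ^ 2 / 2) *
      overlap (removeSite i w) (removeSite i w)) ≤ 16) {h : ℝ} (hh : 0 ≤ h) (l : ℕ) :
    ∀ c : (Fin n → ℝ) → ℝ,
    ∫ Z, lse A (ham (siteCoef lam K (l * h) i) c Z) ∂𝐙 ≤
      ∫ Z, lse A (ham (siteCoef lam K 0 i)
        (fun w => c w + (h ^ 2 * (l * (l + 1) / 2)) * siteBonus lam K ρ r i w) Z) ∂𝐙 +
        192 * lam * (h ^ 2 * (l * (l + 1) / 2)) := by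
  -- The deterministic term `c` stays universally quantified because each step adds its own multiple
  -- of the bonus to it.
  induction l with
  | zero => intro c; simp
  | succ l ih =>
    intro c
    have h1 := integral_lse_site_step hA hter hK hlam hr hKr hρ hB hBK hcount c
      (s := ((l + 1 : ℕ) : ℝ) * h) (h := h) (by positivity) hh
    rw [show ((l + 1 : ℕ) : ℝ) * h - h = l * h by push_cast; ring] at h1
    have h2 := ih fun w => c w + h * (((l + 1 : ℕ) : ℝ) * h) * siteBonus lam K ρ r i w
    have e : (fun w => c w + h * (((l + 1 : ℕ) : ℝ) * h) * siteBonus lam K ρ r i w +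
        (h ^ 2 * (l * (l + 1) / 2)) * siteBonus lam K ρ r i w) =
        fun w => c w + (h ^ 2 * (((l + 1 : ℕ) : ℝ) * (((l + 1 : ℕ) : ℝ) + 1) / 2)) *
          siteBonus lam K ρ r i w := by
      funext w; push_cast; ring
    rw [e] at h2
    refine h1.trans ((add_le_add_left h2 _).trans_eq ?_)
    push_cast; ring

end SiteInterpolation

/-! ### Moving one nonzero entry to the best site of a fresh block -/

section Relocation

variable {n : ℕ} {lam K ρ r : ℝ} {i : Fin n} {A : Finset (Fin n → ℝ)}

local notation "𝐙" => stdGaussianNoise (Fin n × Fin n × Fin n)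

theorem gibbs_eq_sum {Ω : Type*} (A : Finset Ω) (X f : Ω → ℝ) :
    gibbs A X f = ∑ a ∈ A, Real.exp (X a) / (∑ b ∈ A, Real.exp (X b)) * f a := by
  rw [gibbs, Finset.sum_div]
  exact Finset.sum_congr rfl fun a _ => by ring

/-- The vector `w` with the entry at `i` moved to the site `x`. -/
def moveSite (i x : Fin n) (w : Fin n → ℝ) : Fin n → ℝ :=
  Function.update (removeSite i w) x (w i)

theorem overlap_update_left {x : Fin n} {u : Fin n → ℝ} (hu : u x = 0) (a : ℝ) (u' : Fin n → ℝ) :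
    overlap (Function.update u x a) u' = overlap u u' + a * u' x := by
  have : ∀ p, Function.update u x a p * u' p = u p * u' p + if p = x then a * u' x else 0 :=
    fun p => by
      by_cases h : p = x
      · subst h; simp [hu]
      · simp [h]
  simp only [overlap, this, Finset.sum_add_distrib]
  simp

theorem overlap_update_right {x : Fin n} {u : Fin n → ℝ} (hu : u x = 0) (a : ℝ)
    (u' : Fin n → ℝ) :
    overlap u' (Function.update u x a) = overlap u' u + a * u' x := by
  rw [overlap_comm, overlap_update_left hu, overlap_comm]

/-- Vectors of `A` vanish on `D`, so an entry found on `D` reveals both the chosen site and the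
value removed from `i`; every other entry is unchanged. -/
theorem moveSite_injOn {D : Finset (Fin n)} (hiD : i ∉ D)
    (havoid : ∀ w ∈ A, ∀ x ∈ D, w x = 0) (xs : (Fin n → ℝ) → Fin n) (hxs : ∀ w, xs w ∈ D) :
    Set.InjOn (fun w => if w i = 0 then w else moveSite i (xs w) w) A := by
  have hne : ∀ x ∈ D, x ≠ i := fun x hx h => hiD (h ▸ hx)
  intro w hw w' hw' h
  have hw : w ∈ A := hw
  have hw' : w' ∈ A := hw'
  simp only at h
  have hmv : ∀ v ∈ A, ∀ x ∈ D, ∀ p ∈ D, moveSite i x v p = if p = x then v i else 0 := by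
    intro v hv x _ p hp
    by_cases hpx : p = x
    · subst hpx; simp [moveSite]
    · simp [moveSite, hpx, removeSite_of_ne (hne p hp), havoid v hv p hp]
  by_cases h1 : w i = 0 <;> by_cases h2 : w' i = 0
  · simpa [h1, h2] using h
  · rw [if_pos h1, if_neg h2] at h
    have := congrFun h (xs w')
    rw [hmv w' hw' _ (hxs w') _ (hxs w'), if_pos rfl, havoid w hw _ (hxs w')] at this
    exact absurd this.symm h2
  · rw [if_neg h1, if_pos h2] at h
    have := congrFun h (xs w)
    rw [hmv w hw _ (hxs w) _ (hxs w), if_pos rfl, havoid w' hw' _ (hxs w)] at this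
    exact absurd this h1
  · rw [if_neg h1, if_neg h2] at h
    have hx := congrFun h (xs w)
    rw [hmv w hw _ (hxs w) _ (hxs w), if_pos rfl, hmv w' hw' _ (hxs w') _ (hxs w)] at hx
    have hxx : xs w = xs w' := by
      by_contra hc
      rw [if_neg hc] at hx
      exact h1 hx
    rw [if_pos hxx] at hx
    funext p
    by_cases hp : p = i
    · rw [hp, hx]
    by_cases hpx : p = xs w
    · rw [hpx, havoid w hw _ (hxs w), havoid w' hw' _ (hxs w)]
    have := congrFun h p
    rw [← hxx] at this
    simpa [moveSite, hpx, removeSite_of_ne hp] using this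

theorem tensorCube_eq_zero {w : Fin n → ℝ} {x : Fin n} (hx : w x = 0)
    {τ : Fin n × Fin n × Fin n} (hτ : τ.1 = x ∨ τ.2.1 = x ∨ τ.2.2 = x) : tensorCube w τ = 0 := by
  rcases hτ with h | h | h <;> simp [tensorCube, h, hx]

/-- The expected Gibbs average of the best field among the sites of `D`. -/
theorem integral_gibbs_sup'_field_ge (hter : ∀ w ∈ A, IsTernary w)
    {D : Finset (Fin n)} (hD : D.Nonempty) (hiD : i ∉ D)
    (havoid : ∀ w ∈ A, ∀ x ∈ D, w x = 0) (c : (Fin n → ℝ) → ℝ) {t : ℝ} (ht : 0 ≤ t) :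
    ∫ Z, gibbs A (ham (siteCoef lam K 0 i) c Z) (fun w => w i ^ 2 *
        (√((overlap (removeSite i w) (removeSite i w) + 1) ^ 3 -
          overlap (removeSite i w) (removeSite i w) ^ 3) *
        (t * (1 - Real.exp (-(D.card * (Real.exp (-(t + 1) ^ 2 / 2) / 3)))) - 1))) ∂𝐙 ≤
      ∫ Z, gibbs A (ham (siteCoef lam K 0 i) c Z) (fun w => w i ^ 2 * D.sup' hD
        (fun x => ∑ τ, Z τ * (tensorCube (moveSite i x w) τ -
          tensorCube (removeSite i w) τ))) ∂𝐙 := by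
  have hne : ∀ x ∈ D, x ≠ i := fun x hx h => hiD (h ▸ hx)
  set X := siteCoef lam K 0 i with hX
  let p : (Fin n → ℝ) → (Fin n × Fin n × Fin n → ℝ) → ℝ := fun w Z =>
    Real.exp (ham X c Z w) / ∑ w' ∈ A, Real.exp (ham X c Z w')
  let y : (Fin n → ℝ) → Fin n → Fin n × Fin n × Fin n → ℝ := fun w x τ =>
    tensorCube (moveSite i x w) τ - tensorCube (removeSite i w) τ
  let g : (Fin n → ℝ) → (Fin n × Fin n × Fin n → ℝ) → ℝ := fun w Z =>
    D.sup' hD fun x => ∑ τ, Z τ * y w x τ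
  have hpm : ∀ w, Measurable (p w) := fun w =>
    (continuous_ham X c w).rexp.measurable.div
      (Finset.measurable_sum _ fun w' _ => (continuous_ham X c w').rexp.measurable)
  have hgm : ∀ w, Measurable (g w) := fun w => by
    have : g w = D.sup' hD fun x Z => ∑ τ, Z τ * y w x τ := by
      funext Z; rw [Finset.sup'_apply]
    rw [this]
    exact Finset.sup'_induction hD _ (p := fun g => Measurable g)
      (fun _ h₁ _ h₂ => h₁.sup h₂) fun x _ => by fun_prop
  have hgi : ∀ w, Integrable (g w) 𝐙 := fun w =>
    integrable_finset_sup' hD fun x _ => integrable_linear _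
  have hp0 : ∀ w Z, 0 ≤ p w Z := fun w Z =>
    div_nonneg (Real.exp_pos _).le (Finset.sum_nonneg fun _ _ => (Real.exp_pos _).le)
  have hp1 : ∀ w ∈ A, ∀ Z, p w Z ≤ 1 := fun w hw Z =>
    div_le_one_of_le₀ (Finset.single_le_sum (f := fun w => Real.exp (ham X c Z w))
      (fun _ _ => (Real.exp_pos _).le) hw) (Finset.sum_nonneg fun _ _ => (Real.exp_pos _).le)
  have hpi : ∀ w ∈ A, Integrable (p w) 𝐙 := fun w hw =>
    Integrable.mono' (integrable_const 1) (hpm w).aestronglyMeasurable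
      (ae_of_all _ fun Z => by rw [Real.norm_of_nonneg (hp0 w Z)]; exact hp1 w hw Z)
  have hpgi : ∀ w ∈ A, Integrable (fun Z => p w Z * g w Z) 𝐙 := fun w hw =>
    (hgi w).bdd_mul (c := 1) (hpm w).aestronglyMeasurable
      (ae_of_all _ fun Z => by rw [Real.norm_of_nonneg (hp0 w Z)]; exact hp1 w hw Z)
  -- `T` collects the noise entries with an index in `D`, and `S` the others. Since all vectors of
  -- `A` vanish on `D`, the Gibbs weights depend only on `S`; the fields at the sites of `D` depend
  -- only on `T`. The two are therefore independent.
  let T : Finset (Fin n × Fin n × Fin n) :=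
    Finset.univ.filter fun τ => ∃ x ∈ D, τ.1 = x ∨ τ.2.1 = x ∨ τ.2.2 = x
  let S : Finset (Fin n × Fin n × Fin n) :=
    Finset.univ.filter fun τ => ¬ ∃ x ∈ D, τ.1 = x ∨ τ.2.1 = x ∨ τ.2.2 = x
  have hST : Disjoint S T := (Finset.disjoint_filter_filter_not _ _ _).symm
  have hpS : ∀ w ∈ A, ∀ Z Z' : Fin n × Fin n × Fin n → ℝ, (∀ τ ∈ S, Z τ = Z' τ) →
      p w Z = p w Z' := by
    intro w hw Z Z' hZ
    have : ∀ v ∈ A, ham X c Z v = ham X c Z' v := fun v hv => by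
      unfold ham
      congr 1
      refine Finset.sum_congr rfl fun τ _ => ?_
      by_cases hτ : ∃ x ∈ D, τ.1 = x ∨ τ.2.1 = x ∨ τ.2.2 = x
      · obtain ⟨x, hx, hτx⟩ := hτ
        have h1 : tensorCube (removeSite i v) τ = 0 :=
          tensorCube_eq_zero (by rw [removeSite_of_ne (hne x hx)]; exact havoid v hv x hx) hτx
        have h2 : diagCoef i τ = 0 := by
          refine if_neg fun h => ?_
          subst h
          rcases hτx with h | h | h <;> exact hne x hx h.symm
        simp [hX, siteCoef, h1, h2]
      · rw [hZ τ (by simpa [S] using hτ)]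
    simp only [p]
    rw [this w hw, Finset.sum_congr rfl fun v hv => by rw [this v hv]]
  have hgT : ∀ w, ∀ Z Z' : Fin n × Fin n × Fin n → ℝ, (∀ τ ∈ T, Z τ = Z' τ) →
      g w Z = g w Z' := by
    intro w Z Z' hZ
    refine Finset.sup'_congr hD rfl fun x hx => Finset.sum_congr rfl fun τ _ => ?_
    by_cases hτ : ∃ x ∈ D, τ.1 = x ∨ τ.2.1 = x ∨ τ.2.2 = x
    · rw [hZ τ (by simpa [T] using hτ)]
    · have h1 : τ.1 ≠ x := fun h => hτ ⟨x, hx, Or.inl h⟩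
      have h2 : τ.2.1 ≠ x := fun h => hτ ⟨x, hx, Or.inr (Or.inl h)⟩
      have h3 : τ.2.2 ≠ x := fun h => hτ ⟨x, hx, Or.inr (Or.inr h)⟩
      have : y w x τ = 0 := by
        simp [y, tensorCube, moveSite, h1, h2, h3]
      rw [this, mul_zero, mul_zero]
  set m := t * (1 - Real.exp (-(D.card * (Real.exp (-(t + 1) ^ 2 / 2) / 3)))) - 1
  let b : (Fin n → ℝ) → ℝ := fun w => overlap (removeSite i w) (removeSite i w)
  have hgain : ∀ w ∈ A, w i ≠ 0 → √((b w + 1) ^ 3 - b w ^ 3) * m ≤ ∫ Z, g w Z ∂𝐙 := by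
    intro w hw hwi
    have hsq : w i * w i = 1 := by
      rcases hter w hw i with h | h | h
      · exact absurd h hwi
      · rw [h]; norm_num
      · rw [h]; norm_num
    have hu : ∀ x ∈ D, removeSite i w x = 0 := fun x hx => by
      rw [removeSite_of_ne (hne x hx)]; exact havoid w hw x hx
    have hb0 : 0 ≤ b w := Finset.sum_nonneg fun p _ => mul_self_nonneg _
    -- The increments for distinct target sites are orthogonal, as two moved vectors then overlap
    -- exactly in `removeSite i w`. Each has squared norm `(b + 1) ^ 3 - b ^ 3`.
    have hcov : ∀ x ∈ D, ∀ x' ∈ D, ∑ τ, y w x τ * y w x' τ =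
        overlap (moveSite i x w) (moveSite i x' w) ^ 3 - b w ^ 3 := by
      intro x hx x' hx'
      have : ∀ τ, y w x τ * y w x' τ =
          tensorCube (moveSite i x w) τ * tensorCube (moveSite i x' w) τ -
          tensorCube (moveSite i x w) τ * tensorCube (removeSite i w) τ -
          (tensorCube (removeSite i w) τ * tensorCube (moveSite i x' w) τ -
          tensorCube (removeSite i w) τ * tensorCube (removeSite i w) τ) := fun τ => by
        simp only [y]; ring
      simp only [this, Finset.sum_sub_distrib, sum_tensorCube_mul]
      have h1 : overlap (moveSite i x w) (removeSite i w) = b w := by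
        rw [moveSite, overlap_update_left (hu x hx), hu x hx]; simp [b]
      have h2 : overlap (removeSite i w) (moveSite i x' w) = b w := by
        rw [overlap_comm, moveSite, overlap_update_left (hu x' hx'), hu x' hx']; simp [b]
      rw [h1, h2]; simp only [b]; ring
    have hov : ∀ x ∈ D, ∀ x' ∈ D, overlap (moveSite i x w) (moveSite i x' w) =
        b w + if x = x' then 1 else 0 := by
      intro x hx x' hx'
      rw [moveSite, overlap_update_left (hu x hx), moveSite, overlap_update_right (hu x' hx'),
        hu x' hx']
      by_cases h : x = x'
      · subst h; simp [b, hsq]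
      · simp [b, h, hu x hx]
    refine integral_sup'_linear_ge hD (y w) (s := (b w + 1) ^ 3 - b w ^ 3) (by nlinarith)
      (fun x hx => ?_) (fun x hx x' hx' hxx' => ?_) ht
    · simp only [sq (y w x _)]
      rw [hcov x hx x hx, hov x hx x hx, if_pos rfl]
    · rw [hcov x hx x' hx', hov x hx x' hx', if_neg hxx', add_zero, sub_self]
  simp only [gibbs_eq_sum]
  rw [integral_finsetSum, integral_finsetSum]
  · refine Finset.sum_le_sum fun w hw => ?_
    change ∫ Z, p w Z * (w i ^ 2 * (√((b w + 1) ^ 3 - b w ^ 3) * m)) ∂𝐙 ≤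
      ∫ Z, p w Z * (w i ^ 2 * g w Z) ∂𝐙
    by_cases hwi : w i = 0
    · simp [hwi]
    have e : ∀ Z, p w Z * (w i ^ 2 * g w Z) = w i ^ 2 * (p w Z * g w Z) := fun Z => by ring
    simp only [e]
    rw [integral_const_mul, integral_mul_const,
      integral_mul_of_disjoint_coord hST (hpm w) (hgm w) (hpS w hw) (hgT w)]
    have h0 : 0 ≤ ∫ Z, p w Z ∂𝐙 := integral_nonneg (hp0 w)
    have := mul_le_mul_of_nonneg_left (hgain w hw hwi) h0
    nlinarith [sq_nonneg (w i), mul_le_mul_of_nonneg_left this (sq_nonneg (w i))]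
  · intro w hw
    refine ((hpgi w hw).const_mul (w i ^ 2)).congr (ae_of_all _ fun Z => ?_)
    simp only [p, g, y]; ring
  · intro w hw
    exact (hpi w hw).mul_const _

/-- Relocating the site `i` to the best site of `D`. -/
theorem integral_lse_site_relocate (hA : A.Nonempty) (hter : ∀ w ∈ A, IsTernary w)
    (hlam : 0 ≤ lam) (hK : 1 ≤ K) (hr : 1 ≤ r) (hKr : K * Real.exp (-r ^ 2 / 2) ≤ 1)
    {D : Finset (Fin n)} (hD : D.Nonempty) (hiD : i ∉ D)
    (havoid : ∀ w ∈ A, ∀ x ∈ D, w x = 0) {A' : Finset (Fin n → ℝ)}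
    {c c' B : (Fin n → ℝ) → ℝ} {γ t : ℝ} (ht : 0 ≤ t)
    (h0 : ∀ w ∈ A, w i = 0 → w ∈ A' ∧ c w ≤ c' w)
    (h1 : ∀ w ∈ A, w i ≠ 0 → ∀ x ∈ D, moveSite i x w ∈ A' ∧ c w ≤ c' (moveSite i x w) + γ)
    (hB0 : ∀ w ∈ A, w i = 0 → B w = 0)
    (hB : ∀ w ∈ A, w i ≠ 0 → B w + γ + lam * (K * r) ≤
      lam * (√((overlap (removeSite i w) (removeSite i w) + 1) ^ 3 -
          overlap (removeSite i w) (removeSite i w) ^ 3) *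
        (t * (1 - Real.exp (-(D.card * (Real.exp (-(t + 1) ^ 2 / 2) / 3)))) - 1))) :
    ∫ Z, lse A (ham (siteCoef lam K 0 i) (fun w => c w + B w) Z) ∂𝐙 ≤
      ∫ Z, lse A' (ham (fun w τ => lam * tensorCube w τ) c' Z) ∂𝐙 + 2 * lam := by
  set X := siteCoef lam K 0 i with hX
  set cB := fun w => c w + B w
  set b : (Fin n → ℝ) → ℝ := fun w => overlap (removeSite i w) (removeSite i w)
  set m := t * (1 - Real.exp (-(D.card * (Real.exp (-(t + 1) ^ 2 / 2) / 3)))) - 1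
  let G : (Fin n → ℝ) → (Fin n × Fin n × Fin n → ℝ) → ℝ := fun w Z =>
    D.sup' hD fun x => ∑ τ, Z τ * (tensorCube (moveSite i x w) τ - tensorCube (removeSite i w) τ)
  have hsq : ∀ w ∈ A, w i ≠ 0 → w i ^ 2 = 1 := fun w hw hwi => by
    rcases hter w hw i with h | h | h
    · exact absurd h hwi
    · rw [h]; norm_num
    · rw [h]; norm_num
  obtain ⟨w₀, hw₀⟩ := hA
  have hA : A.Nonempty := ⟨w₀, hw₀⟩
  have hA' : A'.Nonempty := by
    obtain ⟨x, hx⟩ := hD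
    by_cases h : w₀ i = 0
    · exact ⟨_, (h0 w₀ hw₀ h).1⟩
    · exact ⟨_, (h1 w₀ hw₀ h x hx).1⟩
  have hGi : ∀ w, Integrable (G w) 𝐙 := fun w =>
    integrable_finset_sup' hD fun x _ => integrable_linear _
  have hGm : ∀ w, Measurable (G w) := fun w => by
    have : G w = D.sup' hD fun x Z => ∑ τ, Z τ * (tensorCube (moveSite i x w) τ -
        tensorCube (removeSite i w) τ) := by
      funext Z; rw [Finset.sup'_apply]
    rw [this]
    exact Finset.sup'_induction hD _ (p := fun g => Measurable g)
      (fun _ h₁ _ h₂ => h₁.sup h₂) fun x _ => by fun_prop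
  have hpt : ∀ Z, lse A (ham X cB Z) + (lam * gibbs A (ham X cB Z) (fun w => w i ^ 2 * G w Z) -
      lam * K * gibbs A (ham X cB Z) (fun w => |Z (i, i, i)| * w i ^ 2) -
      gibbs A (ham X cB Z) (fun w => w i ^ 2 * (γ + B w))) ≤
      lse A' (ham (fun w τ => lam * tensorCube w τ) c' Z) := fun Z => by
    -- For each `w` the target is the site of `D` with the largest field; it may depend on `Z`.
    choose xs hxs hxs' using fun w => Finset.exists_mem_eq_sup' hD
      fun x => ∑ τ, Z τ * (tensorCube (moveSite i x w) τ - tensorCube (removeSite i w) τ)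
    let S : (Fin n → ℝ) → Fin n → ℝ := fun w => if w i = 0 then w else moveSite i (xs w) w
    have hcomp := lse_comp_le (B := A') hA (T := S) (fun w hw => by
      by_cases h : w i = 0
      · simpa [S, h] using (h0 w hw h).1
      · simpa [S, h] using (h1 w hw h _ (hxs w)).1) (moveSite_injOn hiD havoid xs hxs)
      (ham (fun w τ => lam * tensorCube w τ) c' Z)
    refine le_trans (le_trans (add_le_add le_rfl ?_) (lse_add_gibbs_le hA (ham X cB Z)
      fun w => ham (fun w τ => lam * tensorCube w τ) c' Z (S w))) hcomp
    rw [← gibbs_const_mul, ← gibbs_const_mul, ← gibbs_sub, ← gibbs_sub]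
    refine gibbs_mono _ fun w hw => ?_
    have hXw : ∑ τ, Z τ * X w τ = lam * ∑ τ, Z τ * tensorCube (removeSite i w) τ +
        lam * K * (w i * Z (i, i, i)) := by
      rw [← sum_mul_diagCoef Z i, Finset.mul_sum, Finset.mul_sum, Finset.mul_sum,
        ← Finset.sum_add_distrib]
      exact Finset.sum_congr rfl fun τ _ => by simp only [hX, siteCoef]; ring
    have hS : ∀ v : Fin n → ℝ, ∑ τ, Z τ * (lam * tensorCube v τ) =
        lam * ∑ τ, Z τ * tensorCube v τ := fun v => by
      rw [Finset.mul_sum]; exact Finset.sum_congr rfl fun τ _ => by ring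
    simp only [ham, hXw, hS, cB]
    by_cases hwi : w i = 0
    · have hrem : removeSite i w = w := by
        rw [removeSite, ← hwi, Function.update_eq_self]
      simp only [S, hwi, if_true, hrem, hB0 w hw hwi]
      have := (h0 w hw hwi).2
      simp only [ne_eq, OfNat.ofNat_ne_zero, not_false_eq_true, zero_pow, zero_mul, mul_zero]
      linarith
    · have h2 := (h1 w hw hwi _ (hxs w)).2
      have hGw : G w Z = ∑ τ, Z τ * tensorCube (moveSite i (xs w) w) τ -
          ∑ τ, Z τ * tensorCube (removeSite i w) τ := by
        rw [← Finset.sum_sub_distrib]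
        refine (hxs' w).trans (Finset.sum_congr rfl fun τ _ => by ring)
      have h3 : w i * Z (i, i, i) ≤ |Z (i, i, i)| := by
        have := (hter w hw).sq_eq_abs i
        rw [hsq w hw hwi] at this
        calc _ ≤ |w i * Z (i, i, i)| := le_abs_self _
          _ = _ := by rw [abs_mul, ← this, one_mul]
      have h4 : 0 ≤ lam * K := by positivity
      have h5 := mul_le_mul_of_nonneg_left h3 h4
      simp only [S, hwi, if_false, hsq w hw hwi, hGw]
      linarith
  have hi1 : Integrable (fun Z => gibbs A (ham X cB Z) (fun w => w i ^ 2 * G w Z)) 𝐙 :=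
    integrable_gibbs_ham X cB (fun w => (hGm w).const_mul _) fun w => (hGi w).const_mul _
  have hi2 : Integrable (fun Z => gibbs A (ham X cB Z) (fun w => |Z (i, i, i)| * w i ^ 2)) 𝐙 :=
    integrable_gibbs_ham X cB (fun a => (by fun_prop :
      Measurable fun Z : Fin n × Fin n × Fin n → ℝ => |Z (i, i, i)| * a i ^ 2))
      fun _ => (integrable_coord _).abs.mul_const _
  have hconst : ∀ f : (Fin n → ℝ) → ℝ, Integrable (fun Z => gibbs A (ham X cB Z) f) 𝐙 := fun f =>
    integrable_gibbs_ham X cB (fun _ => measurable_const) fun _ => integrable_const _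
  have hlow := integral_gibbs_sup'_field_ge (lam := lam) (K := K) hter hD hiD havoid cB ht
  have hdiag := integral_gibbs_abs_diag_le (i := i) hA hter (by linarith) hr hKr X cB
  have hi3 : Integrable (fun Z => lam * gibbs A (ham X cB Z) (fun w => w i ^ 2 * G w Z) -
      lam * K * gibbs A (ham X cB Z) (fun w => |Z (i, i, i)| * w i ^ 2)) 𝐙 :=
    (hi1.const_mul lam).sub (hi2.const_mul (lam * K))
  have hint := integral_mono ((integrable_lse_ham hA X cB).add (hi3.sub (hconst _)))
    (integrable_lse_ham hA' _ c') hpt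
  rw [integral_add' (integrable_lse_ham hA X cB) (hi3.sub (hconst _)),
    integral_sub' hi3 (hconst _),
    integral_sub (hi1.const_mul lam) (hi2.const_mul (lam * K)), integral_const_mul,
    integral_const_mul] at hint
  -- On configurations occupying `i` the expected best field pays for the bonus `B`, the reward `γ`
  -- and the loss of the amplified diagonal term. The tail of the latter leaves the additive `2 *
  -- lam`.
  have hbal : ∫ Z, gibbs A (ham X cB Z) (fun w => w i ^ 2 * (γ + B w)) ∂𝐙 +
      lam * (K * r * ∫ Z, gibbs A (ham X cB Z) (fun w => w i ^ 2) ∂𝐙) ≤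
      lam * ∫ Z, gibbs A (ham X cB Z) (fun w => w i ^ 2 *
        (√((b w + 1) ^ 3 - b w ^ 3) * m)) ∂𝐙 := by
    rw [← integral_const_mul (K * r), ← integral_const_mul lam, ← integral_const_mul lam,
      ← integral_add (hconst _) (((hconst _).const_mul _).const_mul _)]
    refine integral_mono ((hconst _).add (((hconst _).const_mul _).const_mul _))
      ((hconst _).const_mul _) fun Z => ?_
    simp only [← gibbs_const_mul, ← gibbs_add]
    refine gibbs_mono _ fun w hw => ?_
    by_cases hwi : w i = 0
    · simp [hwi]
    have := hB w hw hwi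
    rw [hsq w hw hwi]
    simp only [one_mul, mul_one]
    linarith
  have hA1 := mul_le_mul_of_nonneg_left hlow hlam
  have hA2 := mul_le_mul_of_nonneg_left hdiag hlam
  have hG : ∫ Z, gibbs A (ham X cB Z) (fun w => w i ^ 2 * G w Z) ∂𝐙 =
    ∫ Z, gibbs A (ham (siteCoef lam K 0 i) cB Z) (fun w => w i ^ 2 * D.sup' hD
        (fun x => ∑ τ, Z τ * (tensorCube (moveSite i x w) τ -
          tensorCube (removeSite i w) τ))) ∂𝐙 := rfl
  rw [← hG] at hA1
  linarith

end Relocation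

/-! ### Entropy bounds and the choice of an avoidable block -/

section Elimination

variable {n : ℕ}

local notation "𝐙" => stdGaussianNoise (Fin n × Fin n × Fin n)

/-- Restricting the configurations to those that are not hit costs little when hits are rare. -/
theorem lse_le_lse_filter_add {Ω : Type*} {A : Finset Ω} (hA : A.Nonempty) (hit : Ω → Prop)
    [DecidablePred hit] (T : Ω → Ω) (hT : ∀ a ∈ A, T a ∈ A ∧ ¬ hit (T a)) (X : Ω → ℝ) :
    lse A X ≤ lse (A.filter fun a => ¬ hit a) X + Real.log 2 +
      gibbs A X (fun a => if hit a then X a - X (T a) + Real.log A.card else 0) := by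
  set A₀ := A.filter fun a => ¬ hit a
  have hA₀ : A₀.Nonempty := by
    obtain ⟨a, ha⟩ := hA
    exact ⟨T a, Finset.mem_filter.2 (hT a ha)⟩
  set N : ℝ := (A.card : ℝ)
  have hN : 0 < N := by simpa [N] using hA.card_pos
  -- A hit configuration is given the energy of its unhit substitute, lowered by `log (card A)`.
  -- Together the hit configurations then weigh at most one copy of the unhit partition function,
  -- which explains `log 2`.
  let X' : Ω → ℝ := fun a => if hit a then X (T a) - Real.log N else X a
  have h1 := lse_add_gibbs_le hA X X'
  have h2 : gibbs A X (fun a => X' a - X a) =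
      -gibbs A X (fun a => if hit a then X a - X (T a) + Real.log N else 0) := by
    rw [← neg_one_mul, ← gibbs_const_mul]
    refine gibbs_congr _ fun a _ => ?_
    by_cases h : hit a
    · simp only [X', h, if_true]; ring
    · simp [X', h]
  have h3 : lse A X' ≤ lse A₀ X + Real.log 2 := by
    have hpos := partition_pos hA₀ X
    rw [lse, lse, ← Real.log_mul hpos.ne' (by norm_num)]
    refine Real.log_le_log (partition_pos hA X') ?_
    rw [← Finset.sum_filter_add_sum_filter_not A hit]
    have e1 : ∑ a ∈ A.filter hit, Real.exp (X' a) ≤ ∑ a ∈ A₀, Real.exp (X a) := by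
      calc ∑ a ∈ A.filter hit, Real.exp (X' a)
          ≤ ∑ _a ∈ A.filter hit, (∑ b ∈ A₀, Real.exp (X b)) / N := by
            refine Finset.sum_le_sum fun a ha => ?_
            obtain ⟨ha, hh⟩ := Finset.mem_filter.1 ha
            simp only [X', hh, if_true]
            rw [Real.exp_sub, Real.exp_log hN]
            gcongr
            exact Finset.single_le_sum (f := fun a => Real.exp (X a))
              (fun _ _ => (Real.exp_pos _).le) (Finset.mem_filter.2 (hT a ha))
        _ = (A.filter hit).card * ((∑ b ∈ A₀, Real.exp (X b)) / N) := by
            rw [Finset.sum_const, nsmul_eq_mul]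
        _ ≤ N * ((∑ b ∈ A₀, Real.exp (X b)) / N) := by
            gcongr
            exact Nat.cast_le.2 (Finset.card_filter_le _ _)
        _ = _ := by field_simp
    have e2 : ∑ a ∈ A.filter (fun a => ¬ hit a), Real.exp (X' a) = ∑ a ∈ A₀, Real.exp (X a) := by
      refine Finset.sum_congr rfl fun a ha => ?_
      simp [X', (Finset.mem_filter.1 ha).2]
    rw [e2]; linarith
  linarith

/-- The support of the prior on vectors: ternary vectors with between `k / 2` and `2 k` nonzero
entries. -/
def sparseTernary (n k : ℕ) : Finset (Fin n → ℝ) :=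
  (Fintype.piFinset fun _ => ({0, 1, -1} : Finset ℝ)).filter
    fun w => k ≤ 2 * hammingNorm w ∧ hammingNorm w ≤ 2 * k

theorem mem_ternary {w : Fin n → ℝ} :
    w ∈ Fintype.piFinset (fun _ : Fin n => ({0, 1, -1} : Finset ℝ)) ↔ IsTernary w := by
  simp [IsTernary]

theorem mem_sparseTernary {k : ℕ} {w : Fin n → ℝ} :
    w ∈ sparseTernary n k ↔ IsTernary w ∧ k ≤ 2 * hammingNorm w ∧ hammingNorm w ≤ 2 * k := by
  rw [sparseTernary, Finset.mem_filter, mem_ternary]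

theorem IsTernary.sq_eq_ite {w : Fin n → ℝ} (hw : IsTernary w) (p : Fin n) :
    w p ^ 2 = if w p ≠ 0 then 1 else 0 := by
  rcases hw p with h | h | h <;> rw [h] <;> norm_num

theorem IsTernary.overlap_self {w : Fin n → ℝ} (hw : IsTernary w) :
    overlap w w = hammingNorm w := by
  simp only [overlap, ← sq, hw.sq_eq_ite, hammingNorm, Finset.card_filter]
  push_cast
  rfl

theorem sum_ternary_prod (f : Fin n → ℝ → ℝ) :
    ∑ w ∈ Fintype.piFinset (fun _ : Fin n => ({0, 1, -1} : Finset ℝ)), ∏ p, f p (w p) =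
      ∏ p, (f p 0 + f p 1 + f p (-1)) := by
  rw [← Finset.prod_univ_sum]
  refine Finset.prod_congr rfl fun p _ => ?_
  have h1 : (0 : ℝ) ∉ ({1, -1} : Finset ℝ) := by simp
  have h2 : (1 : ℝ) ∉ ({-1} : Finset ℝ) := by simp; norm_num
  rw [Finset.sum_insert h1, Finset.sum_insert h2, Finset.sum_singleton]; ring

theorem one_add_two_div_pow_le (hn : 0 < n) (m : ℕ) (hm : m ≤ n) :
    (1 + 2 / (n : ℝ)) ^ m ≤ Real.exp 2 := by
  have hn' : (0 : ℝ) < n := by exact_mod_cast hn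
  calc (1 + 2 / (n : ℝ)) ^ m ≤ (1 + 2 / (n : ℝ)) ^ n :=
        pow_le_pow_right₀ (by linarith [div_pos (two_pos (α := ℝ)) hn']) hm
    _ ≤ (Real.exp (2 / n)) ^ n := by
        gcongr
        linarith [Real.add_one_le_exp (2 / (n : ℝ))]
    _ = Real.exp 2 := by rw [← Real.exp_nat_mul]; congr 1; field_simp

theorem exp_two_le : Real.exp 2 ≤ 8 := by
  have h := Real.exp_one_lt_d9
  have : Real.exp 2 = Real.exp 1 * Real.exp 1 := by rw [← Real.exp_add]; norm_num
  rw [this]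
  nlinarith [Real.exp_pos 1]

/-- The entropy bound, weighted on vectors occupying `i`. -/
theorem sum_ternary_occupied_le (hn : 0 < n) (i : Fin n) :
    ∑ w ∈ Fintype.piFinset (fun _ : Fin n => ({0, 1, -1} : Finset ℝ)),
      w i ^ 2 * Real.exp (-Real.log n * overlap (removeSite i w) (removeSite i w)) ≤ 16 := by
  have hn' : (0 : ℝ) < n := by exact_mod_cast hn
  -- The weight factorizes over sites. A site other than `i` contributes `1 + 2 / n` and the site
  -- `i` contributes `2`, so the sum is at most `2 * exp 2 ≤ 16`.
  let f : Fin n → ℝ → ℝ := fun p a => if p = i then a ^ 2 else Real.exp (-Real.log n * (a * a))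
  have e : ∀ w : Fin n → ℝ, w i ^ 2 * Real.exp (-Real.log n *
      overlap (removeSite i w) (removeSite i w)) = ∏ p, f p (w p) := fun w => by
    rw [← Finset.mul_prod_erase _ _ (Finset.mem_univ i), overlap,
      ← Finset.add_sum_erase _ _ (Finset.mem_univ i)]
    simp only [removeSite_self, mul_zero, zero_add, Finset.mul_sum, Real.exp_sum]
    congr 1
    · simp [f]
    · refine Finset.prod_congr rfl fun p hp => ?_
      have hp := Finset.ne_of_mem_erase hp
      simp [f, hp, removeSite_of_ne hp]
  rw [Finset.sum_congr rfl fun w _ => e w, sum_ternary_prod,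
    ← Finset.mul_prod_erase _ _ (Finset.mem_univ i)]
  have e2 : ∀ p ∈ Finset.univ.erase i, f p 0 + f p 1 + f p (-1) = 1 + 2 / n := fun p hp => by
    simp only [f, Finset.ne_of_mem_erase hp, if_false]
    norm_num
    rw [Real.exp_neg, Real.exp_log hn']
    ring
  rw [Finset.prod_congr rfl e2, Finset.prod_const]
  have e3 : f i 0 + f i 1 + f i (-1) = 2 := by simp [f]; norm_num
  rw [e3]
  have := one_add_two_div_pow_le hn (Finset.univ.erase i).card
    ((Finset.card_le_univ _).trans (by simp))
  linarith [exp_two_le]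

/-- Over all ternary vectors `n ^ (-overlap w w)` sums to at most `exp 2`, and each sparse vector
contributes at least `n ^ (-2 * k)`. -/
theorem log_card_sparseTernary_le (hn : 0 < n) (k : ℕ) :
    Real.log (sparseTernary n k).card ≤ 2 + 2 * k * Real.log n := by
  have hn' : (0 : ℝ) < n := by exact_mod_cast hn
  have hlog : 0 ≤ Real.log n := Real.log_natCast_nonneg n
  rcases (sparseTernary n k).eq_empty_or_nonempty with h | h
  · rw [h]; simp; positivity
  rw [Real.log_le_iff_le_exp (by exact_mod_cast h.card_pos), Real.exp_add]
  let f : Fin n → ℝ → ℝ := fun _ a => Real.exp (-Real.log n * (a * a))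
  have e : ∀ w : Fin n → ℝ, ∏ p, f p (w p) = Real.exp (-Real.log n * overlap w w) := fun w => by
    rw [overlap, Finset.mul_sum, Real.exp_sum]
  have h1 : ∑ w ∈ Fintype.piFinset (fun _ : Fin n => ({0, 1, -1} : Finset ℝ)), ∏ p, f p (w p) ≤
      Real.exp 2 := by
    rw [sum_ternary_prod]
    have e2 : ∀ p ∈ Finset.univ, f p 0 + f p 1 + f p (-1) = 1 + 2 / n := fun p _ => by
      simp only [f]
      norm_num
      rw [Real.exp_neg, Real.exp_log hn']
      ring
    rw [Finset.prod_congr rfl e2, Finset.prod_const, Finset.card_univ, Fintype.card_fin]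
    exact one_add_two_div_pow_le hn n le_rfl
  calc ((sparseTernary n k).card : ℝ) = ∑ w ∈ sparseTernary n k, 1 := by simp
    _ ≤ ∑ w ∈ sparseTernary n k, (∏ p, f p (w p)) * Real.exp (2 * k * Real.log n) := by
        refine Finset.sum_le_sum fun w hw => ?_
        obtain ⟨hw1, _, hw2⟩ := mem_sparseTernary.1 hw
        rw [e, ← Real.exp_add, hw1.overlap_self]
        refine Real.one_le_exp ?_
        have : (hammingNorm w : ℝ) ≤ 2 * k := by exact_mod_cast hw2
        nlinarith
    _ = (∑ w ∈ sparseTernary n k, (∏ p, f p (w p))) * Real.exp (2 * k * Real.log n) := by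
        rw [Finset.sum_mul]
    _ ≤ _ := by
        gcongr
        refine le_trans ?_ h1
        refine Finset.sum_le_sum_of_subset_of_nonneg (Finset.filter_subset _ _) fun w _ _ => ?_
        exact Finset.prod_nonneg fun p _ => (Real.exp_pos _).le

theorem hammingNorm_eq_card (w : Fin n → ℝ) :
    hammingNorm w = (Finset.univ.filter fun p => w p ≠ 0).card := rfl

/-- A ternary vector can be modified off a set `S` so as to avoid a set `D`. -/
theorem exists_avoiding {S D : Finset (Fin n)} {w : Fin n → ℝ} (hw : IsTernary w)
    (hSD : Disjoint S D) {m : ℕ} (hm : hammingNorm w ≤ m) (hcard : S.card + D.card + 2 * m ≤ n) :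
    ∃ w' : Fin n → ℝ, IsTernary w' ∧ hammingNorm w' = hammingNorm w ∧ (∀ p ∈ S, w' p = w p) ∧
      ∀ x ∈ D, w' x = 0 := by
  classical
  set U := Finset.univ.filter fun p => w p ≠ 0
  have hUm : U.card ≤ m := hm
  -- There is room off `S ∪ D ∪ U` to re-create the entries deleted on `D`: one `m` in `hcard` pays
  -- for the support `U`, the other for the new entries.
  have hfree : (U ∩ D).card ≤ (Finset.univ \ (S ∪ D ∪ U)).card := by
    have h1 := Finset.card_sdiff_add_card_eq_card (Finset.subset_univ (S ∪ D ∪ U))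
    rw [Finset.card_univ, Fintype.card_fin] at h1
    have h2 := Finset.card_union_le (S ∪ D) U
    have h3 := Finset.card_union_le S D
    have h4 := Finset.card_le_card (Finset.inter_subset_left (s₁ := U) (s₂ := D))
    omega
  obtain ⟨E, hE, hEc⟩ := Finset.exists_subset_card_eq hfree
  have hE' : ∀ p ∈ E, p ∉ S ∧ p ∉ D ∧ p ∉ U := fun p hp => by
    have := hE hp
    simp only [Finset.mem_sdiff, Finset.mem_univ, true_and, Finset.mem_union, not_or] at this
    exact ⟨this.1.1, this.1.2, this.2⟩
  refine ⟨fun p => if p ∈ D then 0 else if p ∈ E then 1 else w p, fun p => ?_, ?_, fun p hp => ?_,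
    fun x hx => by simp [hx]⟩
  · by_cases h1 : p ∈ D
    · simp [h1]
    · by_cases h2 : p ∈ E
      · simp [h1, h2]
      · simpa [h1, h2] using hw p
  · have : (Finset.univ.filter fun p => (if p ∈ D then (0 : ℝ) else if p ∈ E then 1 else w p) ≠ 0) =
        (U \ D) ∪ E := by
      ext p
      simp only [Finset.mem_filter, Finset.mem_univ, true_and, Finset.mem_union, Finset.mem_sdiff, U]
      by_cases h1 : p ∈ D
      · have : p ∉ E := fun h => (hE' p h).2.1 h1
        simp [h1, this]
      · by_cases h2 : p ∈ E <;> simp [h1, h2]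
    rw [hammingNorm_eq_card, hammingNorm_eq_card, this, Finset.card_union_of_disjoint, hEc]
    · have := Finset.card_sdiff_add_card_inter U D
      omega
    · refine Finset.disjoint_left.2 fun p hp hpE => (hE' p hpE).2.2 (Finset.mem_sdiff.1 hp).1
  · have h1 : p ∉ D := Finset.disjoint_left.1 hSD hp
    have h2 : p ∉ E := fun h => (hE' p h).1 hp
    simp [h1, h2]

/-- Disjoint blocks of equal size off a given set. -/
theorem exists_disjoint_blocks (S : Finset (Fin n)) {B M : ℕ} (h : B * M + S.card ≤ n) :
    ∃ D : Fin B → Finset (Fin n), (∀ r, (D r).card = M) ∧ (∀ r, Disjoint S (D r)) ∧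
      ∀ r r', r ≠ r' → Disjoint (D r) (D r') := by
  classical
  have hc : Fintype.card (Fin B × Fin M) ≤ Fintype.card {p // p ∉ S} := by
    rw [Fintype.card_prod, Fintype.card_fin, Fintype.card_fin, Fintype.card_subtype_compl,
      Fintype.card_fin, Fintype.card_coe]
    omega
  obtain ⟨e⟩ := Function.Embedding.nonempty_of_card_le hc
  have he : ∀ a b, (e a : Fin n) = e b → a = b := fun a b hab => e.injective (Subtype.ext hab)
  refine ⟨fun r => Finset.univ.image fun m => (e (r, m) : Fin n), fun r => ?_, fun r => ?_,
    fun r r' hr => ?_⟩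
  · rw [Finset.card_image_of_injective _ fun m m' hm => by simpa using he _ _ hm]
    simp
  · refine Finset.disjoint_right.2 fun p hp => ?_
    obtain ⟨m, _, rfl⟩ := Finset.mem_image.1 hp
    exact (e (r, m)).2
  · refine Finset.disjoint_left.2 fun p hp hp' => ?_
    obtain ⟨m, _, rfl⟩ := Finset.mem_image.1 hp
    obtain ⟨m', _, hm'⟩ := Finset.mem_image.1 hp'
    have := he _ _ hm'
    simp only [Prod.mk.injEq] at this
    exact hr this.1.symm

/-- Each vector hits at most as many disjoint blocks as it has nonzero entries. -/
theorem card_hit_blocks_le {B : ℕ} {D : Fin B → Finset (Fin n)}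
    (hD : ∀ r r', r ≠ r' → Disjoint (D r) (D r')) (w : Fin n → ℝ) :
    (Finset.univ.filter fun r => ∃ x ∈ D r, w x ≠ 0).card ≤ hammingNorm w := by
  classical
  rw [hammingNorm_eq_card]
  have h : ∀ r ∈ Finset.univ.filter (fun r => ∃ x ∈ D r, w x ≠ 0), ∃ x, x ∈ D r ∧ w x ≠ 0 :=
    fun r hr => by simpa using hr
  rcases isEmpty_or_nonempty (Fin n) with hn | hn
  · have : ∀ r ∈ Finset.univ.filter (fun r => ∃ x ∈ D r, w x ≠ 0), False := fun r hr => by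
      obtain ⟨x, _⟩ := h r hr
      exact hn.elim x
    rw [Finset.eq_empty_of_forall_notMem this]
    simp
  choose! f hf using h
  refine Finset.card_le_card_of_injOn f (fun r hr => ?_) fun r hr r' hr' he => ?_
  · simpa using (hf r hr).2
  · by_contra hne
    have h1 := (hf r hr).1
    have h2 := (hf r' hr').1
    rw [he] at h1
    exact Finset.disjoint_left.1 (hD r r' hne) h1 h2

/-- The Hamiltonian of the spiked tensor model without the signal. -/
def tensorCoef (lam : ℝ) (w : Fin n → ℝ) (τ : Fin n × Fin n × Fin n) : ℝ := lam * tensorCube w τ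

theorem tensorCoef_sum (lam : ℝ) (w : Fin n → ℝ) :
    ∑ τ, tensorCoef lam w τ ^ 2 = lam ^ 2 * overlap w w ^ 3 := by
  have : ∀ τ, tensorCoef lam w τ ^ 2 = lam ^ 2 * (tensorCube w τ * tensorCube w τ) := fun τ => by
    simp only [tensorCoef]; ring
  rw [Finset.sum_congr rfl fun τ _ => this τ, ← Finset.mul_sum, sum_tensorCube_mul]

/-- A bound for the largest absolute energy over a family of sparse vectors. -/
theorem exists_energy_bound {k : ℕ} (hn : 0 < n) (hk : 4 ≤ k) (hlogn : Real.log n ≤ k) {lam : ℝ}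
    (hlam : 0 < lam) {A : Finset (Fin n → ℝ)} (hAk : A ⊆ sparseTernary n k) :
    ∃ E : (Fin n × Fin n × Fin n → ℝ) → ℝ, Integrable E 𝐙 ∧ ∫ Z, E Z ∂𝐙 ≤ 8 * lam * k ^ 3 ∧
      (∀ Z, 0 ≤ E Z) ∧ ∀ Z, ∀ w ∈ A, |∑ τ, Z τ * tensorCoef lam w τ| ≤ E Z := by
  have hk' : (4 : ℝ) ≤ k := by exact_mod_cast hk
  set N : ℝ := ((sparseTernary n k).card : ℝ)
  -- The variance is at most `lam ^ 2 * (2 * k) ^ 3`, so with `θ = lam⁻¹` this level makes each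
  -- expected overshoot at most `2 * lam / N`, and a union over the `N` vectors costs `2 * lam`.
  set a₀ : ℝ := lam * (4 * k ^ 3 + Real.log N)
  have hlogN : 0 ≤ Real.log N := Real.log_natCast_nonneg _
  have ha₀ : 0 ≤ a₀ := by positivity
  let e : (Fin n → ℝ) → (Fin n × Fin n × Fin n → ℝ) → ℝ := fun w Z =>
    max (|∑ τ, Z τ * tensorCoef lam w τ| - a₀) 0
  have hei : ∀ w, Integrable (e w) 𝐙 := fun w => integrable_abs_linear_sub_posPart _ _
  have hsum : Integrable (fun Z => ∑ w ∈ sparseTernary n k, e w Z) 𝐙 :=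
    integrable_finsetSum _ fun w _ => hei w
  refine ⟨fun Z => a₀ + ∑ w ∈ sparseTernary n k, e w Z, (integrable_const _).add hsum, ?_,
    fun Z => ?_, fun Z w hw => ?_⟩
  · rw [integral_add (integrable_const _) hsum, integral_finsetSum _ fun w _ => hei w]
    have hw : ∀ w ∈ sparseTernary n k, ∫ Z, e w Z ∂𝐙 ≤ 2 * lam / N := fun w hw => by
      have hN : 0 < N := by
        exact Nat.cast_pos.2 (Finset.card_pos.2 ⟨w, hw⟩)
      obtain ⟨h1, _, h2⟩ := mem_sparseTernary.1 hw
      have h3 : (hammingNorm w : ℝ) ≤ 2 * k := by exact_mod_cast h2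
      refine (integral_abs_linear_sub_posPart_le (tensorCoef lam w) (θ := lam⁻¹) (by positivity)
        (b := a₀)).trans ?_
      rw [tensorCoef_sum, h1.overlap_self, inv_inv]
      have h4 : (lam⁻¹) ^ 2 * (lam ^ 2 * (hammingNorm w : ℝ) ^ 3) / 2 - lam⁻¹ * a₀ ≤
          -Real.log N := by
        have e1 : (lam⁻¹) ^ 2 * (lam ^ 2 * (hammingNorm w : ℝ) ^ 3) = (hammingNorm w : ℝ) ^ 3 := by
          field_simp
        have e2 : lam⁻¹ * a₀ = 4 * k ^ 3 + Real.log N := by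
          simp only [a₀]; field_simp
        rw [e1, e2]
        have : (hammingNorm w : ℝ) ^ 3 ≤ (2 * k) ^ 3 := by gcongr
        nlinarith
      have h5 := Real.exp_le_exp.2 h4
      rw [Real.exp_neg, Real.exp_log hN] at h5
      calc _ ≤ 2 * (lam * N⁻¹) := by gcongr
        _ = _ := by ring
    have hs := Finset.sum_le_sum hw
    rw [Finset.sum_const, nsmul_eq_mul] at hs
    have h6 : N * (2 * lam / N) ≤ 2 * lam := by
      rcases eq_or_ne N 0 with h | h
      · rw [h]; simp; positivity
      · field_simp; rfl
    have h7 : Real.log N ≤ 2 + 2 * k * k := by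
      refine (log_card_sparseTernary_le hn k).trans ?_
      gcongr
    have h8 : a₀ + 2 * lam ≤ 8 * lam * k ^ 3 := by
      have : 4 * (k : ℝ) ^ 3 + Real.log N + 2 ≤ 8 * k ^ 3 := by nlinarith [sq_nonneg (k : ℝ)]
      calc a₀ + 2 * lam = lam * (4 * k ^ 3 + Real.log N + 2) := by simp only [a₀]; ring
        _ ≤ lam * (8 * k ^ 3) := by gcongr
        _ = _ := by ring
    simp only [integral_const, probReal_univ, one_smul]
    linarith
  · exact add_nonneg ha₀ (Finset.sum_nonneg fun w _ => le_max_right _ _)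
  · have h1 : e w Z ≤ ∑ w ∈ sparseTernary n k, e w Z :=
      Finset.single_le_sum (f := fun w => e w Z) (fun _ _ => le_max_right _ _) (hAk hw)
    have h2 : |∑ τ, Z τ * tensorCoef lam w τ| - a₀ ≤ e w Z := le_max_left _ _
    linarith

/-- Some block of sites can be avoided at a bounded cost in expected log-partition function. -/
theorem exists_block_avoid {k : ℕ} (hn : 0 < n) (hk : 4 ≤ k) (hlogn : Real.log n ≤ k) {lam : ℝ}
    (hlam : 0 < lam) {A : Finset (Fin n → ℝ)} (hA : A.Nonempty) (hAk : A ⊆ sparseTernary n k)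
    (c : (Fin n → ℝ) → ℝ) {B : ℕ} (hB : k ^ 4 ≤ B) {D : Fin B → Finset (Fin n)}
    (hD : ∀ r r', r ≠ r' → Disjoint (D r) (D r'))
    (hmove : ∀ r, ∀ w ∈ A, ∃ w' ∈ A, (∀ x ∈ D r, w' x = 0) ∧ c w' = c w) :
    ∃ r, ∫ Z, lse A (ham (tensorCoef lam) c Z) ∂𝐙 ≤
      ∫ Z, lse (A.filter fun w => ∀ x ∈ D r, w x = 0) (ham (tensorCoef lam) c Z) ∂𝐙 +
        (40 * lam + 9) := by
  classical
  have hk' : (4 : ℝ) ≤ k := by exact_mod_cast hk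
  have hB' : (k : ℝ) ^ 4 ≤ B := by exact_mod_cast hB
  have hB0 : (0 : ℝ) < B := by linarith [pow_pos (by linarith : (0 : ℝ) < k) 4]
  obtain ⟨E, hEi, hE, hE0, hEw⟩ := exists_energy_bound hn hk hlogn hlam hAk
  set X := tensorCoef (n := n) lam
  set N : ℝ := (A.card : ℝ)
  have hlogN : 0 ≤ Real.log N := Real.log_natCast_nonneg _
  have hlogN' : Real.log N ≤ 2 + 2 * k * k := by
    have h1 : Real.log N ≤ Real.log (sparseTernary n k).card := by
      refine Real.log_le_log ?_ ?_
      · have := hA.card_pos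
        simp only [N]; exact_mod_cast this
      · simp only [N]; exact_mod_cast Finset.card_le_card hAk
    refine h1.trans ((log_card_sparseTernary_le hn k).trans ?_)
    gcongr
  let hit : Fin B → (Fin n → ℝ) → Prop := fun r w => ∃ x ∈ D r, w x ≠ 0
  have hfil : ∀ r, (A.filter fun w => ¬ hit r w) = A.filter fun w => ∀ x ∈ D r, w x = 0 :=
    fun r => Finset.filter_congr fun w _ => by simp [hit]
  have hne : ∀ r, (A.filter fun w => ∀ x ∈ D r, w x = 0).Nonempty := fun r => by
    obtain ⟨w, hw⟩ := hA
    obtain ⟨w', hw', h, _⟩ := hmove r w hw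
    exact ⟨w', Finset.mem_filter.2 ⟨hw', h⟩⟩
  have hpt : ∀ r Z, lse A (ham X c Z) ≤
      lse (A.filter fun w => ∀ x ∈ D r, w x = 0) (ham X c Z) + Real.log 2 +
        (2 * E Z + Real.log N) * gibbs A (ham X c Z) (fun w => if hit r w then 1 else 0) := by
    intro r Z
    choose! T hT using hmove r
    let T' : (Fin n → ℝ) → Fin n → ℝ := fun w => if hit r w then T w else w
    have h1 := lse_le_lse_filter_add hA (hit r) T' (fun w hw => by
        by_cases h : hit r w
        · simp only [T', h, if_true]
          refine ⟨(hT w hw).1, ?_⟩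
          rintro ⟨x, hx, hx0⟩
          exact hx0 ((hT w hw).2.1 x hx)
        · simpa [T', h] using hw)
      (ham X c Z)
    rw [hfil] at h1
    refine h1.trans (add_le_add le_rfl ?_)
    rw [← gibbs_const_mul]
    refine gibbs_mono _ fun w hw => ?_
    by_cases h : hit r w
    · simp only [T', h, if_true, ham, (hT w hw).2.2, mul_one]
      have h2 := hEw Z w hw
      have h3 := hEw Z (T w) (hT w hw).1
      have h4 := le_abs_self (∑ τ, Z τ * X w τ)
      have h5 := neg_abs_le (∑ τ, Z τ * X (T w) τ)
      linarith
    · simp [h]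
  -- Summed over the blocks, the probabilities of being hit total at most `2 * k`, since the blocks
  -- are disjoint and each vector has at most `2 * k` nonzero entries.
  have hsum : ∀ Z, B * lse A (ham X c Z) ≤
      ∑ r, lse (A.filter fun w => ∀ x ∈ D r, w x = 0) (ham X c Z) + B * Real.log 2 +
        (2 * E Z + Real.log N) * (2 * k) := fun Z => by
    have h1 := Finset.sum_le_sum fun (r : Fin B) (_ : r ∈ Finset.univ) => hpt r Z
    simp only [Finset.sum_add_distrib, Finset.sum_const, Finset.card_univ, Fintype.card_fin,
      nsmul_eq_mul, ← Finset.mul_sum, ← gibbs_sum] at h1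
    refine h1.trans (add_le_add le_rfl ?_)
    refine mul_le_mul_of_nonneg_left ?_ (by linarith [hE0 Z])
    refine gibbs_le_of_le hA _ fun w hw => ?_
    have h2 := card_hit_blocks_le hD w
    have h3 := (mem_sparseTernary.1 (hAk hw)).2.2
    have h4 : ∑ r : Fin B, (if hit r w then (1 : ℝ) else 0) =
        (Finset.univ.filter fun r => ∃ x ∈ D r, w x ≠ 0).card := by
      simp [hit]
    rw [h4]
    exact_mod_cast h2.trans h3
  have hi : ∀ r, Integrable (fun Z => lse (A.filter fun w => ∀ x ∈ D r, w x = 0) (ham X c Z)) 𝐙 :=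
    fun r => integrable_lse_ham (hne r) X c
  have hi2 : Integrable (fun Z => (2 * E Z + Real.log N) * (2 * k)) 𝐙 :=
    ((hEi.const_mul 2).add (integrable_const _)).mul_const _
  have hi3 : Integrable (fun Z => ∑ r, lse (A.filter fun w => ∀ x ∈ D r, w x = 0)
      (ham X c Z)) 𝐙 := integrable_finsetSum _ fun r _ => hi r
  have hint := integral_mono ((integrable_lse_ham hA X c).const_mul B)
    ((hi3.add (integrable_const (B * Real.log 2))).add hi2) hsum
  rw [integral_add' (hi3.add (integrable_const _)) hi2, integral_add' hi3 (integrable_const _),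
    integral_finsetSum _ fun r _ => hi r, integral_const_mul,
    integral_mul_const (2 * (k : ℝ)), integral_add (hEi.const_mul 2) (integrable_const _), integral_const_mul,
    integral_const_mul 2] at hint
  simp only [integral_const, probReal_univ, one_smul] at hint
  have hlog2 : Real.log 2 ≤ 1 := by linarith [Real.log_two_lt_d9]
  -- The energy is of order `lam * k ^ 3` and a vector hits `O(k)` blocks, so `k ^ 4` blocks make
  -- the average loss `O(lam + 1)`. Some block does no worse than the average.
  have hloss : (2 * ∫ Z, E Z ∂𝐙 + Real.log N) * (2 * k) ≤ B * (40 * lam + 8) := by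
    calc (2 * ∫ Z, E Z ∂𝐙 + Real.log N) * (2 * k) ≤
        (2 * (8 * lam * k ^ 3) + (2 + 2 * k * k)) * (2 * k) := by gcongr
      _ ≤ k ^ 4 * (40 * lam + 8) := by
        have h1 : (0 : ℝ) ≤ lam * k ^ 4 := by positivity
        have h2 : (2 + 2 * (k : ℝ) * k) * (2 * k) ≤ 8 * k ^ 4 := by
          have : (1 : ℝ) ≤ k := by linarith
          have h3 : (k : ℝ) ≤ k ^ 4 := le_self_pow₀ this (by norm_num)
          have h4 : (k : ℝ) ^ 3 ≤ k ^ 4 := pow_le_pow_right₀ this (by norm_num)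
          nlinarith
        nlinarith
      _ ≤ B * (40 * lam + 8) := by gcongr
  by_contra hcon
  push Not at hcon
  have hs := Finset.sum_lt_sum_of_nonempty (s := (Finset.univ : Finset (Fin B)))
    ⟨⟨0, by exact_mod_cast hB0⟩, Finset.mem_univ _⟩ fun r _ => hcon r
  rw [Finset.sum_add_distrib, Finset.sum_const, Finset.sum_const, Finset.card_univ,
    Fintype.card_fin, nsmul_eq_mul, nsmul_eq_mul] at hs
  nlinarith [mul_le_mul_of_nonneg_left hlog2 hB0.le]

end Elimination

/-! ### Eliminating the sites of the support of the signal -/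

section Induction

variable {n : ℕ}

local notation "𝐙" => stdGaussianNoise (Fin n × Fin n × Fin n)

/-- The numerical relations between the parameters under which one site can be eliminated with
gain `g`: `M` is the number of sites available for relocation, `ρ` bounds the energy per site of a
sparse vector, `r` bounds the maximum of `k` Gaussian variables and `t` is below the typical maximum
of `M` of them. -/
structure EliminationBounds (n k M : ℕ) (ρ r t g : ℝ) : Prop where
  four_le : 4 ≤ k
  log_le : Real.log n ≤ k
  one_le_card : 1 ≤ M
  size : k ^ 4 * M + 6 * k ≤ n
  one_le_rho : 1 ≤ ρ
  rho_sq : ρ ^ 2 / 2 = Real.log n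
  one_le_r : 1 ≤ r
  exp_r : k * Real.exp (-r ^ 2 / 2) ≤ 1
  t_nonneg : 0 ≤ t
  -- The right side is the gain of relocating among `M` sites, about `√3 * b * t`. The left side is
  -- the loss of the discretized interpolation (`0.51` in place of `1 / 2`), the reward, and the
  -- amplified diagonal term.
  gain : ∀ b : ℝ, (k : ℝ) / 2 - 1 ≤ b → b ≤ 2 * k →
    0.51 * ((3 * b + 6) * ρ + 24 * k * r) + g + k * r ≤
      √((b + 1) ^ 3 - b ^ 3) * (t * (1 - Real.exp (-(M * (Real.exp (-(t + 1) ^ 2 / 2) / 3)))) - 1)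

/-- The vectors of the prior that vanish on `S` outside of `P`. -/
def vanishingOff (k : ℕ) (S P : Finset (Fin n)) : Finset (Fin n → ℝ) :=
  (sparseTernary n k).filter fun w => ∀ p ∈ S, p ∉ P → w p = 0

theorem mem_vanishingOff {k : ℕ} {S P : Finset (Fin n)} {w : Fin n → ℝ} :
    w ∈ vanishingOff k S P ↔ w ∈ sparseTernary n k ∧ ∀ p ∈ S, p ∉ P → w p = 0 :=
  Finset.mem_filter

theorem vanishingOff_nonempty {k : ℕ} {S : Finset (Fin n)} (h : S.card + k ≤ n)
    (P : Finset (Fin n)) : (vanishingOff k S P).Nonempty := by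
  have hc : k ≤ (Finset.univ \ S).card := by
    have := Finset.card_sdiff_add_card_eq_card (Finset.subset_univ S)
    rw [Finset.card_univ, Fintype.card_fin] at this
    omega
  obtain ⟨E, hE, hEc⟩ := Finset.exists_subset_card_eq hc
  have hn : hammingNorm (fun p => if p ∈ E then (1 : ℝ) else 0) = k := by
    rw [hammingNorm_eq_card, ← hEc]
    congr 1
    ext p; simp
  refine ⟨fun p => if p ∈ E then 1 else 0, mem_vanishingOff.2 ⟨mem_sparseTernary.2 ⟨fun p => ?_, ?_, ?_⟩,
    fun p hp _ => ?_⟩⟩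
  · by_cases h : p ∈ E <;> simp [h]
  · rw [hn]; omega
  · rw [hn]; omega
  · have : p ∉ E := fun h => (Finset.mem_sdiff.1 (hE h)).2 hp
    simp [this]

/-- The energy of a vector as a function of its size, rewarding the sites of `P`. -/
def siteEnergy (e : ℕ → ℝ) (γ : ℝ) (P : Finset (Fin n)) (w : Fin n → ℝ) : ℝ :=
  e (hammingNorm w) + γ * ∑ p ∈ P, w p ^ 2

theorem IsTernary.hammingNorm_moveSite {w : Fin n → ℝ} (hw : IsTernary w) {i x : Fin n}
    (hx : w x = 0) (hxi : x ≠ i) :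
    IsTernary (moveSite i x w) ∧ hammingNorm (moveSite i x w) = hammingNorm w := by
  have hter : IsTernary (moveSite i x w) := fun p => by
    by_cases h : p = x
    · subst h; simpa [moveSite] using hw i
    · simpa [moveSite, h] using hw.removeSite i p
  refine ⟨hter, ?_⟩
  have hux : _root_.removeSite i w x = 0 := by rw [removeSite_of_ne hxi, hx]
  have : (hammingNorm (moveSite i x w) : ℝ) = hammingNorm w := by
    rw [← hter.overlap_self, ← hw.overlap_self, overlap_eq_add i w w, moveSite,
      overlap_update_left hux, overlap_update_right hux, hux]
    simp
  exact_mod_cast this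

theorem moveSite_of_ne {i x p : Fin n} (hpi : p ≠ i) (hpx : p ≠ x) (w : Fin n → ℝ) :
    moveSite i x w p = w p := by
  simp [moveSite, hpx, removeSite_of_ne hpi]

theorem siteCoef_one_of_ne (lam K : ℝ) {i : Fin n} (w : Fin n → ℝ) {τ : Fin n × Fin n × Fin n}
    (h : τ ≠ (i, i, i)) : siteCoef lam K 1 i w τ = tensorCoef lam w τ := by
  simp [siteCoef, tensorCoef, diagCoef, h]

theorem IsTernary.pow_three {w : Fin n → ℝ} (hw : IsTernary w) (p : Fin n) :
    w p * w p * w p = w p := by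
  rcases hw p with h | h | h <;> rw [h] <;> norm_num

/-- Eliminating one site. -/
theorem integral_lse_eliminate_site {k M : ℕ} {ρ r t g : ℝ} (hp : EliminationBounds n k M ρ r t g)
    {lam : ℝ} (hlam : 0 < lam) {S P : Finset (Fin n)} (hS : S.card ≤ 2 * k) {i : Fin n}
    (hi : i ∈ S) (hiP : i ∉ P) (hPS : P ⊆ S) (e : ℕ → ℝ) :
    ∫ Z, lse (vanishingOff k S (insert i P))
        (ham (tensorCoef lam) (siteEnergy e (lam * g) (insert i P)) Z) ∂𝐙 ≤
      ∫ Z, lse (vanishingOff k S P) (ham (tensorCoef lam) (siteEnergy e (lam * g) P) Z) ∂𝐙 +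
        150 * (lam + 1) := by
  have hk := hp.four_le
  have hk' : (4 : ℝ) ≤ k := by exact_mod_cast hk
  have hM := hp.one_le_card
  have hsize := hp.size
  have hkM : M ≤ k ^ 4 * M := Nat.le_mul_of_pos_left _ (by positivity)
  have hn : 0 < n := by omega
  set A := vanishingOff k S (insert i P)
  have hAne : A.Nonempty := vanishingOff_nonempty (by omega) _
  have hAk : A ⊆ sparseTernary n k := Finset.filter_subset _ _
  -- The blocks lie off all of `S`, not just off `i`: relocation must not occupy another site of the
  -- support.
  obtain ⟨D, hDc, hDS, hDD⟩ := exists_disjoint_blocks S (B := k ^ 4) (M := M) (by omega)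
  have hmove : ∀ r, ∀ w ∈ A, ∃ w' ∈ A, (∀ x ∈ D r, w' x = 0) ∧
      siteEnergy e (lam * g) (insert i P) w' = siteEnergy e (lam * g) (insert i P) w := by
    intro r w hw
    obtain ⟨h1, h2⟩ := mem_vanishingOff.1 hw
    obtain ⟨h1, h3, h4⟩ := mem_sparseTernary.1 h1
    obtain ⟨w', a1, a2, a3, a4⟩ := exists_avoiding h1 (hDS r) h4 (by rw [hDc]; omega)
    refine ⟨w', mem_vanishingOff.2 ⟨mem_sparseTernary.2 ⟨a1, by rwa [a2], by rwa [a2]⟩,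
      fun p hp hpP => by rw [a3 p hp, h2 p hp hpP]⟩, a4, ?_⟩
    simp only [siteEnergy, a2]
    congr 2
    refine Finset.sum_congr rfl fun p hp => ?_
    rw [a3 p (Finset.insert_subset hi hPS hp)]
  obtain ⟨b, hb⟩ := exists_block_avoid hn hk hp.log_le hlam hAne hAk
    (siteEnergy e (lam * g) (insert i P)) le_rfl hDD hmove
  set A₁ := A.filter fun w => ∀ x ∈ D b, w x = 0
  have hA₁ : A₁.Nonempty := by
    obtain ⟨w, hw⟩ := hAne
    obtain ⟨w', hw', h, _⟩ := hmove b w hw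
    exact ⟨w', Finset.mem_filter.2 ⟨hw', h⟩⟩
  have hA₁A : ∀ w ∈ A₁, w ∈ A ∧ ∀ x ∈ D b, w x = 0 := fun w hw => Finset.mem_filter.1 hw
  have hsp : ∀ w ∈ A₁, IsTernary w ∧ k ≤ 2 * hammingNorm w ∧ hammingNorm w ≤ 2 * k :=
    fun w hw => mem_sparseTernary.1 (hAk (hA₁A w hw).1)
  have hter : ∀ w ∈ A₁, IsTernary w := fun w hw => (hsp w hw).1
  have hrem : ∀ w ∈ A₁, w i ≠ 0 →
      overlap (removeSite i w) (removeSite i w) = hammingNorm w - 1 := fun w hw hwi => by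
    have h1 := overlap_eq_add i w w
    have h2 : w i * w i = 1 := by
      rcases hter w hw i with h | h | h
      · exact absurd h hwi
      all_goals rw [h]; norm_num
    rw [(hter w hw).overlap_self, h2] at h1
    linarith
  have hlow : ∀ w ∈ A₁, (k : ℝ) / 2 ≤ hammingNorm w := fun w hw => by
    have : (k : ℝ) ≤ 2 * hammingNorm w := by exact_mod_cast (hsp w hw).2.1
    linarith
  have hupp : ∀ w ∈ A₁, (hammingNorm w : ℝ) ≤ 2 * k := fun w hw => by
    exact_mod_cast (hsp w hw).2.2
  -- At `s = 1` the interpolating Hamiltonian is the original one except for the diagonal entry,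
  -- amplified by `k`.
  have hamp := integral_lse_le_of_amplify hA₁ (tensorCoef lam) (siteCoef lam k 1 i)
    (siteEnergy e (lam * g) (insert i P)) (i, i, i) (K := k) (by linarith)
    (fun w _ τ hτ => siteCoef_one_of_ne lam k w hτ)
    (fun w hw => by
      rw [siteCoef_diag, tensorCoef, tensorCube, (hter w hw).pow_three]; ring)
  have hint := integral_lse_site_interpolate (i := i) (lam := lam) (K := k) (ρ := ρ) (r := r) hA₁
    hter (by linarith) hlam.le hp.one_le_r hp.exp_r hp.one_le_rho
    (fun w hw hwi => by rw [hrem w hw hwi]; linarith [hlow w hw])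
    (fun w hw hwi => by rw [hrem w hw hwi]; linarith [hupp w hw])
    (by
      rw [hp.rho_sq]
      refine le_trans (Finset.sum_le_sum_of_subset_of_nonneg ?_ fun w _ _ => by positivity)
        (sum_ternary_occupied_le hn i)
      intro w hw
      exact mem_ternary.2 (hter w hw))
    (h := 1 / 50) (by norm_num) 50 (siteEnergy e (lam * g) (insert i P))
  -- Fifty steps suffice: `0.51 * 3 = 1.53` is still below `√3`.
  have hcoef : (1 / 50 : ℝ) ^ 2 * (((50 : ℕ) : ℝ) * (((50 : ℕ) : ℝ) + 1) / 2) = 0.51 := by norm_num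
  have hone : ((50 : ℕ) : ℝ) * (1 / 50 : ℝ) = 1 := by norm_num
  rw [hcoef, hone] at hint
  have hDne : (D b).Nonempty := Finset.card_pos.1 (by rw [hDc]; omega)
  have hiD : i ∉ D b := Finset.disjoint_left.1 (hDS b) hi
  have hrel := integral_lse_site_relocate (i := i) (lam := lam) (K := k) (r := r) hA₁ hter hlam.le
    (by linarith) hp.one_le_r hp.exp_r hDne hiD (fun w hw => (hA₁A w hw).2)
    (A' := vanishingOff k S P) (c := siteEnergy e (lam * g) (insert i P))
    (c' := siteEnergy e (lam * g) P) (B := fun w => 0.51 * siteBonus lam k ρ r i w)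
    (γ := lam * g) hp.t_nonneg
    (fun w hw hwi => by
      obtain ⟨h1, h2⟩ := mem_vanishingOff.1 (hA₁A w hw).1
      refine ⟨mem_vanishingOff.2 ⟨h1, fun p hpS hpP => ?_⟩, ?_⟩
      · by_cases h : p = i
        · rw [h, hwi]
        · exact h2 p hpS (by simp [h, hpP])
      · rw [siteEnergy, siteEnergy, Finset.sum_insert hiP, hwi]
        simp)
    (fun w hw hwi x hx => by
      obtain ⟨h1, h2⟩ := mem_vanishingOff.1 (hA₁A w hw).1
      have hxS : x ∉ S := Finset.disjoint_right.1 (hDS b) hx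
      have hxi : x ≠ i := fun h => hxS (h ▸ hi)
      obtain ⟨a1, a2⟩ := (hter w hw).hammingNorm_moveSite ((hA₁A w hw).2 x hx) hxi
      have hxS' : ∀ p ∈ S, p ≠ x := fun p hpS h => hxS (h ▸ hpS)
      refine ⟨mem_vanishingOff.2 ⟨mem_sparseTernary.2 ⟨a1, by rw [a2]; exact (hsp w hw).2.1,
        by rw [a2]; exact (hsp w hw).2.2⟩, fun p hpS hpP => ?_⟩, ?_⟩
      · by_cases h : p = i
        · simp [h, moveSite, hxi.symm]
        · rw [moveSite_of_ne h (hxS' p hpS)]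
          exact h2 p hpS (by simp [h, hpP])
      · have h3 : ∑ p ∈ P, moveSite i x w p ^ 2 = ∑ p ∈ P, w p ^ 2 :=
          Finset.sum_congr rfl fun p hpP => by
            rw [moveSite_of_ne (ne_of_mem_of_not_mem hpP hiP) (hxS' p (hPS hpP))]
        rw [siteEnergy, siteEnergy, Finset.sum_insert hiP, a2, h3, (hter w hw).sq_eq_ite,
          if_pos hwi]
        exact le_of_eq (by ring))
    (fun w hw hwi => by simp [siteBonus, hwi])
    (fun w hw hwi => by
      have hg := hp.gain (hammingNorm w - 1) (by linarith [hlow w hw]) (by linarith [hupp w hw])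
      rw [← hrem w hw hwi] at hg
      rw [hDc, siteBonus, (hter w hw).sq_eq_ite, if_pos hwi]
      refine le_trans (le_of_eq ?_) (mul_le_mul_of_nonneg_left hg hlam.le)
      ring)
  have e1 : (fun (w : Fin n → ℝ) (τ : Fin n × Fin n × Fin n) => lam * tensorCube w τ) =
      tensorCoef lam := rfl
  rw [e1] at hrel
  -- The errors add up to `40 * lam + 9` for the block, `192 * 0.51 * lam` for the interpolation and
  -- `2 * lam` for the relocation.
  linarith

/-- Eliminating all sites of `P`. -/
theorem integral_lse_eliminate {k M : ℕ} {ρ r t g : ℝ} (hp : EliminationBounds n k M ρ r t g)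
    {lam : ℝ} (hlam : 0 < lam) {S : Finset (Fin n)} (hS : S.card ≤ 2 * k) (e : ℕ → ℝ)
    (P : Finset (Fin n)) (hPS : P ⊆ S) :
    ∫ Z, lse (vanishingOff k S P) (ham (tensorCoef lam) (siteEnergy e (lam * g) P) Z) ∂𝐙 ≤
      ∫ Z, lse (vanishingOff k S ∅) (ham (tensorCoef lam) (fun w => e (hammingNorm w)) Z) ∂𝐙 +
        P.card * (150 * (lam + 1)) := by
  induction P using Finset.induction_on with
  | empty =>
    have : siteEnergy e (lam * g) (∅ : Finset (Fin n)) = fun w => e (hammingNorm w) := by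
      funext w; simp [siteEnergy]
    rw [this]; simp
  | insert i P hiP ih =>
    have h1 := integral_lse_eliminate_site hp hlam hS (hPS (Finset.mem_insert_self i P)) hiP
      ((Finset.subset_insert i P).trans hPS) e
    have h2 := ih ((Finset.subset_insert i P).trans hPS)
    rw [Finset.card_insert_of_notMem hiP]
    push_cast
    linarith

/-- The vectors of the prior with a given overlap with `v`. -/
def overlapShell (k : ℕ) (v : Fin n → ℝ) (j : ℝ) : Finset (Fin n → ℝ) :=
  (sparseTernary n k).filter fun w => overlap v w = j

theorem mem_overlapShell {k : ℕ} {v w : Fin n → ℝ} {j : ℝ} :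
    w ∈ overlapShell k v j ↔ w ∈ sparseTernary n k ∧ overlap v w = j := Finset.mem_filter

theorem vanishingOff_subset_overlapShell (k : ℕ) (v : Fin n → ℝ) :
    vanishingOff k (Finset.univ.filter fun p => v p ≠ 0) ∅ ⊆ overlapShell k v 0 := fun w hw => by
  obtain ⟨h1, h2⟩ := mem_vanishingOff.1 hw
  refine mem_overlapShell.2 ⟨h1, Finset.sum_eq_zero fun p _ => ?_⟩
  by_cases h : v p = 0
  · rw [h, zero_mul]
  · rw [h2 p (by simp [h]) (by simp), mul_zero]

theorem overlapShell_zero_nonempty {k : ℕ} (hn : 3 * k ≤ n) {v : Fin n → ℝ}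
    (hv : v ∈ sparseTernary n k) : (overlapShell k v 0).Nonempty := by
  have h := (mem_sparseTernary.1 hv).2.2
  rw [hammingNorm_eq_card] at h
  exact (vanishingOff_nonempty (by omega) ∅).mono (vanishingOff_subset_overlapShell k v)

/-- The restricted free energy decreases linearly in the overlap. -/
theorem integral_lse_overlapShell_le {k M : ℕ} {ρ r t g : ℝ}
    (hp : EliminationBounds n k M ρ r t g) (hg : 0 ≤ g) {lam : ℝ} (hlam : 0 < lam) (e : ℕ → ℝ)
    {v : Fin n → ℝ} (hv : v ∈ sparseTernary n k) {j : ℝ} (hj : (overlapShell k v j).Nonempty) :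
    ∫ Z, lse (overlapShell k v j) (ham (tensorCoef lam) (fun w => e (hammingNorm w)) Z) ∂𝐙 +
        lam * g * j ≤
      ∫ Z, lse (overlapShell k v 0) (ham (tensorCoef lam) (fun w => e (hammingNorm w)) Z) ∂𝐙 +
        300 * k * (lam + 1) := by
  set S := Finset.univ.filter fun p => v p ≠ 0
  obtain ⟨hv1, _, hv2⟩ := mem_sparseTernary.1 hv
  have hS : S.card ≤ 2 * k := hv2
  have hkM : M ≤ k ^ 4 * M := Nat.le_mul_of_pos_left _ (by have := hp.four_le; positivity)
  have hsize := hp.size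
  have h1 := integral_lse_eliminate hp hlam hS e S subset_rfl
  have hne : (vanishingOff k S ∅).Nonempty := vanishingOff_nonempty (by omega) ∅
  have h2 : ∫ Z, lse (vanishingOff k S ∅) (ham (tensorCoef lam) (fun w => e (hammingNorm w)) Z) ∂𝐙 ≤
      ∫ Z, lse (overlapShell k v 0) (ham (tensorCoef lam) (fun w => e (hammingNorm w)) Z) ∂𝐙 :=
    integral_mono (integrable_lse_ham hne _ _)
      (integrable_lse_ham (hne.mono (vanishingOff_subset_overlapShell k v)) _ _)
      fun Z => lse_mono_set hne (vanishingOff_subset_overlapShell k v) _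
  -- With `P = S` no site is forbidden; with `P = ∅` the vector is disjoint from `v`, hence of
  -- overlap zero.
  have hsub : overlapShell k v j ⊆ vanishingOff k S S := fun w hw =>
    mem_vanishingOff.2 ⟨(mem_overlapShell.1 hw).1, fun p h h' => absurd h h'⟩
  have h3 : ∫ Z, lse (overlapShell k v j) (ham (tensorCoef lam) (fun w => e (hammingNorm w)) Z) ∂𝐙 +
      lam * g * j ≤ ∫ Z, lse (vanishingOff k S S)
        (ham (tensorCoef lam) (siteEnergy e (lam * g) S) Z) ∂𝐙 := by
    have hi := integrable_lse_ham hj (tensorCoef lam) (fun w => e (hammingNorm w))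
    have : ∫ Z, lse (overlapShell k v j) (ham (tensorCoef lam) (fun w => e (hammingNorm w)) Z) ∂𝐙 +
      lam * g * j = ∫ Z, (lse (overlapShell k v j)
        (ham (tensorCoef lam) (fun w => e (hammingNorm w)) Z) + lam * g * j) ∂𝐙 := by
      rw [integral_add hi (integrable_const _)]; simp
    rw [this]
    refine integral_mono (hi.add (integrable_const _))
      (integrable_lse_ham (hj.mono hsub) _ _) fun Z => ?_
    simp only
    rw [← lse_add_const hj]
    refine (lse_mono hj fun w hw => ?_).trans (lse_mono_set hj hsub _)
    have hw' := (mem_overlapShell.1 hw)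
    have hwt := (mem_sparseTernary.1 hw'.1).1
    simp only [ham, siteEnergy]
    -- A unit of overlap requires an occupied site of the support, so the rewards total at least
    -- `lam * g * j`.
    have h5 : j ≤ ∑ p ∈ S, w p ^ 2 := by
      rw [← hw'.2, overlap, Finset.sum_filter]
      refine Finset.sum_le_sum fun p _ => ?_
      rcases hv1 p with h | h | h <;> rcases hwt p with h' | h' | h' <;> rw [h, h'] <;> norm_num
    have := mul_le_mul_of_nonneg_left h5 (mul_nonneg hlam.le hg)
    linarith
  have h6 : (S.card : ℝ) * (150 * (lam + 1)) ≤ 300 * k * (lam + 1) := by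
    have : (S.card : ℝ) ≤ 2 * k := by exact_mod_cast hS
    nlinarith
  linarith

end Induction

/-! ### The truncated prior as a finite weighted sum -/

section Prior

variable {n k : ℕ}

theorem isProbabilityMeasure_sparseRademacher {p : ℝ} (h0 : 0 ≤ p) (h1 : p ≤ 1) :
    IsProbabilityMeasure (sparseRademacher p) := by
  constructor
  simp only [sparseRademacher, Measure.coe_add, Measure.coe_smul, Pi.add_apply, Pi.smul_apply,
    measure_univ, smul_eq_mul, mul_one]
  rw [← ENNReal.ofReal_add (by positivity) (by positivity),
    ← ENNReal.ofReal_add (by positivity) (by linarith)]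
  simp

theorem sparseRademacher_singleton (p : ℝ) {a : ℝ} (ha : a = 0 ∨ a = 1 ∨ a = -1) :
    sparseRademacher p {a} = ENNReal.ofReal (if a = 0 then 1 - p else p / 2) := by
  have h1 : ¬ (-1 : ℝ) = 1 := by norm_num
  have h2 : ¬ (1 : ℝ) = -1 := by norm_num
  rcases ha with rfl | rfl | rfl <;> simp [sparseRademacher, h1, h2]

theorem ae_sparseRademacher (p : ℝ) :
    ∀ᵐ a ∂(sparseRademacher p), a = 0 ∨ a = 1 ∨ a = -1 := by
  rw [ae_iff, sparseRademacher]
  simp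

/-- The probability of a ternary vector under the law with independent sparse Rademacher entries. -/
def iidWeight (p : ℝ) (w : Fin n → ℝ) : ℝ := ∏ i, if w i = 0 then 1 - p else p / 2

theorem pi_sparseRademacher_singleton {p : ℝ} (h0 : 0 ≤ p) (h1 : p ≤ 1) {w : Fin n → ℝ}
    (hw : IsTernary w) :
    Measure.pi (fun _ : Fin n => sparseRademacher p) {w} = ENNReal.ofReal (iidWeight p w) := by
  have := isProbabilityMeasure_sparseRademacher h0 h1
  rw [Measure.pi_singleton, iidWeight, ENNReal.ofReal_prod_of_nonneg]
  · exact Finset.prod_congr rfl fun i _ => sparseRademacher_singleton p (hw i)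
  · intro i _
    split_ifs <;> linarith

theorem iidWeight_nonneg {p : ℝ} (h0 : 0 ≤ p) (h1 : p ≤ 1) (w : Fin n → ℝ) : 0 ≤ iidWeight p w :=
  Finset.prod_nonneg fun i _ => by split_ifs <;> linarith

theorem iidWeight_neg (p : ℝ) (w : Fin n → ℝ) : iidWeight p (-w) = iidWeight p w := by
  simp [iidWeight]

theorem iidWeight_eq (p : ℝ) (w : Fin n → ℝ) :
    iidWeight p w = (p / 2) ^ hammingNorm w * (1 - p) ^ (n - hammingNorm w) := by
  rw [iidWeight, ← Finset.prod_filter_mul_prod_filter_not _ (fun i => w i ≠ 0)]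
  have h1 : ∀ i ∈ Finset.univ.filter (fun i => w i ≠ 0), (if w i = 0 then 1 - p else p / 2) = p / 2 :=
    fun i hi => if_neg (Finset.mem_filter.1 hi).2
  have h2 : ∀ i ∈ Finset.univ.filter (fun i => ¬ w i ≠ 0),
      (if w i = 0 then 1 - p else p / 2) = 1 - p :=
    fun i hi => if_pos (not_not.1 (Finset.mem_filter.1 hi).2)
  rw [Finset.prod_congr rfl h1, Finset.prod_congr rfl h2, Finset.prod_const, Finset.prod_const,
    hammingNorm_eq_card]
  congr 2
  have := Finset.card_filter_add_card_filter_not (s := (Finset.univ : Finset (Fin n)))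
    (fun i => w i ≠ 0)
  rw [Finset.card_univ, Fintype.card_fin] at this
  omega

theorem ae_pi_sparseRademacher {p : ℝ} (h0 : 0 ≤ p) (h1 : p ≤ 1) :
    ∀ᵐ w ∂(Measure.pi fun _ : Fin n => sparseRademacher p), IsTernary w := by
  have := isProbabilityMeasure_sparseRademacher h0 h1
  refine ae_all_iff.2 fun i => ?_
  exact (Measure.tendsto_eval_ae_ae (μ := fun _ : Fin n => sparseRademacher p)
    (i := i)).eventually (ae_sparseRademacher p)

theorem ratio_mem (hkn : k ≤ n) : 0 ≤ (k : ℝ) / n ∧ (k : ℝ) / n ≤ 1 :=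
  ⟨by positivity, div_le_one_of_le₀ (by exact_mod_cast hkn) (by positivity)⟩

theorem isProbabilityMeasure_truncSparseVector (hkn : k ≤ n) :
    IsProbabilityMeasure (truncSparseVector n k) := by
  have := isProbabilityMeasure_sparseRademacher (ratio_mem hkn).1 (ratio_mem hkn).2
  exact Measure.isProbabilityMeasure_map (measurable_truncateSparse k).aemeasurable

theorem truncateSparse_mem (hkn : k ≤ n) {u : Fin n → ℝ} (hu : IsTernary u) :
    truncateSparse k u ∈ sparseTernary n k := by
  rw [mem_sparseTernary, truncateSparse]
  split_ifs with h
  · exact ⟨hu, h⟩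
  · have hc : hammingNorm (fun i : Fin n => if (i : ℕ) < k then (1 : ℝ) else 0) = k := by
      have : (Finset.univ.filter fun i : Fin n => (if (i : ℕ) < k then (1 : ℝ) else 0) ≠ 0) =
          Finset.univ.filter fun i : Fin n => (i : ℕ) < k := by
        ext i; simp
      rw [hammingNorm_eq_card, this, Fin.card_filter_val_lt]
      omega
    rw [hc]
    refine ⟨fun i => ?_, by omega, by omega⟩
    by_cases h : (i : ℕ) < k <;> simp [h]

theorem ae_truncSparseVector (hkn : k ≤ n) :
    ∀ᵐ w ∂(truncSparseVector n k), w ∈ sparseTernary n k := by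
  rw [truncSparseVector]
  refine (ae_map_iff (measurable_truncateSparse k).aemeasurable
    (p := fun w => w ∈ sparseTernary n k) (sparseTernary n k).measurableSet).2 ?_
  filter_upwards [ae_pi_sparseRademacher (ratio_mem hkn).1 (ratio_mem hkn).2] with u hu
  exact truncateSparse_mem hkn hu

/-- The prior probability of a vector. -/
def priorWeight (n k : ℕ) (w : Fin n → ℝ) : ℝ := (truncSparseVector n k).real {w}

theorem priorWeight_nonneg (w : Fin n → ℝ) : 0 ≤ priorWeight n k w := measureReal_nonneg

theorem ofReal_priorWeight (hkn : k ≤ n) (w : Fin n → ℝ) :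
    ENNReal.ofReal (priorWeight n k w) = truncSparseVector n k {w} := by
  have := isProbabilityMeasure_truncSparseVector hkn
  exact ofReal_measureReal

/-- Truncation fixes admissible vectors. Equality can fail because the fallback vector also receives
the discarded mass. -/
theorem iidWeight_le_priorWeight (hkn : k ≤ n) {w : Fin n → ℝ} (hw : w ∈ sparseTernary n k) :
    iidWeight (k / n) w ≤ priorWeight n k w := by
  obtain ⟨hw1, hw2⟩ := mem_sparseTernary.1 hw
  rw [← ENNReal.ofReal_le_ofReal_iff (priorWeight_nonneg w), ofReal_priorWeight hkn,
    ← pi_sparseRademacher_singleton (ratio_mem hkn).1 (ratio_mem hkn).2 hw1, truncSparseVector,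
    Measure.map_apply (measurable_truncateSparse k) (measurableSet_singleton w)]
  refine measure_mono fun u hu => ?_
  rw [Set.mem_singleton_iff.1 hu]
  simp [truncateSparse, hw2]

theorem sum_priorWeight (hkn : k ≤ n) : ∑ w ∈ sparseTernary n k, priorWeight n k w = 1 := by
  have := isProbabilityMeasure_truncSparseVector hkn
  have h1 : truncSparseVector n k (sparseTernary n k : Set (Fin n → ℝ)) = 1 :=
    prob_compl_eq_zero_iff (sparseTernary n k).measurableSet |>.1 (ae_truncSparseVector hkn)
  rw [← sum_measure_singleton] at h1
  rw [← ENNReal.ofReal_eq_one, ENNReal.ofReal_sum_of_nonneg fun w _ => priorWeight_nonneg w, ← h1]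
  exact Finset.sum_congr rfl fun w _ => ofReal_priorWeight hkn w

/-- Integration against the prior is a finite sum. -/
theorem lintegral_truncSparseTensorPrior (hkn : k ≤ n) (f : (Fin n × Fin n × Fin n → ℝ) → ℝ≥0∞) :
    ∫⁻ X, f X ∂(truncSparseTensorPrior n k) =
      ∑ w ∈ sparseTernary n k, ENNReal.ofReal (priorWeight n k w) * f (tensorCube w) := by
  have h : truncSparseTensorPrior n k = ∑ w ∈ sparseTernary n k,
      ENNReal.ofReal (priorWeight n k w) • Measure.dirac (tensorCube w) := by
    ext s hs
    have h1 : truncSparseTensorPrior n k s =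
        ∫⁻ w in (sparseTernary n k : Set (Fin n → ℝ)), s.indicator 1 (tensorCube w)
          ∂(truncSparseVector n k) := by
      rw [Measure.restrict_eq_self_of_ae_mem (ae_truncSparseVector hkn), truncSparseTensorPrior,
        Measure.map_apply measurable_tensorCube hs,
        ← lintegral_indicator_one (measurable_tensorCube hs)]
      rfl
    rw [h1, lintegral_finset, Measure.finsetSum_apply]
    refine Finset.sum_congr rfl fun w _ => ?_
    rw [Measure.smul_apply, Measure.dirac_apply' _ hs, ofReal_priorWeight hkn, smul_eq_mul, mul_comm]
  rw [h, lintegral_finsetSum_measure]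
  refine Finset.sum_congr rfl fun w _ => ?_
  rw [lintegral_smul_measure, lintegral_dirac, smul_eq_mul]

/-- An upper bound for the information content of the prior. -/
theorem neg_log_iidWeight_le (hk : 0 < k) (hkn : 2 * k ≤ n) {w : Fin n → ℝ}
    (hw : w ∈ sparseTernary n k) :
    0 < iidWeight (k / n) w ∧
      -(2 * k * (Real.log (n / k) + 2)) ≤ Real.log (iidWeight (k / n) w) := by
  have hk' : (0 : ℝ) < k := by exact_mod_cast hk
  have hn' : (0 : ℝ) < n := by exact_mod_cast (by omega : 0 < n)
  have hkn' : 2 * (k : ℝ) ≤ n := by exact_mod_cast hkn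
  set p : ℝ := k / n
  have hp0 : 0 < p := by positivity
  have hp : p ≤ 1 / 2 := by rw [div_le_iff₀ hn']; linarith
  have hq : 0 < 1 - p := by linarith
  have hlogp : Real.log p = -Real.log (n / k) := by
    rw [← Real.log_inv, inv_div]
  have hlognk : 0 ≤ Real.log (n / k) := by
    apply Real.log_nonneg; rw [le_div_iff₀ hk']; linarith
  -- For `p ≤ 1 / 2` one has `1 - p ≥ exp (-2 * p)`; over at most `n` zero entries this costs `2 * n
  -- * p = 2 * k`.
  have hlogq : -(2 * p) ≤ Real.log (1 - p) := by
    rw [Real.le_log_iff_exp_le hq, Real.exp_neg, inv_le_comm₀ (Real.exp_pos _) hq]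
    refine le_trans ?_ (Real.add_one_le_exp _)
    rw [inv_le_iff_one_le_mul₀ hq]
    nlinarith
  have hm : (hammingNorm w : ℝ) ≤ 2 * k := by exact_mod_cast (mem_sparseTernary.1 hw).2.2
  have hnm : ((n - hammingNorm w : ℕ) : ℝ) ≤ n := by exact_mod_cast Nat.sub_le _ _
  refine ⟨by rw [iidWeight_eq]; positivity, ?_⟩
  rw [iidWeight_eq, Real.log_mul (by positivity) (by positivity), Real.log_pow, Real.log_pow,
    Real.log_div hp0.ne' (by norm_num), hlogp]
  have h2 : Real.log 2 ≤ 1 := by linarith [Real.log_two_lt_d9]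
  have h3 : ((n - hammingNorm w : ℕ) : ℝ) * -(2 * p) ≥ -(2 * k) := by
    have : (n : ℝ) * p = k := by simp only [p]; field_simp
    nlinarith
  have h4 : ((n - hammingNorm w : ℕ) : ℝ) * -(2 * p) ≤
      ((n - hammingNorm w : ℕ) : ℝ) * Real.log (1 - p) :=
    mul_le_mul_of_nonneg_left hlogq (by positivity)
  have h5 : (hammingNorm w : ℝ) * (Real.log (n / k) + Real.log 2) ≤ 2 * k * (Real.log (n / k) + 1) :=
    mul_le_mul hm (by linarith) (by have := Real.log_pos (one_lt_two); linarith) (by positivity)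
  nlinarith

end Prior

/-! ### From restricted free energies to the Franz–Parisi potential -/

section Potential

variable {n k : ℕ} {lam : ℝ}

local notation "𝐙" => stdGaussianNoise (Fin n × Fin n × Fin n)

/-- The energy of a configuration of the posterior, up to the noise term. -/
def posteriorEnergy (n k : ℕ) (lam : ℝ) (w : Fin n → ℝ) : ℝ :=
  -(lam ^ 2 * (hammingNorm w : ℝ) ^ 3 / 2) + Real.log (priorWeight n k w)

/-- The logarithm of the partition function at overlap `j` in the noise `Z`, for the signal `v`. -/
def shellEnergy (n k : ℕ) (lam j : ℝ) (v : Fin n → ℝ) (Z : Fin n × Fin n × Fin n → ℝ) : ℝ :=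
  lse (overlapShell k v j) (ham (tensorCoef lam) (posteriorEnergy n k lam) Z)

theorem priorWeight_pos (hk : 0 < k) (hkn : 2 * k ≤ n) {w : Fin n → ℝ}
    (hw : w ∈ sparseTernary n k) : 0 < priorWeight n k w :=
  (neg_log_iidWeight_le hk hkn hw).1.trans_le (iidWeight_le_priorWeight (by omega) hw)

/-- On a fixed overlap shell the first bracket does not depend on `w`. What remains is a Gaussian
Hamiltonian free of signal, with a deterministic term in the size of `w`. -/
theorem sum_gamObs_sub_sq {v w : Fin n → ℝ} (hw : IsTernary w)
    (Z : Fin n × Fin n × Fin n → ℝ) :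
    -(∑ τ, (lam * tensorCube v τ + Z τ - lam * tensorCube w τ) ^ 2) / 2 =
      (lam ^ 2 * overlap v w ^ 3 - (∑ τ, (lam * tensorCube v τ + Z τ) ^ 2) / 2) +
        (∑ τ, Z τ * tensorCoef lam w τ + -(lam ^ 2 * (hammingNorm w : ℝ) ^ 3 / 2)) := by
  have h : ∀ τ, (lam * tensorCube v τ + Z τ - lam * tensorCube w τ) ^ 2 =
      (lam * tensorCube v τ + Z τ) ^ 2 - 2 * lam ^ 2 * (tensorCube v τ * tensorCube w τ) -
        2 * (Z τ * tensorCoef lam w τ) + lam ^ 2 * (tensorCube w τ * tensorCube w τ) := fun τ => by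
    simp only [tensorCoef]; ring
  simp only [h, Finset.sum_add_distrib, Finset.sum_sub_distrib, ← Finset.mul_sum,
    sum_tensorCube_mul, hw.overlap_self]
  ring

theorem overlapPartition_truncSparseTensorPrior (hk : 0 < k) (hkn : 2 * k ≤ n) (hlam : 0 ≤ lam)
    (v : Fin n → ℝ) (j : ℝ) (Z : Fin n × Fin n × Fin n → ℝ) :
    overlapPartition (truncSparseTensorPrior n k) (lam ^ 2) (j ^ 3) (tensorCube v)
        (gamObs (lam ^ 2) (tensorCube v) Z) =
      ENNReal.ofReal (∑ w ∈ overlapShell k v j,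
        Real.exp (lam ^ 2 * j ^ 3 - (∑ τ, (lam * tensorCube v τ + Z τ) ^ 2) / 2 +
          ham (tensorCoef lam) (posteriorEnergy n k lam) Z w)) := by
  -- Cubing is injective on `ℝ`, so the tensor overlap determines the vector overlap, including its
  -- sign.
  have hodd : ∀ w : Fin n → ℝ, overlap v w ^ 3 = j ^ 3 ↔ overlap v w = j := fun w =>
    (Odd.strictMono_pow (by decide : Odd 3)).injective.eq_iff
  rw [overlapPartition, lintegral_truncSparseTensorPrior (by omega),
    ENNReal.ofReal_sum_of_nonneg fun w _ => (Real.exp_pos _).le, overlapShell, Finset.sum_filter]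
  refine Finset.sum_congr rfl fun w hw => ?_
  simp only [gamObs, Real.sqrt_sq hlam]
  by_cases h : overlap v w = j
  · rw [if_pos h, Set.indicator_of_mem (by simp [sum_tensorCube_mul, h]),
      ← ENNReal.ofReal_mul (priorWeight_nonneg w), sum_gamObs_sub_sq (mem_sparseTernary.1 hw).1, h]
    congr 1
    nth_rw 1 [← Real.exp_log (priorWeight_pos hk hkn hw)]
    rw [← Real.exp_add, ham, posteriorEnergy]
    congr 1
    ring
  · rw [if_neg h, Set.indicator_of_notMem (by simp [sum_tensorCube_mul, hodd, h]), mul_zero]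

/-- Minus the logarithm of the partition function at overlap `j`. -/
def shellCost (n k : ℕ) (lam j : ℝ) (v : Fin n → ℝ) (Z : Fin n × Fin n × Fin n → ℝ) : ℝ :=
  (∑ τ, (lam * tensorCube v τ + Z τ) ^ 2) / 2 - lam ^ 2 * j ^ 3 - shellEnergy n k lam j v Z

theorem neg_log_overlapPartition (hk : 0 < k) (hkn : 2 * k ≤ n) (hlam : 0 ≤ lam)
    {v : Fin n → ℝ} {j : ℝ} (hne : (overlapShell k v j).Nonempty)
    (Z : Fin n × Fin n × Fin n → ℝ) :
    (-(ENNReal.log (overlapPartition (truncSparseTensorPrior n k) (lam ^ 2) (j ^ 3) (tensorCube v)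
        (gamObs (lam ^ 2) (tensorCube v) Z)))).toENNReal =
      ENNReal.ofReal (shellCost n k lam j v Z) := by
  have hpos : 0 < ∑ w ∈ overlapShell k v j,
        Real.exp (lam ^ 2 * j ^ 3 - (∑ τ, (lam * tensorCube v τ + Z τ) ^ 2) / 2 +
          ham (tensorCoef lam) (posteriorEnergy n k lam) Z w) :=
    Finset.sum_pos (fun _ _ => Real.exp_pos _) hne
  rw [overlapPartition_truncSparseTensorPrior hk hkn hlam, ENNReal.log_ofReal_of_pos hpos,
    ← EReal.coe_neg, EReal.real_coe_toENNReal]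
  congr 1
  have : Real.log (∑ w ∈ overlapShell k v j,
        Real.exp (lam ^ 2 * j ^ 3 - (∑ τ, (lam * tensorCube v τ + Z τ) ^ 2) / 2 +
          ham (tensorCoef lam) (posteriorEnergy n k lam) Z w)) =
      shellEnergy n k lam j v Z +
        (lam ^ 2 * j ^ 3 - (∑ τ, (lam * tensorCube v τ + Z τ) ^ 2) / 2) := by
    rw [shellEnergy, ← lse_add_const hne, lse]
    simp only [add_comm]
  rw [this, shellCost]
  ring

/-- Each Boltzmann factor is the exponential of minus a square and the prior weights sum to at most
one. Nonnegativity makes the passage to `ℝ≥0∞` in the potential lossless. -/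
theorem shellCost_nonneg (hk : 0 < k) (hkn : 2 * k ≤ n) {v : Fin n → ℝ} {j : ℝ}
    (hne : (overlapShell k v j).Nonempty) (Z : Fin n × Fin n × Fin n → ℝ) :
    0 ≤ shellCost n k lam j v Z := by
  have h1 : shellEnergy n k lam j v Z ≤
      (∑ τ, (lam * tensorCube v τ + Z τ) ^ 2) / 2 - lam ^ 2 * j ^ 3 := by
    rw [shellEnergy, lse, Real.log_le_iff_le_exp (partition_pos hne _)]
    have h2 : ∀ w ∈ overlapShell k v j,
        Real.exp (ham (tensorCoef lam) (posteriorEnergy n k lam) Z w) ≤ priorWeight n k w *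
          Real.exp ((∑ τ, (lam * tensorCube v τ + Z τ) ^ 2) / 2 - lam ^ 2 * j ^ 3) := by
      intro w hw
      obtain ⟨hw1, hw2⟩ := mem_overlapShell.1 hw
      rw [← Real.exp_log (priorWeight_pos hk hkn hw1)]
      rw [← Real.exp_add, Real.exp_le_exp]
      have h3 := sum_gamObs_sub_sq (lam := lam) (v := v) (mem_sparseTernary.1 hw1).1 Z
      have h4 : 0 ≤ ∑ τ, (lam * tensorCube v τ + Z τ - lam * tensorCube w τ) ^ 2 :=
        Finset.sum_nonneg fun _ _ => sq_nonneg _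
      rw [hw2] at h3
      simp only [ham, posteriorEnergy]
      linarith
    refine (Finset.sum_le_sum h2).trans ?_
    rw [← Finset.sum_mul]
    refine mul_le_of_le_one_left (Real.exp_pos _).le ?_
    rw [← sum_priorWeight (n := n) (k := k) (by omega)]
    exact Finset.sum_le_sum_of_subset_of_nonneg (Finset.filter_subset _ _)
      fun w _ _ => priorWeight_nonneg w
  rw [shellCost]; linarith

theorem integrable_coord_sq {ι : Type} [Fintype ι] (τ : ι) :
    Integrable (fun Z : ι → ℝ => Z τ ^ 2) (stdGaussianNoise ι) := by
  have h : MemLp (fun Z : ι → ℝ => Z τ) 2 (stdGaussianNoise ι) :=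
    (hasGaussianLaw_coord τ).memLp_two
  exact h.integrable_sq

theorem integrable_obs_sq (v : Fin n → ℝ) :
    Integrable (fun Z => (∑ τ, (lam * tensorCube v τ + Z τ) ^ 2) / 2) 𝐙 := by
  refine (integrable_finsetSum _ fun τ _ => ?_).div_const 2
  have : (fun Z : Fin n × Fin n × Fin n → ℝ => (lam * tensorCube v τ + Z τ) ^ 2) =
      fun Z => (lam * tensorCube v τ) ^ 2 + (2 * (lam * tensorCube v τ)) * Z τ + Z τ ^ 2 := by
    funext Z; ring
  rw [this]
  exact ((integrable_const _).add ((integrable_coord τ).const_mul _)).add (integrable_coord_sq τ)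

theorem integrable_shellEnergy {v : Fin n → ℝ} {j : ℝ} (hne : (overlapShell k v j).Nonempty) :
    Integrable (shellEnergy n k lam j v) 𝐙 := integrable_lse_ham hne _ _

theorem integrable_shellCost {v : Fin n → ℝ} {j : ℝ} (hne : (overlapShell k v j).Nonempty) :
    Integrable (shellCost n k lam j v) 𝐙 :=
  ((integrable_obs_sq v).sub (integrable_const _)).sub (integrable_shellEnergy hne)

theorem integral_shellCost {v : Fin n → ℝ} {j : ℝ} (hne : (overlapShell k v j).Nonempty) :
    ∫ Z, shellCost n k lam j v Z ∂𝐙 = ∫ Z, (∑ τ, (lam * tensorCube v τ + Z τ) ^ 2) / 2 ∂𝐙 -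
      lam ^ 2 * j ^ 3 - ∫ Z, shellEnergy n k lam j v Z ∂𝐙 := by
  have h1 := integral_sub ((integrable_obs_sq (lam := lam) v).sub
    (integrable_const (lam ^ 2 * j ^ 3))) (integrable_shellEnergy (lam := lam) hne)
  have h2 := integral_sub (integrable_obs_sq (lam := lam) v)
    (integrable_const (μ := 𝐙) (lam ^ 2 * j ^ 3))
  simp only [Pi.sub_apply] at h1
  rw [h2] at h1
  simpa [shellCost] using h1

/-- The potential at an overlap attained with every signal. -/
theorem tensorFP_eq (hk : 0 < k) (hkn : 2 * k ≤ n) (hlam : 0 ≤ lam) {j : ℝ}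
    (hne : ∀ v ∈ sparseTernary n k, (overlapShell k v j).Nonempty) :
    tensorFP n k lam (j ^ 3) = ENNReal.ofReal (∑ v ∈ sparseTernary n k,
      priorWeight n k v * ∫ Z, shellCost n k lam j v Z ∂𝐙) := by
  rw [tensorFP, quenchedFP, lintegral_truncSparseTensorPrior (by omega),
    ENNReal.ofReal_sum_of_nonneg fun v hv => mul_nonneg (priorWeight_nonneg v)
      (integral_nonneg (shellCost_nonneg hk hkn (hne v hv)))]
  refine Finset.sum_congr rfl fun v hv => ?_
  rw [ENNReal.ofReal_mul (priorWeight_nonneg v), ofReal_integral_eq_lintegral_ofReal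
    (integrable_shellCost (hne v hv)) (ae_of_all _ (shellCost_nonneg hk hkn (hne v hv)))]
  congr 1
  exact lintegral_congr fun Z => neg_log_overlapPartition hk hkn hlam (hne v hv) Z

theorem tensorFP_ne_top (hk : 0 < k) (hkn : 2 * k ≤ n) (hlam : 0 ≤ lam) {j : ℝ}
    (hne : ∀ v ∈ sparseTernary n k, (overlapShell k v j).Nonempty) :
    tensorFP n k lam (j ^ 3) ≠ ∞ := by
  rw [tensorFP_eq hk hkn hlam hne]
  exact ENNReal.ofReal_ne_top

/-- The potential is infinite at an overlap which some signal does not attain. -/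
theorem tensorFP_eq_top (hk : 0 < k) (hkn : 2 * k ≤ n) (hlam : 0 ≤ lam) {j : ℝ} {v : Fin n → ℝ}
    (hv : v ∈ sparseTernary n k) (hne : ¬ (overlapShell k v j).Nonempty) :
    tensorFP n k lam (j ^ 3) = ∞ := by
  rw [tensorFP, quenchedFP, lintegral_truncSparseTensorPrior (by omega), ENNReal.sum_eq_top]
  refine ⟨v, hv, ?_⟩
  have h : ∀ Z, (-(ENNReal.log (overlapPartition (truncSparseTensorPrior n k) (lam ^ 2) (j ^ 3)
      (tensorCube v) (gamObs (lam ^ 2) (tensorCube v) Z)))).toENNReal = ∞ := fun Z => by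
    rw [overlapPartition_truncSparseTensorPrior hk hkn hlam, Finset.not_nonempty_iff_eq_empty.1 hne]
    simp
  simp only [h, lintegral_const, measure_univ, mul_one]
  exact ENNReal.mul_top (by simpa using priorWeight_pos hk hkn hv)

/-- A bound on the restricted free energies implies one on the potential. -/
theorem le_tensorFP_sub (hk : 0 < k) (hkn : 3 * k ≤ n) (hlam : 0 ≤ lam) {j a : ℝ}
    (h : ∀ v ∈ sparseTernary n k, (overlapShell k v j).Nonempty →
      ∫ Z, shellEnergy n k lam j v Z ∂𝐙 + a ≤ ∫ Z, shellEnergy n k lam 0 v Z ∂𝐙) :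
    ((-(lam ^ 2 * j ^ 3) + a : ℝ) : EReal) ≤
      (tensorFP n k lam (j ^ 3) : EReal) - (tensorFP n k lam 0 : EReal) := by
  have hkn' : 2 * k ≤ n := by omega
  have hne0 : ∀ v ∈ sparseTernary n k, (overlapShell k v 0).Nonempty := fun v hv =>
    overlapShell_zero_nonempty hkn hv
  have h0 := tensorFP_eq hk hkn' hlam hne0
  rw [zero_pow three_ne_zero] at h0
  by_cases hne : ∀ v ∈ sparseTernary n k, (overlapShell k v j).Nonempty
  · have hs : ∀ j : ℝ, (∀ v ∈ sparseTernary n k, (overlapShell k v j).Nonempty) →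
        0 ≤ ∑ v ∈ sparseTernary n k, priorWeight n k v * ∫ Z, shellCost n k lam j v Z ∂𝐙 :=
      fun j hne => Finset.sum_nonneg fun v hv => mul_nonneg (priorWeight_nonneg v)
        (integral_nonneg (shellCost_nonneg hk hkn' (hne v hv)))
    rw [h0, tensorFP_eq hk hkn' hlam hne, EReal.coe_ennreal_ofReal, EReal.coe_ennreal_ofReal,
      max_eq_left (hs j hne), max_eq_left (hs 0 hne0), ← EReal.coe_sub, EReal.coe_le_coe_iff,
      ← Finset.sum_sub_distrib]
    calc -(lam ^ 2 * j ^ 3) + a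
        = ∑ v ∈ sparseTernary n k, priorWeight n k v * (-(lam ^ 2 * j ^ 3) + a) := by
          rw [← Finset.sum_mul, sum_priorWeight (by omega), one_mul]
      _ ≤ _ := by
          refine Finset.sum_le_sum fun v hv => ?_
          rw [← mul_sub]
          refine mul_le_mul_of_nonneg_left ?_ (priorWeight_nonneg v)
          rw [integral_shellCost (hne v hv), integral_shellCost (hne0 v hv)]
          have := h v hv (hne v hv)
          linarith
  -- If some signal cannot attain the overlap, the potential there is infinite while it is finite at
  -- `0`, so the bound is trivial. This covers every `q` that is not an attainable cube.
  · push Not at hne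
    obtain ⟨v, hv, hne⟩ := hne
    rw [tensorFP_eq_top hk hkn' hlam hv (by simpa using hne), EReal.coe_ennreal_top, EReal.top_sub]
    · exact le_top
    · rw [h0, EReal.coe_ennreal_ofReal]
      exact EReal.coe_ne_top _

/-- The elimination needs energies depending on a vector only through its size, which the prior
violates at the fallback vector. These bounds let the prior be dropped altogether, at the cost of
the `k * log (n / k)` term. -/
theorem log_priorWeight_bounds (hk : 0 < k) (hkn : 2 * k ≤ n) {w : Fin n → ℝ}
    (hw : w ∈ sparseTernary n k) :
    -(2 * k * (Real.log (n / k) + 2)) ≤ Real.log (priorWeight n k w) ∧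
      Real.log (priorWeight n k w) ≤ 0 := by
  obtain ⟨h1, h2⟩ := neg_log_iidWeight_le hk hkn hw
  refine ⟨h2.trans (Real.log_le_log h1 (iidWeight_le_priorWeight (by omega) hw)),
    Real.log_nonpos (priorWeight_nonneg w) ?_⟩
  rw [← sum_priorWeight (n := n) (k := k) (by omega)]
  exact Finset.single_le_sum (fun w _ => priorWeight_nonneg w) hw

/-- The lower bound on the potential, without signal. -/
theorem le_tensorFP_zero_sub (hk : 0 < k) (hkn : 3 * k ≤ n) (j : ℝ) :
    ((-(2 * k * (Real.log (n / k) + 2)) : ℝ) : EReal) ≤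
      (tensorFP n k 0 (j ^ 3) : EReal) - (tensorFP n k 0 0 : EReal) := by
  have h := le_tensorFP_sub (n := n) (k := k) (lam := 0) (j := j)
    (a := -(2 * k * (Real.log (n / k) + 2))) hk hkn le_rfl fun v hv hne => ?_
  · simpa using h
  have hham : ∀ Z : Fin n × Fin n × Fin n → ℝ, ham (tensorCoef 0) (posteriorEnergy n k 0) Z =
      fun w => Real.log (priorWeight n k w) := fun Z => by
    funext w; simp [ham, tensorCoef, posteriorEnergy]
  have hc : ∀ j, ∫ Z, shellEnergy n k 0 j v Z ∂𝐙 =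
      lse (overlapShell k v j) fun w => Real.log (priorWeight n k w) := fun j => by
    simp [shellEnergy, hham]
  rw [hc, hc]
  obtain ⟨w, hw⟩ := overlapShell_zero_nonempty hkn hv
  have h1 := le_lse (fun w => Real.log (priorWeight n k w)) hw
  have h2 := (log_priorWeight_bounds hk (by omega) (mem_overlapShell.1 hw).1).1
  have h3 : lse (overlapShell k v j) (fun w => Real.log (priorWeight n k w)) ≤ 0 := by
    rw [lse]
    refine Real.log_nonpos (Finset.sum_nonneg fun _ _ => (Real.exp_pos _).le) ?_
    rw [← sum_priorWeight (n := n) (k := k) (by omega)]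
    refine le_trans (Finset.sum_le_sum fun w hw => (Real.exp_log
      (priorWeight_pos hk (by omega) (mem_overlapShell.1 hw).1)).le)
      (Finset.sum_le_sum_of_subset_of_nonneg (Finset.filter_subset _ _)
        fun w _ _ => priorWeight_nonneg w)
  linarith

/-- The lower bound on the potential in terms of the gain per site. -/
theorem le_tensorFP_sub_of_bounds {M : ℕ} {ρ r t g : ℝ}
    (hp : EliminationBounds n k M ρ r t g) (hg : 0 ≤ g) (hkn : 3 * k ≤ n) (hlam : 0 < lam) (j : ℝ) :
    ((-(lam ^ 2 * j ^ 3) +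
      (lam * g * j - 300 * k * (lam + 1) - 2 * k * (Real.log (n / k) + 2)) : ℝ) : EReal) ≤
      (tensorFP n k lam (j ^ 3) : EReal) - (tensorFP n k lam 0 : EReal) := by
  have hk : 0 < k := by have := hp.four_le; omega
  refine le_tensorFP_sub hk hkn hlam.le fun v hv hne => ?_
  -- The elimination is run without the prior: dropping it raises the energies at overlap `j`, and
  -- restoring it at overlap `0` costs at most `2 * k * (log (n / k) + 2)`.
  have h1 := integral_lse_overlapShell_le hp hg hlam
    (fun m => -(lam ^ 2 * (m : ℝ) ^ 3 / 2)) hv hne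
  have hne0 := overlapShell_zero_nonempty hkn hv
  have h2 : ∫ Z, shellEnergy n k lam j v Z ∂𝐙 ≤ ∫ Z, lse (overlapShell k v j)
      (ham (tensorCoef lam) (fun w => -(lam ^ 2 * (hammingNorm w : ℝ) ^ 3 / 2)) Z) ∂𝐙 :=
    integral_mono (integrable_shellEnergy hne) (integrable_lse_ham hne _ _) fun Z =>
      lse_mono hne fun w hw => by
        have := (log_priorWeight_bounds hk (by omega) (mem_overlapShell.1 hw).1).2
        simp only [ham, posteriorEnergy]
        linarith
  have h3 : ∫ Z, lse (overlapShell k v 0)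
      (ham (tensorCoef lam) (fun w => -(lam ^ 2 * (hammingNorm w : ℝ) ^ 3 / 2)) Z) ∂𝐙 -
        2 * k * (Real.log (n / k) + 2) ≤ ∫ Z, shellEnergy n k lam 0 v Z ∂𝐙 := by
    have hi := integrable_lse_ham hne0 (tensorCoef lam)
      (fun w => -(lam ^ 2 * (hammingNorm w : ℝ) ^ 3 / 2))
    have : ∫ Z, lse (overlapShell k v 0)
      (ham (tensorCoef lam) (fun w => -(lam ^ 2 * (hammingNorm w : ℝ) ^ 3 / 2)) Z) ∂𝐙 -
        2 * k * (Real.log (n / k) + 2) = ∫ Z, (lse (overlapShell k v 0)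
      (ham (tensorCoef lam) (fun w => -(lam ^ 2 * (hammingNorm w : ℝ) ^ 3 / 2)) Z) +
        -(2 * k * (Real.log (n / k) + 2))) ∂𝐙 := by
      rw [integral_add hi (integrable_const _)]; simp; ring
    rw [this]
    refine integral_mono (hi.add (integrable_const _)) (integrable_shellEnergy hne0) fun Z => ?_
    simp only
    rw [← lse_add_const hne0]
    refine lse_mono hne0 fun w hw => ?_
    have := (log_priorWeight_bounds hk (by omega) (mem_overlapShell.1 hw).1).1
    simp only [ham, posteriorEnergy]
    linarith
  linarith

/-- Small nonnegative integer overlaps are attained with every signal. -/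
theorem overlapShell_natCast_nonempty (hkn : 3 * k ≤ n) {v : Fin n → ℝ}
    (hv : v ∈ sparseTernary n k) {j : ℕ} (hj : 2 * j ≤ k) :
    (overlapShell k v (j : ℝ)).Nonempty := by
  classical
  obtain ⟨hv1, hv2, hv3⟩ := mem_sparseTernary.1 hv
  rw [hammingNorm_eq_card] at hv2 hv3
  set S := Finset.univ.filter fun p => v p ≠ 0
  obtain ⟨E, hES, hEc⟩ := Finset.exists_subset_card_eq (s := S) (n := j) (by omega)
  have hc : k - j ≤ (Finset.univ \ S).card := by
    have := Finset.card_sdiff_add_card_eq_card (Finset.subset_univ S)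
    rw [Finset.card_univ, Fintype.card_fin] at this
    omega
  obtain ⟨E', hE', hEc'⟩ := Finset.exists_subset_card_eq hc
  have hE'S : ∀ p ∈ E', p ∉ S := fun p hp => (Finset.mem_sdiff.1 (hE' hp)).2
  have hdis : Disjoint E E' := Finset.disjoint_left.2 fun p hp hp' => hE'S p hp' (hES hp)
  -- Agree with `v` on `j` sites of its support, and put `k - j` ones off the support, so that the
  -- size is exactly `k`.
  let w : Fin n → ℝ := fun p => if p ∈ E then v p else if p ∈ E' then 1 else 0
  have hS : ∀ p, p ∈ S ↔ v p ≠ 0 := fun p => by simp [S]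
  have hwn : hammingNorm w = k := by
    have : (Finset.univ.filter fun p => w p ≠ 0) = E ∪ E' := by
      ext p
      simp only [Finset.mem_filter, Finset.mem_univ, true_and, Finset.mem_union, w]
      by_cases h1 : p ∈ E
      · simp [h1, (hS p).1 (hES h1)]
      · by_cases h2 : p ∈ E' <;> simp [h1, h2]
    rw [hammingNorm_eq_card, this, Finset.card_union_of_disjoint hdis, hEc, hEc']
    omega
  refine ⟨w, mem_overlapShell.2 ⟨mem_sparseTernary.2 ⟨fun p => ?_, by omega, by omega⟩, ?_⟩⟩
  · by_cases h1 : p ∈ E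
    · simpa [w, h1] using hv1 p
    · by_cases h2 : p ∈ E' <;> simp [w, h1, h2]
  · have : ∀ p, v p * w p = if p ∈ E then 1 else 0 := fun p => by
      by_cases h1 : p ∈ E
      · have h3 := (hS p).1 (hES h1)
        simp only [w, h1, if_true, ← sq, hv1.sq_eq_ite, if_pos h3]
      · by_cases h2 : p ∈ E'
        · have h3 : v p = 0 := not_not.1 fun h => hE'S p h2 ((hS p).2 h)
          simp [h1, h3]
        · simp [w, h1, h2]
    simp [overlap, this, hEc]

end Potential

/-! ### Trivial error from below, low-degree error from above -/

section LowDegree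

variable {n k : ℕ} {lam : ℝ}

theorem sum_exp_mul_iidWeight (p θ : ℝ) :
    ∑ w ∈ Fintype.piFinset (fun _ : Fin n => ({0, 1, -1} : Finset ℝ)),
      Real.exp (θ * hammingNorm w) * iidWeight p w = (1 - p + p * Real.exp θ) ^ n := by
  have e : ∀ w : Fin n → ℝ, Real.exp (θ * hammingNorm w) * iidWeight p w =
      ∏ i, (if w i = 0 then 1 - p else Real.exp θ * (p / 2)) := fun w => by
    have : Real.exp (θ * hammingNorm w) = ∏ i, if w i = 0 then 1 else Real.exp θ := by
      rw [Finset.prod_ite, Finset.prod_const_one, one_mul, Finset.prod_const, mul_comm,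
        Real.exp_nat_mul, hammingNorm_eq_card]
    rw [this, iidWeight, ← Finset.prod_mul_distrib]
    refine Finset.prod_congr rfl fun i _ => ?_
    split_ifs <;> simp
  rw [Finset.sum_congr rfl fun w _ => e w,
    sum_ternary_prod fun _ a => if a = 0 then 1 - p else Real.exp θ * (p / 2)]
  simp
  congr 1
  ring

theorem sum_iidWeight (p : ℝ) :
    ∑ w ∈ Fintype.piFinset (fun _ : Fin n => ({0, 1, -1} : Finset ℝ)), iidWeight p w = 1 := by
  have := sum_exp_mul_iidWeight (n := n) p 0
  simpa using this

/-- The Chernoff bound for the number of nonzero entries. -/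
theorem sum_exp_mul_iidWeight_le (hn : 0 < n) (hkn : k ≤ n) (θ : ℝ) :
    ∑ w ∈ Fintype.piFinset (fun _ : Fin n => ({0, 1, -1} : Finset ℝ)),
      Real.exp (θ * hammingNorm w) * iidWeight (k / n) w ≤ Real.exp (k * (Real.exp θ - 1)) := by
  rw [sum_exp_mul_iidWeight]
  have hn' : (0 : ℝ) < n := by exact_mod_cast hn
  have h0 := (ratio_mem hkn).1
  have h1 := (ratio_mem hkn).2
  have h2 : (0 : ℝ) ≤ (k : ℝ) / n * Real.exp θ := by positivity
  calc (1 - (k : ℝ) / n + k / n * Real.exp θ) ^ n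
      ≤ (Real.exp (k / n * (Real.exp θ - 1))) ^ n := by
        refine pow_le_pow_left₀ (by linarith) ?_ n
        refine le_trans (le_of_eq ?_) (Real.add_one_le_exp _)
        ring
    _ = Real.exp (k * (Real.exp θ - 1)) := by
        rw [← Real.exp_nat_mul]
        congr 1
        field_simp

/-- Most of the mass of the untruncated law is kept by the truncation. -/
theorem half_le_sum_iidWeight (hk : 20 ≤ k) (hkn : k ≤ n) :
    1 / 2 ≤ ∑ w ∈ sparseTernary n k, iidWeight (k / n) w := by
  have hn : 0 < n := by omega
  have hk' : (20 : ℝ) ≤ k := by exact_mod_cast hk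
  set T := Fintype.piFinset (fun _ : Fin n => ({0, 1, -1} : Finset ℝ))
  have hq : ∀ w : Fin n → ℝ, 0 ≤ iidWeight (k / n) w :=
    iidWeight_nonneg (ratio_mem hkn).1 (ratio_mem hkn).2
  have hup := mul_le_mul_of_nonneg_left (sum_exp_mul_iidWeight_le hn hkn (1 / 2))
    (Real.exp_pos (-k)).le
  have hlo := mul_le_mul_of_nonneg_left (sum_exp_mul_iidWeight_le hn hkn (-(1 / 2)))
    (Real.exp_pos ((k : ℝ) / 4)).le
  rw [← Real.exp_add, Finset.mul_sum] at hup hlo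
  -- Both discarded events, size above `2 * k` and size below `k / 2`, are controlled by exponential
  -- moments at `θ = 1 / 2` and `θ = -1 / 2`.
  have hpt : ∀ w ∈ T, iidWeight (k / n) w ≤
      (if k ≤ 2 * hammingNorm w ∧ hammingNorm w ≤ 2 * k then iidWeight (k / n) w else 0) +
      Real.exp (-k) * (Real.exp (1 / 2 * hammingNorm w) * iidWeight (k / n) w) +
      Real.exp (k / 4) * (Real.exp (-(1 / 2) * hammingNorm w) * iidWeight (k / n) w) := by
    intro w _
    have e1 : Real.exp (-k) * (Real.exp (1 / 2 * hammingNorm w) * iidWeight (k / n) w) =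
        Real.exp (-k + 1 / 2 * hammingNorm w) * iidWeight (k / n) w := by rw [Real.exp_add]; ring
    have e2 : Real.exp (k / 4) * (Real.exp (-(1 / 2) * hammingNorm w) * iidWeight (k / n) w) =
        Real.exp (k / 4 + -(1 / 2) * hammingNorm w) * iidWeight (k / n) w := by
      rw [Real.exp_add]; ring
    rw [e1, e2]
    have p1 : 0 ≤ Real.exp (-k + 1 / 2 * hammingNorm w) * iidWeight (k / n) w :=
      mul_nonneg (Real.exp_pos _).le (hq w)
    have p2 : 0 ≤ Real.exp (k / 4 + -(1 / 2) * hammingNorm w) * iidWeight (k / n) w :=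
      mul_nonneg (Real.exp_pos _).le (hq w)
    by_cases h : k ≤ 2 * hammingNorm w ∧ hammingNorm w ≤ 2 * k
    · rw [if_pos h]; linarith
    · rw [if_neg h]
      rw [not_and_or, not_le, not_le] at h
      rcases h with h | h
      · have h' : 2 * (hammingNorm w : ℝ) < k := by exact_mod_cast h
        have := le_mul_of_one_le_left (hq w) (Real.one_le_exp
          (by linarith : (0 : ℝ) ≤ k / 4 + -(1 / 2) * hammingNorm w))
        linarith
      · have h' : 2 * (k : ℝ) < hammingNorm w := by exact_mod_cast h
        have := le_mul_of_one_le_left (hq w) (Real.one_le_exp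
          (by linarith : (0 : ℝ) ≤ -k + 1 / 2 * hammingNorm w))
        linarith
  have hsum := Finset.sum_le_sum hpt
  rw [sum_iidWeight, Finset.sum_add_distrib, Finset.sum_add_distrib, ← Finset.sum_filter] at hsum
  have hexp : Real.exp (1 / 2) ≤ 1.7 := by
    have h1 : Real.exp (1 / 2) ^ 2 = Real.exp 1 := by rw [← Real.exp_nat_mul]; norm_num
    have h2 := Real.exp_one_lt_d9
    nlinarith [Real.exp_pos (1 / 2)]
  have hexp' : Real.exp (-(1 / 2)) ≤ 0.65 := by
    rw [Real.exp_neg]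
    have h1 : (1.625 : ℝ) ≤ Real.exp (1 / 2) := by
      have := Real.quadratic_le_exp_of_nonneg (x := 1 / 2) (by norm_num)
      norm_num at this ⊢; linarith
    rw [inv_le_comm₀ (Real.exp_pos _) (by norm_num)]
    refine le_trans ?_ h1
    norm_num
  have h4 : Real.exp (-2) ≤ 0.2 := by
    have h1 : Real.exp 2 = Real.exp 1 * Real.exp 1 := by rw [← Real.exp_add]; norm_num
    have h2 := Real.exp_one_gt_d9
    rw [Real.exp_neg, inv_le_comm₀ (Real.exp_pos _) (by norm_num), h1]
    nlinarith
  -- The exponents are at most `-0.3 * k` and `-0.1 * k`; the second one is where `20 ≤ k` is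
  -- needed.
  have b1 : Real.exp (-k + k * (Real.exp (1 / 2) - 1)) ≤ 0.2 :=
    (Real.exp_le_exp.2 (by nlinarith)).trans h4
  have b2 : Real.exp (k / 4 + k * (Real.exp (-(1 / 2)) - 1)) ≤ 0.2 :=
    (Real.exp_le_exp.2 (by nlinarith)).trans h4
  have hW : ∑ w ∈ T with k ≤ 2 * hammingNorm w ∧ hammingNorm w ≤ 2 * k, iidWeight (k / n) w =
      ∑ w ∈ sparseTernary n k, iidWeight (k / n) w := rfl
  rw [hW] at hsum
  norm_num at hsum hup hlo b1 b2 ⊢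
  linarith

theorem sparseTernary_neg {w : Fin n → ℝ} (hw : w ∈ sparseTernary n k) :
    -w ∈ sparseTernary n k := by
  obtain ⟨h1, h2⟩ := mem_sparseTernary.1 hw
  have : hammingNorm (-w) = hammingNorm w := by simp [hammingNorm]
  rw [mem_sparseTernary, this]
  refine ⟨fun p => ?_, h2⟩
  rcases h1 p with h | h | h <;> simp [h]

theorem tensorCube_neg (w : Fin n → ℝ) (τ : Fin n × Fin n × Fin n) :
    tensorCube (-w) τ = -tensorCube w τ := by
  simp [tensorCube]

/-- No constant estimates the signal well. -/
theorem le_trivialMMSE (hk : 20 ≤ k) (hkn : k ≤ n) :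
    ENNReal.ofReal ((k : ℝ) ^ 3 / 16) ≤ trivialMMSE (truncSparseTensorPrior n k) := by
  refine le_iInf fun b => ?_
  rw [lintegral_truncSparseTensorPrior hkn]
  have h1 : ∀ w ∈ sparseTernary n k, ENNReal.ofReal (priorWeight n k w) *
      ENNReal.ofReal (∑ τ, (b τ - tensorCube w τ) ^ 2) =
      ENNReal.ofReal (priorWeight n k w * ∑ τ, (b τ - tensorCube w τ) ^ 2) := fun w _ =>
    (ENNReal.ofReal_mul (priorWeight_nonneg w)).symm
  rw [Finset.sum_congr rfl h1, ← ENNReal.ofReal_sum_of_nonneg fun w _ =>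
    mul_nonneg (priorWeight_nonneg w) (Finset.sum_nonneg fun _ _ => sq_nonneg _)]
  refine ENNReal.ofReal_le_ofReal ?_
  have hq : ∀ w : Fin n → ℝ, 0 ≤ iidWeight (k / n) w :=
    iidWeight_nonneg (ratio_mem hkn).1 (ratio_mem hkn).2
  set Q := ∑ w ∈ sparseTernary n k, iidWeight (k / n) w * ∑ τ, (b τ - tensorCube w τ) ^ 2
  have h2 : Q ≤ ∑ w ∈ sparseTernary n k, priorWeight n k w * ∑ τ, (b τ - tensorCube w τ) ^ 2 :=
    Finset.sum_le_sum fun w hw => mul_le_mul_of_nonneg_right (iidWeight_le_priorWeight hkn hw)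
      (Finset.sum_nonneg fun _ _ => sq_nonneg _)
  -- The i.i.d. weight is even while the prior need not be. Averaging `Q` with its reflection uses
  -- `(b - x) ^ 2 + (b + x) ^ 2 ≥ 2 * x ^ 2`, so no constant helps. Retained mass at least `1 / 2`
  -- and size at least `k / 2` give `k ^ 3 / 16`.
  have h3 : Q = ∑ w ∈ sparseTernary n k,
      iidWeight (k / n) w * ∑ τ, (b τ + tensorCube w τ) ^ 2 := by
    refine Finset.sum_nbij' (fun w => -w) (fun w => -w) (fun w hw => sparseTernary_neg hw)
      (fun w hw => sparseTernary_neg hw) (fun w _ => neg_neg w) (fun w _ => neg_neg w)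
      fun w _ => ?_
    rw [iidWeight_neg]
    congr 1
    refine Finset.sum_congr rfl fun τ _ => ?_
    rw [tensorCube_neg]; ring
  have h4 : ∑ w ∈ sparseTernary n k, iidWeight (k / n) w * ((k : ℝ) ^ 3 / 4) ≤ Q + Q := by
    nth_rw 2 [h3]
    rw [← Finset.sum_add_distrib]
    refine Finset.sum_le_sum fun w hw => ?_
    rw [← mul_add]
    refine mul_le_mul_of_nonneg_left ?_ (hq w)
    obtain ⟨a1, a2, _⟩ := mem_sparseTernary.1 hw
    have h5 : ∑ τ, tensorCube w τ * tensorCube w τ = (hammingNorm w : ℝ) ^ 3 := by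
      rw [sum_tensorCube_mul, a1.overlap_self]
    have h6 : (k : ℝ) / 2 ≤ hammingNorm w := by
      have : (k : ℝ) ≤ 2 * hammingNorm w := by exact_mod_cast a2
      linarith
    have h7 : ((k : ℝ) / 2) ^ 3 ≤ (hammingNorm w : ℝ) ^ 3 := by gcongr
    rw [← Finset.sum_add_distrib]
    calc (k : ℝ) ^ 3 / 4 ≤ 2 * ∑ τ, tensorCube w τ * tensorCube w τ := by
          rw [h5]; linarith
      _ = ∑ τ, 2 * (tensorCube w τ * tensorCube w τ) := Finset.mul_sum _ _ _
      _ ≤ _ := Finset.sum_le_sum fun τ _ => by nlinarith [sq_nonneg (b τ)]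
  rw [← Finset.sum_mul] at h4
  have h8 := half_le_sum_iidWeight hk hkn
  have h9 : (0 : ℝ) ≤ (k : ℝ) ^ 3 / 4 := by positivity
  nlinarith

/-- The moment controlling the error of the entrywise power estimator. -/
def powerMoment (d : ℕ) : ℝ≥0∞ :=
  ∫⁻ z, ENNReal.ofReal ((d * (1 + |z|) ^ d) ^ 2) ∂(gaussianReal 0 1)

theorem powerMoment_ne_top (d : ℕ) : powerMoment d ≠ ∞ := by
  have hp : ∀ p : NNReal, MemLp (fun z : ℝ => 1 + |z|) p (gaussianReal 0 1) := fun p => by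
    have h1 : MemLp (fun _ : ℝ => (1 : ℝ)) p (gaussianReal 0 1) := memLp_const 1
    have h2 := (memLp_id_gaussianReal (μ := 0) (v := 1) p).norm
    simp only [id, Real.norm_eq_abs] at h2
    exact h1.add h2
  have h : MemLp (fun z : ℝ => 1 + |z|) ((2 * d : ℕ) : ℝ≥0∞) (gaussianReal 0 1) := by
    rw [← ENNReal.coe_natCast]
    exact hp _
  have h2 : Integrable (fun z : ℝ => (d * (1 + |z|) ^ d) ^ 2) (gaussianReal 0 1) := by
    have h3 := (h.integrable_norm_pow').const_mul ((d : ℝ) ^ 2)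
    refine h3.congr (ae_of_all _ fun z => ?_)
    simp only [Real.norm_eq_abs]
    rw [abs_of_nonneg (by positivity : (0 : ℝ) ≤ 1 + |z|)]
    ring
  rw [powerMoment, ← ofReal_integral_eq_lintegral_ofReal h2 (ae_of_all _ fun z => sq_nonneg _)]
  exact ENNReal.ofReal_ne_top

/-- The error of the power estimator at a nonzero entry. -/
theorem sq_pow_sub_le {d : ℕ} (hd : 0 < d) (hlam : 1 ≤ lam) {x : ℝ} (hx : |x| ≤ 1)
    (hxd : x ^ d = x) (z : ℝ) :
    ((lam⁻¹) ^ d * (lam * x + z) ^ d - x) ^ 2 ≤ (lam⁻¹) ^ 2 * (d * (1 + |z|) ^ d) ^ 2 := by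
  have hl0 : 0 < lam := by linarith
  have hinv : lam⁻¹ ≤ 1 := inv_le_one_of_one_le₀ hlam
  have h1 : (lam⁻¹) ^ d * (lam * x + z) ^ d - x = (x + lam⁻¹ * z) ^ d - x ^ d := by
    rw [hxd, ← mul_pow]
    congr 2
    field_simp
  have hz : |lam⁻¹ * z| ≤ |z| := by
    rw [abs_mul, abs_of_pos (inv_pos.2 hl0)]
    exact mul_le_of_le_one_left (abs_nonneg z) hinv
  have h2 := abs_pow_sub_pow_le (x + lam⁻¹ * z) x d
  have h3 : max |x + lam⁻¹ * z| |x| ≤ 1 + |z| := by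
    refine max_le ((abs_add_le _ _).trans (add_le_add hx hz)) ?_
    linarith [abs_nonneg z]
  have h4 : max |x + lam⁻¹ * z| |x| ^ (d - 1) ≤ (1 + |z|) ^ (d - 1) :=
    pow_le_pow_left₀ (by positivity) h3 _
  have h5 : |(x + lam⁻¹ * z) ^ d - x ^ d| ≤ lam⁻¹ * (d * (1 + |z|) ^ d) := by
    refine h2.trans ?_
    rw [add_sub_cancel_left, abs_mul, abs_of_pos (inv_pos.2 hl0)]
    calc lam⁻¹ * |z| * d * max |x + lam⁻¹ * z| |x| ^ (d - 1)
        ≤ lam⁻¹ * (1 + |z|) * d * (1 + |z|) ^ (d - 1) := by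
          gcongr
          linarith [abs_nonneg z]
      _ = lam⁻¹ * (d * ((1 + |z|) ^ (d - 1) * (1 + |z|))) := by ring
      _ = _ := by rw [← pow_succ, Nat.sub_add_cancel hd]
  rw [h1, ← mul_pow, ← sq_abs]
  exact pow_le_pow_left₀ (abs_nonneg _) h5 2

/-- The error of the power estimator at a zero entry. -/
theorem sq_pow_le {d : ℕ} (hd : 0 < d) (hlam : 0 < lam) (z : ℝ) :
    ((lam⁻¹) ^ d * z ^ d) ^ 2 ≤ (lam⁻¹) ^ (2 * d) * (d * (1 + |z|) ^ d) ^ 2 := by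
  have hd' : (1 : ℝ) ≤ d := by exact_mod_cast hd
  have h1 : |z| ^ d ≤ d * (1 + |z|) ^ d := by
    calc |z| ^ d ≤ (1 + |z|) ^ d := by gcongr; linarith
      _ ≤ _ := le_mul_of_one_le_left (by positivity) hd'
  have h2 : (z ^ d) ^ 2 ≤ (d * (1 + |z|) ^ d) ^ 2 := by
    rw [← sq_abs (z ^ d), abs_pow]
    exact pow_le_pow_left₀ (by positivity) h1 2
  rw [mul_pow, ← pow_mul, mul_comm d 2]
  exact mul_le_mul_of_nonneg_left h2 (by positivity)

theorem lintegral_coord {ι : Type} [Fintype ι] (τ : ι) {f : ℝ → ℝ≥0∞} (hf : Measurable f) :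
    ∫⁻ Z : ι → ℝ, f (Z τ) ∂(stdGaussianNoise ι) = ∫⁻ z, f z ∂(gaussianReal 0 1) := by
  rw [← map_coord τ, lintegral_map hf (measurable_pi_apply τ)]

/-- The entrywise power estimator bounds the low-degree error. -/
theorem lowDegreeMMSE_le {d D : ℕ} (hd : Odd d) (hdD : d ≤ D) (hkn : k ≤ n) (hlam : 1 ≤ lam) :
    lowDegreeMMSE (truncSparseTensorPrior n k) (lam ^ 2) D ≤
      ENNReal.ofReal ((2 * k) ^ 3 * (lam⁻¹) ^ 2 + (n : ℝ) ^ 3 * (lam⁻¹) ^ (2 * d)) *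
        powerMoment d := by
  classical
  have hl0 : 0 < lam := by linarith
  -- The estimator is `(Y τ / lam) ^ d`; odd `d` is needed to fix the value `-1`.
  let f : Fin n × Fin n × Fin n → {p : MvPolynomial (Fin n × Fin n × Fin n) ℝ // p.totalDegree ≤ D} :=
    fun τ => ⟨MvPolynomial.C ((lam⁻¹) ^ d) * MvPolynomial.X τ ^ d, by
      refine (MvPolynomial.totalDegree_mul _ _).trans ?_
      rw [MvPolynomial.totalDegree_C, zero_add, MvPolynomial.totalDegree_X_pow]
      exact hdD⟩
  refine (iInf_le _ f).trans ?_
  rw [lintegral_truncSparseTensorPrior hkn]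
  have hmain : ∀ w ∈ sparseTernary n k, ∫⁻ Z, ENNReal.ofReal (∑ τ,
      (MvPolynomial.eval (gamObs (lam ^ 2) (tensorCube w) Z) (f τ).1 - tensorCube w τ) ^ 2)
        ∂(stdGaussianNoise (Fin n × Fin n × Fin n)) ≤
      ENNReal.ofReal ((2 * k) ^ 3 * (lam⁻¹) ^ 2 + (n : ℝ) ^ 3 * (lam⁻¹) ^ (2 * d)) *
        powerMoment d := by
    intro w hw
    obtain ⟨a1, _, a2⟩ := mem_sparseTernary.1 hw
    -- Nonzero entries, at most `(2 * k) ^ 3` of them, have error of order `lam ^ (-2)`; the zero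
    -- entries have the much smaller `lam ^ (-2 * d)`, which must beat `n ^ 3`.
    let c : Fin n × Fin n × Fin n → ℝ := fun τ =>
      tensorCube w τ * tensorCube w τ * (lam⁻¹) ^ 2 + (lam⁻¹) ^ (2 * d)
    have hc0 : ∀ τ, 0 ≤ c τ := fun τ =>
      add_nonneg (mul_nonneg (mul_self_nonneg _) (by positivity)) (by positivity)
    have hmeas : Measurable fun z : ℝ => ENNReal.ofReal (((d : ℝ) * (1 + |z|) ^ d) ^ 2) := by
      fun_prop
    have hcube : ∀ τ, tensorCube w τ = 0 ∨ tensorCube w τ = 1 ∨ tensorCube w τ = -1 := fun τ => by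
      unfold tensorCube
      rcases a1 τ.1 with h | h | h <;> rcases a1 τ.2.1 with h' | h' | h' <;>
        rcases a1 τ.2.2 with h'' | h'' | h'' <;> rw [h, h', h''] <;> norm_num
    have hpt : ∀ Z : Fin n × Fin n × Fin n → ℝ, ∑ τ,
        (MvPolynomial.eval (gamObs (lam ^ 2) (tensorCube w) Z) (f τ).1 - tensorCube w τ) ^ 2 ≤
        ∑ τ, c τ * ((d : ℝ) * (1 + |Z τ|) ^ d) ^ 2 := fun Z => by
      refine Finset.sum_le_sum fun τ _ => ?_
      simp only [f, map_mul, MvPolynomial.eval_C, map_pow, MvPolynomial.eval_X, gamObs,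
        Real.sqrt_sq hl0.le, c]
      have p1 : 0 ≤ (lam⁻¹) ^ (2 * d) * ((d : ℝ) * (1 + |Z τ|) ^ d) ^ 2 := by positivity
      rcases hcube τ with h | h | h
      · have := sq_pow_le hd.pos hl0 (Z τ)
        simpa [h] using this
      · have := sq_pow_sub_le hd.pos hlam (x := 1) (by simp) (by simp) (Z τ)
        rw [h, add_mul]
        linarith
      · have := sq_pow_sub_le hd.pos hlam (x := -1) (by simp) hd.neg_one_pow (Z τ)
        rw [h, add_mul]
        linarith
    calc _ ≤ ∫⁻ Z, ∑ τ, ENNReal.ofReal (c τ) *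
            ENNReal.ofReal (((d : ℝ) * (1 + |Z τ|) ^ d) ^ 2)
            ∂(stdGaussianNoise (Fin n × Fin n × Fin n)) := by
          refine lintegral_mono fun Z => ?_
          refine (ENNReal.ofReal_le_ofReal (hpt Z)).trans (le_of_eq ?_)
          rw [ENNReal.ofReal_sum_of_nonneg fun τ _ => mul_nonneg (hc0 τ) (sq_nonneg _)]
          exact Finset.sum_congr rfl fun τ _ => ENNReal.ofReal_mul (hc0 τ)
      _ = ∑ τ, ENNReal.ofReal (c τ) * powerMoment d := by
          have hm : ∀ τ : Fin n × Fin n × Fin n, Measurable fun Z : Fin n × Fin n × Fin n → ℝ =>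
              ENNReal.ofReal (((d : ℝ) * (1 + |Z τ|) ^ d) ^ 2) := fun τ =>
            hmeas.comp (measurable_pi_apply τ)
          rw [lintegral_finsetSum _ fun τ _ => (hm τ).const_mul _]
          refine Finset.sum_congr rfl fun τ _ => ?_
          rw [lintegral_const_mul _ (hm τ)]
          congr 1
          exact lintegral_coord τ hmeas
      _ ≤ _ := by
          rw [← Finset.sum_mul, ← ENNReal.ofReal_sum_of_nonneg fun τ _ => hc0 τ]
          refine mul_le_mul_left (ENNReal.ofReal_le_ofReal ?_) _
          simp only [c]
          rw [Finset.sum_add_distrib, ← Finset.sum_mul, sum_tensorCube_mul, a1.overlap_self,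
            Finset.sum_const, Finset.card_univ, Fintype.card_prod, Fintype.card_prod,
            Fintype.card_fin, nsmul_eq_mul]
          have : (hammingNorm w : ℝ) ≤ 2 * k := by exact_mod_cast a2
          push_cast
          have h2 : (n : ℝ) * (n * n) = n ^ 3 := by ring
          rw [h2]
          gcongr
  calc _ ≤ ∑ w ∈ sparseTernary n k, ENNReal.ofReal (priorWeight n k w) * _ :=
        Finset.sum_le_sum fun w hw => mul_le_mul_right (hmain w hw) _
    _ = _ := by
        rw [← Finset.sum_mul, ← ENNReal.ofReal_sum_of_nonneg fun w _ => priorWeight_nonneg w,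
          sum_priorWeight hkn, ENNReal.ofReal_one, one_mul]

end LowDegree

/-! ### Choice of parameters and the lower bound on the potential -/

section Asymptotic

variable {n k : ℕ} {lam : ℝ}

/-- The elimination of sites is possible with gain `0.01 k √(2 log n)` when `k` is at least
logarithmic and at most a small power of `n`. -/
theorem eliminationBounds_of_large (hL : 10 ^ 9 ≤ Real.log n) (hLk : Real.log n ≤ k)
    (hkL : Real.log k ≤ 2e-8 * Real.log n) :
    EliminationBounds n k (n / (2 * k ^ 4)) √(2 * Real.log n) √(2 * Real.log k)
      (0.95 * √(2 * Real.log n) - 1) (0.01 * k * √(2 * Real.log n)) ∧ 3 * k ≤ n := by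
  set L := Real.log n
  set ρ := √(2 * L)
  have hk9 : (10 ^ 9 : ℝ) ≤ k := hL.trans hLk
  have hk0 : (0 : ℝ) < k := by linarith
  have hn0 : (0 : ℝ) < n := by
    rcases Nat.eq_zero_or_pos n with h | h
    · simp only [L, h, Nat.cast_zero, Real.log_zero] at hL; norm_num at hL
    · exact_mod_cast h
  have hn : (n : ℝ) = Real.exp L := (Real.exp_log hn0).symm
  -- With `k` below `n ^ (2e-8)`, the `k ^ 4` blocks take only a factor `n ^ 0.01`, so each block
  -- keeps at least `3 * n ^ 0.99` sites.
  have hk4 : 12 * (k : ℝ) ^ 4 ≤ Real.exp (0.01 * L) := by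
    have h1 : (k : ℝ) ^ 4 = Real.exp (4 * Real.log k) := by
      rw [show (4 : ℝ) * Real.log k = ((4 : ℕ) : ℝ) * Real.log k by norm_num, Real.exp_nat_mul,
        Real.exp_log hk0]
    have h2 : (12 : ℝ) ≤ Real.exp 11 := by
      have := Real.add_one_le_exp (11 : ℝ); linarith
    calc 12 * (k : ℝ) ^ 4 ≤ Real.exp 11 * Real.exp (4 * Real.log k) := by rw [h1]; gcongr
      _ = Real.exp (11 + 4 * Real.log k) := (Real.exp_add _ _).symm
      _ ≤ _ := Real.exp_le_exp.2 (by linarith)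
  have hk4n : 12 * (k : ℝ) ^ 4 ≤ n := by
    rw [hn]; exact hk4.trans (Real.exp_le_exp.2 (by linarith))
  have hkk4 : (k : ℝ) ≤ (k : ℝ) ^ 4 := le_self_pow₀ (by linarith) (by norm_num)
  set M := n / (2 * k ^ 4)
  have hkN : 0 < k := by exact_mod_cast hk0
  have hM1 : 2 * (k : ℝ) ^ 4 * M ≤ n := by
    have := Nat.mul_div_le n (2 * k ^ 4)
    exact_mod_cast this
  have hM2 : (n : ℝ) ≤ 4 * k ^ 4 * M := by
    have h1 := Nat.lt_mul_div_succ n (by positivity : 0 < 2 * k ^ 4)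
    have h2 : (n : ℝ) < 2 * k ^ 4 * (M + 1) := by exact_mod_cast h1
    linarith
  have hMpos : (0 : ℝ) < M := by
    by_contra h
    have : (M : ℝ) = 0 := le_antisymm (not_lt.1 h) (Nat.cast_nonneg _)
    rw [this] at hM2
    linarith
  have hρ2 : ρ ^ 2 = 2 * L := Real.sq_sqrt (by linarith)
  have hρ : 40000 ≤ ρ := Real.le_sqrt_of_sq_le (by linarith)
  set r := √(2 * Real.log k)
  have hlogk : 0 ≤ Real.log k := Real.log_natCast_nonneg _
  have hlogk1 : 1 ≤ Real.log k := by
    rw [Real.le_log_iff_exp_le hk0]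
    linarith [Real.exp_one_lt_d9]
  have hr2 : r ^ 2 = 2 * Real.log k := Real.sq_sqrt (by linarith)
  have hr : 1 ≤ r := Real.le_sqrt_of_sq_le (by linarith)
  have hrρ : r ≤ 2e-4 * ρ := by
    refine Real.sqrt_le_iff.2 ⟨by linarith, ?_⟩
    rw [mul_pow, hρ2]
    norm_num at hkL ⊢
    linarith
  refine ⟨⟨?_, hLk, ?_, ?_, by linarith, by linarith, hr, ?_, by linarith, fun b hb1 hb2 => ?_⟩, ?_⟩
  · exact_mod_cast (by linarith : (4 : ℝ) ≤ k)
  · exact_mod_cast hMpos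
  · have : (k : ℝ) ^ 4 * M + 6 * k ≤ n := by linarith
    exact_mod_cast this
  · rw [neg_div, hr2, mul_div_cancel_left₀ _ (two_ne_zero' ℝ), Real.exp_neg, Real.exp_log hk0,
      mul_inv_cancel₀ hk0.ne']
  · set e := Real.exp (-(M * (Real.exp (-(0.95 * ρ - 1 + 1) ^ 2 / 2) / 3)))
    -- A Gaussian exceeds `0.95 * ρ - 1` with probability at least `n ^ (-0.9025) / 3`, so among `M
    -- ≥ 3 * n ^ 0.99` of them one almost surely does.
    have he : e ≤ 0.01 := by
      have e1 : -(0.95 * ρ - 1 + 1) ^ 2 / 2 = -(0.9025 * L) := by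
        have : (0.95 * ρ - 1 + 1) ^ 2 = 0.9025 * ρ ^ 2 := by ring
        rw [this, hρ2]; ring
      have e2 : (99 : ℝ) ≤ M * (Real.exp (-(0.9025 * L)) / 3) := by
        have e3 : 3 * Real.exp (0.99 * L) ≤ M := by
          have h1 : Real.exp (0.99 * L) * Real.exp (0.01 * L) = Real.exp L := by
            rw [← Real.exp_add]; ring_nf
          have h2 : 3 * Real.exp (0.99 * L) * Real.exp (0.01 * L) ≤ M * Real.exp (0.01 * L) := by
            have h3 : 4 * (k : ℝ) ^ 4 * M ≤ Real.exp (0.01 * L) / 3 * M := by gcongr; linarith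
            rw [mul_assoc, h1, ← hn]
            linarith
          exact le_of_mul_le_mul_right h2 (Real.exp_pos _)
        calc (99 : ℝ) ≤ 0.0875 * L + 1 := by linarith
          _ ≤ Real.exp (0.0875 * L) := Real.add_one_le_exp _
          _ = 3 * Real.exp (0.99 * L) * (Real.exp (-(0.9025 * L)) / 3) := by
            rw [mul_div_assoc', mul_assoc, ← Real.exp_add, mul_div_cancel_left₀ _ (by norm_num)]
            ring_nf
          _ ≤ _ := by gcongr
      simp only [e]
      rw [e1, Real.exp_neg, inv_le_comm₀ (Real.exp_pos _) (by norm_num)]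
      refine le_trans ?_ (Real.add_one_le_exp _)
      norm_num at e2 ⊢
      linarith
    have hb8 : 10 ^ 8 ≤ b := by linarith
    have hb0 : 0 < b := by linarith
    -- `1.73` is just below `√3`; the product with `0.9405` is about `1.627`, against a loss of
    -- `1.53` per unit of `b * ρ`.
    have hs : 1.73 * b ≤ √((b + 1) ^ 3 - b ^ 3) := by
      refine Real.le_sqrt_of_sq_le ?_
      nlinarith
    have ht : 0.9405 * ρ - 2 ≤ (0.95 * ρ - 1) * (1 - e) - 1 := by
      have := mul_le_mul_of_nonneg_left he (by linarith : 0 ≤ 0.95 * ρ - 1)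
      linarith
    have h1 : 1.73 * b * (0.9405 * ρ - 2) ≤
        √((b + 1) ^ 3 - b ^ 3) * ((0.95 * ρ - 1) * (1 - e) - 1) :=
      mul_le_mul hs ht (by linarith) (Real.sqrt_nonneg _)
    refine le_trans ?_ h1
    -- The diagonal cost is lower order: `r ≤ 2e-4 * ρ` is where the smallness of the sparsity
    -- exponent enters.
    have h2 : k * r ≤ (2 * b + 2) * (2e-4 * ρ) :=
      mul_le_mul (by linarith) hrρ (by linarith) (by linarith)
    have h3 : (k : ℝ) * ρ ≤ (2 * b + 2) * ρ := mul_le_mul_of_nonneg_right (by linarith) (by linarith)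
    have h4 : 10 ^ 8 * ρ ≤ b * ρ := mul_le_mul_of_nonneg_right hb8 (by linarith)
    have h5 : b * 40000 ≤ b * ρ := mul_le_mul_of_nonneg_left hρ hb0.le
    norm_num at h2 ⊢
    linarith
  · have : 3 * (k : ℝ) ≤ n := by linarith
    exact_mod_cast this

/-- The lower bound on the potential. -/
theorem le_tensorFP_sub_of_large (hL : 10 ^ 9 ≤ Real.log n) (hLk : Real.log n ≤ k)
    (hkL : Real.log k ≤ 2e-8 * Real.log n) (hlam : 0 ≤ lam) {q : ℝ} (hq : 1 ≤ q) :
    ((-lam ^ 2 * q - 306 * k * Real.log (n / k) + 100 * lam * k * q ^ (1 / 3 : ℝ) : ℝ) : EReal) ≤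
      (tensorFP n k lam q : EReal) - (tensorFP n k lam 0 : EReal) := by
  obtain ⟨hp, hkn⟩ := eliminationBounds_of_large hL hLk hkL
  have hk9 : (10 ^ 9 : ℝ) ≤ k := hL.trans hLk
  have hk0 : (0 : ℝ) < k := by linarith
  have hk : 0 < k := by exact_mod_cast hk0
  have hn0 : (0 : ℝ) < n := by exact_mod_cast (by omega : 0 < n)
  set j : ℝ := q ^ (1 / 3 : ℝ)
  have hj : 1 ≤ j := Real.one_le_rpow hq (by norm_num)
  have hjq : j ^ 3 = q := by
    rw [← Real.rpow_natCast, ← Real.rpow_mul (by linarith)]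
    norm_num
  have hlog : 1 ≤ Real.log (n / k) := by
    rw [Real.log_div hn0.ne' hk0.ne']
    norm_num at hkL
    linarith
  have hklog : (k : ℝ) ≤ k * Real.log (n / k) := le_mul_of_one_le_right hk0.le hlog
  -- Zero amplitude is separate because the energy bound uses `lam⁻¹`; only the prior matters there.
  rcases hlam.eq_or_lt with rfl | hlam
  · have h := le_tensorFP_zero_sub hk hkn j
    rw [hjq] at h
    refine le_trans (EReal.coe_le_coe_iff.2 ?_) h
    simp only [zero_pow two_ne_zero, mul_zero, zero_mul, neg_zero]
    nlinarith
  · have h := le_tensorFP_sub_of_bounds hp (by positivity) hkn hlam j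
    rw [hjq] at h
    refine le_trans (EReal.coe_le_coe_iff.2 ?_) h
    have hρ : 40000 ≤ √(2 * Real.log n) := Real.le_sqrt_of_sq_le (by linarith)
    have h1 : 0 ≤ lam * k := by positivity
    -- `0.01 * ρ ≥ 400` absorbs the error `300 * lam * k`, as `j ≥ 1`, and leaves `100 * lam * k *
    -- j`.
    have h2 : lam * k * (400 * j) ≤ lam * (0.01 * k * √(2 * Real.log n)) * j := by
      have h3 : lam * k * j * 400 ≤ lam * k * j * (0.01 * √(2 * Real.log n)) :=
        mul_le_mul_of_nonneg_left (by linarith) (by positivity)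
      linarith
    have h4 : lam * k ≤ lam * k * j := le_mul_of_one_le_right h1 hj
    linarith

/-! ### Asymptotics along sequences and low-degree recovery -/

section Sequences

variable {β : ℝ} {k : ℕ → ℕ}

theorem tendsto_log_natCast : Tendsto (fun n : ℕ => Real.log n) atTop atTop :=
  Real.tendsto_log_atTop.comp tendsto_natCast_atTop_atTop

/-- A sequence `k = n ^ (β + o(1))` is sandwiched between powers of `n`. -/
theorem eventually_log_sparsity_bounds (hβ : 0 < β) {β₀ : ℝ} (hβ₀ : β < β₀)
    (hk : Tendsto (fun n : ℕ => Real.log (k n) / Real.log n) atTop (𝓝 β)) :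
    ∀ᶠ n : ℕ in atTop, 10 ^ 9 ≤ Real.log n ∧ β / 2 * Real.log n ≤ Real.log (k n) ∧
      Real.log (k n) ≤ β₀ * Real.log n := by
  filter_upwards [tendsto_log_natCast.eventually_ge_atTop (10 ^ 9),
    hk.eventually (eventually_gt_nhds (half_lt_self hβ)),
    hk.eventually (eventually_lt_nhds hβ₀)] with n h1 h2 h3
  have hL : 0 < Real.log n := by linarith
  rw [lt_div_iff₀ hL] at h2
  rw [div_lt_iff₀ hL] at h3
  exact ⟨h1, h2.le, h3.le⟩

/-- Powers of the logarithm are below powers of `k`. -/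
theorem eventually_log_rpow_le_sparsity (hβ : 0 < β)
    (hk : Tendsto (fun n : ℕ => Real.log (k n) / Real.log n) atTop (𝓝 β)) (d : ℝ) {s : ℝ}
    (hs : 0 < s) : ∀ᶠ n : ℕ in atTop, Real.log n ^ d ≤ (k n : ℝ) ^ s := by
  have h := (isLittleO_log_rpow_rpow_atTop d (by positivity : 0 < β / 2 * s)).bound one_pos
  filter_upwards [eventually_log_sparsity_bounds hβ (lt_add_one β) hk,
    tendsto_natCast_atTop_atTop.eventually h] with n ⟨h1, h2, _⟩ h3
  have hL : 0 < Real.log n := by linarith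
  have hn0 : (0 : ℝ) < n := by
    rcases Nat.eq_zero_or_pos n with h | h
    · rw [h, Nat.cast_zero, Real.log_zero] at hL; exact absurd hL (lt_irrefl _)
    · exact_mod_cast h
  have hlk : 0 < Real.log (k n) := lt_of_lt_of_le (by positivity) h2
  have hk0 : (0 : ℝ) < k n := by
    rcases Nat.eq_zero_or_pos (k n) with h | h
    · rw [h, Nat.cast_zero, Real.log_zero] at hlk; exact absurd hlk (lt_irrefl _)
    · exact_mod_cast h
  rw [Real.norm_of_nonneg (by positivity), Real.norm_of_nonneg (by positivity), one_mul] at h3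
  refine h3.trans ?_
  rw [Real.rpow_def_of_pos hn0, Real.rpow_def_of_pos hk0, Real.exp_le_exp]
  nlinarith

/-- A sequence `lam = k ^ (ε + o(1))` is sandwiched between powers of `k`. -/
theorem eventually_amplitude_bounds (hβ : 0 < β)
    (hk : Tendsto (fun n : ℕ => Real.log (k n) / Real.log n) atTop (𝓝 β)) {lam : ℕ → ℝ}
    (hlam : ∀ n, 0 < lam n) {ε a b : ℝ} (ha : a < ε) (hb : ε < b)
    (hε : Tendsto (fun n : ℕ => Real.log (lam n) / Real.log (k n)) atTop (𝓝 ε)) :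
    ∀ᶠ n : ℕ in atTop, (k n : ℝ) ^ a ≤ lam n ∧ lam n ≤ (k n : ℝ) ^ b := by
  filter_upwards [eventually_log_sparsity_bounds hβ (lt_add_one β) hk,
    hε.eventually (eventually_gt_nhds ha), hε.eventually (eventually_lt_nhds hb)]
    with n ⟨h1, h2, _⟩ h3 h4
  have hL : 0 < Real.log n := by linarith
  have hlk : 0 < Real.log (k n) := lt_of_lt_of_le (by positivity) h2
  have hk0 : (0 : ℝ) < k n := by
    rcases Nat.eq_zero_or_pos (k n) with h | h
    · rw [h, Nat.cast_zero, Real.log_zero] at hlk; exact absurd hlk (lt_irrefl _)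
    · exact_mod_cast h
  rw [lt_div_iff₀ hlk] at h3
  rw [div_lt_iff₀ hlk] at h4
  rw [Real.rpow_def_of_pos hk0, Real.rpow_def_of_pos hk0, ← Real.le_log_iff_exp_le (hlam n),
    ← Real.log_le_iff_le_exp (hlam n)]
  constructor <;> linarith

/-- Low-degree polynomials recover the signal when the amplitude is polynomially large. -/
theorem tendsto_lowDegreeMMSE_div (hβ : 0 < β) (hβ1 : β < 1 / 2)
    (hk : Tendsto (fun n : ℕ => Real.log (k n) / Real.log n) atTop (𝓝 β)) {lam : ℕ → ℝ}
    {η : ℝ} (hη : 0 < η) (hlam : ∀ᶠ n : ℕ in atTop, (n : ℝ) ^ η ≤ lam n) {D : ℕ → ℕ}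
    (hD : (fun n : ℕ => (D n : ℝ)) =Θ[atTop] fun n : ℕ => Real.log n) :
    Tendsto (fun n : ℕ => lowDegreeMMSE (truncSparseTensorPrior n (k n)) (lam n ^ 2) (D n) /
      trivialMMSE (truncSparseTensorPrior n (k n))) atTop (𝓝 0) := by
  -- The degree only has to satisfy `2 * η * d > 3`, so that `lam ^ (2 * d)` exceeds `n ^ 3`. It is
  -- constant, hence eventually below `D n`, and its noise moment does not depend on `n`.
  obtain ⟨m, hm⟩ := exists_nat_gt (3 / η)
  set d := 2 * m + 1
  have hd : Odd d := ⟨m, rfl⟩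
  have hηd : 0 < 2 * (η * d) - 3 := by
    rw [div_lt_iff₀ hη] at hm
    have : (d : ℝ) = 2 * m + 1 := by simp [d]
    rw [this]
    nlinarith
  have hDd : ∀ᶠ n in atTop, d ≤ D n := by
    have h1 : Tendsto (fun n => ‖(D n : ℝ)‖) atTop atTop := by
      have h2 : Tendsto (fun n : ℕ => ‖Real.log n‖) atTop atTop :=
        tendsto_norm_atTop_atTop.comp tendsto_log_natCast
      exact hD.tendsto_norm_atTop_iff.2 h2
    filter_upwards [h1.eventually_ge_atTop (d : ℝ)] with n hn
    simpa using hn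
  -- The constants are `128 = 2 ^ 3 * 16` and `16`, from dividing by `k ^ 3 / 16`.
  let u : ℕ → ℝ := fun n => 128 * (n : ℝ) ^ (-(2 * η)) + 16 * (n : ℝ) ^ (-(2 * (η * d) - 3))
  have hu : Tendsto u atTop (𝓝 0) := by
    have h1 := ((tendsto_rpow_neg_atTop (by positivity : 0 < 2 * η)).comp
      tendsto_natCast_atTop_atTop).const_mul 128
    have h2 := ((tendsto_rpow_neg_atTop hηd).comp
      tendsto_natCast_atTop_atTop).const_mul 16
    simpa [u, Function.comp_def] using h1.add h2
  have hbound : Tendsto (fun n => ENNReal.ofReal (u n) * powerMoment d) atTop (𝓝 0) := by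
    have h1 := ENNReal.Tendsto.mul_const (b := powerMoment d) (ENNReal.tendsto_ofReal hu)
      (Or.inr (powerMoment_ne_top d))
    simpa using h1
  refine tendsto_of_tendsto_of_tendsto_of_le_of_le' tendsto_const_nhds hbound
    (Eventually.of_forall fun _ => zero_le) ?_
  filter_upwards [eventually_log_sparsity_bounds hβ hβ1 hk,
    eventually_log_rpow_le_sparsity hβ hk 1 one_pos, hlam, hDd] with n ⟨h1, _, h3⟩ h4 h5 h6
  rw [Real.rpow_one, Real.rpow_one] at h4
  have hk9 : (10 ^ 9 : ℝ) ≤ k n := h1.trans h4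
  have hk0 : (0 : ℝ) < k n := by linarith
  have hL : 0 < Real.log n := by linarith
  have hn0 : (0 : ℝ) < n := by
    rcases Nat.eq_zero_or_pos n with h | h
    · rw [h, Nat.cast_zero, Real.log_zero] at hL; exact absurd hL (lt_irrefl _)
    · exact_mod_cast h
  have hn1 : (1 : ℝ) ≤ n := by exact_mod_cast (by exact_mod_cast hn0 : 0 < n)
  have hkn : k n ≤ n := by
    have : (k n : ℝ) ≤ n := by
      rw [← Real.log_le_log_iff hk0 hn0]; linarith
    exact_mod_cast this
  have hk20 : 20 ≤ k n := by exact_mod_cast (by linarith : (20 : ℝ) ≤ k n)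
  have hlam1 : 1 ≤ lam n := (Real.one_le_rpow hn1 hη.le).trans h5
  have hlam0 : 0 < lam n := by linarith
  have htriv := le_trivialMMSE hk20 hkn
  have hlow := lowDegreeMMSE_le hd h6 hkn hlam1
  have hc : (0 : ℝ) < (k n : ℝ) ^ 3 / 16 := by positivity
  have hinv : ∀ e : ℕ, ((lam n)⁻¹) ^ e ≤ (n : ℝ) ^ (-(η * e)) := fun e => by
    rw [Real.rpow_neg hn0.le, inv_pow, Real.rpow_mul hn0.le, Real.rpow_natCast]
    gcongr
  calc _ ≤ ENNReal.ofReal ((2 * k n) ^ 3 * ((lam n)⁻¹) ^ 2 + (n : ℝ) ^ 3 * ((lam n)⁻¹) ^ (2 * d)) *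
        powerMoment d / ENNReal.ofReal ((k n : ℝ) ^ 3 / 16) := ENNReal.div_le_div hlow htriv
    _ = ENNReal.ofReal (((2 * k n) ^ 3 * ((lam n)⁻¹) ^ 2 + (n : ℝ) ^ 3 * ((lam n)⁻¹) ^ (2 * d)) /
        ((k n : ℝ) ^ 3 / 16)) * powerMoment d := by
      rw [ENNReal.ofReal_div_of_pos hc, ENNReal.mul_div_right_comm]
    _ ≤ _ := by
      refine mul_le_mul_left (ENNReal.ofReal_le_ofReal ?_) _
      rw [div_le_iff₀ hc]
      have e1 : ((lam n)⁻¹) ^ 2 ≤ (n : ℝ) ^ (-(2 * η)) := by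
        have := hinv 2
        rwa [mul_comm η, Nat.cast_ofNat] at this
      have e2 : (n : ℝ) ^ 3 * ((lam n)⁻¹) ^ (2 * d) ≤ (n : ℝ) ^ (-(2 * (η * d) - 3)) := by
        calc (n : ℝ) ^ 3 * ((lam n)⁻¹) ^ (2 * d)
            ≤ (n : ℝ) ^ (3 : ℝ) * (n : ℝ) ^ (-(η * (2 * d : ℕ))) := by
              rw [← Real.rpow_natCast (n : ℝ) 3]
              have := hinv (2 * d)
              push_cast at this ⊢
              gcongr
          _ = _ := by
              rw [← Real.rpow_add hn0]
              congr 1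
              push_cast
              ring
      have e3 : (1 : ℝ) ≤ (k n : ℝ) ^ 3 := one_le_pow₀ (by linarith)
      have p2 : 0 ≤ (n : ℝ) ^ (-(2 * (η * d) - 3)) := by positivity
      have e4 := le_mul_of_one_le_right p2 e3
      have e5 := mul_le_mul_of_nonneg_left e1 (by positivity : (0 : ℝ) ≤ (2 * k n) ^ 3)
      simp only [u]
      nlinarith

end Sequences

end Asymptotic

/-! ### Polylogarithmic overlaps at moderate amplitude -/

section Regime

variable {n k : ℕ} {lam : ℝ}

/-- The potential is large at overlaps above the cube of a logarithm, for moderate amplitudes. -/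
theorem rpow_le_tensorFP_sub (hL : 10 ^ 9 ≤ Real.log n) (hLk : Real.log n ≤ k)
    (hkL : Real.log k ≤ 2e-8 * Real.log n) {δ d : ℝ} (hδ : 0 ≤ δ) (hlamk : (k : ℝ) ^ δ ≤ lam)
    (hd : lam * Real.log n ^ d ≤ k) {q : ℝ} (hq : 306 * Real.log n ^ 3 ≤ q)
    (hqd : q ≤ Real.log n ^ d) :
    (((k : ℝ) ^ (1 + δ) : ℝ) : EReal) ≤
      (tensorFP n k lam q : EReal) - (tensorFP n k lam 0 : EReal) := by
  set L := Real.log n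
  have hk9 : (10 ^ 9 : ℝ) ≤ k := hL.trans hLk
  have hk0 : (0 : ℝ) < k := by linarith
  have hlam1 : 1 ≤ lam := (Real.one_le_rpow (by linarith) hδ).trans hlamk
  have hL0 : 0 < L := by linarith
  -- `6 ^ 3 = 216 ≤ 306`, so the linear gain is at least `600 * lam * k * L`, above the entropy `306
  -- * k * L` and the signal term `lam * k` with `lam * k` to spare.
  have hq216 : (6 * L) ^ 3 ≤ q := by
    refine le_trans ?_ hq
    have := pow_pos hL0 3
    rw [mul_pow]; linarith
  have hq1 : 1 ≤ q := le_trans (one_le_pow₀ (by linarith)) hq216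
  refine le_trans (EReal.coe_le_coe_iff.2 ?_)
    (le_tensorFP_sub_of_large hL hLk hkL (by linarith) hq1)
  have hj : 6 * L ≤ q ^ (1 / 3 : ℝ) := by
    calc 6 * L = ((6 * L) ^ 3) ^ (1 / 3 : ℝ) := by
          rw [← Real.rpow_natCast, ← Real.rpow_mul (by linarith)]; norm_num
      _ ≤ _ := Real.rpow_le_rpow (by positivity) hq216 (by norm_num)
  have hn0 : (0 : ℝ) < n := by
    rcases Nat.eq_zero_or_pos n with h | h
    · simp only [L, h, Nat.cast_zero, Real.log_zero] at hL0; exact absurd hL0 (lt_irrefl _)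
    · exact_mod_cast h
  have hlognk : Real.log (n / k) ≤ L := by
    rw [Real.log_div hn0.ne' hk0.ne']
    have : 0 ≤ Real.log k := Real.log_natCast_nonneg _
    linarith
  have h1 : (k : ℝ) ^ (1 + δ) ≤ k * lam := by
    rw [Real.rpow_add hk0, Real.rpow_one]
    gcongr
  have h2 : lam ^ 2 * q ≤ lam * k := by
    calc lam ^ 2 * q ≤ lam ^ 2 * L ^ d := by gcongr
      _ = lam * (lam * L ^ d) := by ring
      _ ≤ _ := by gcongr
  have h3 : 100 * lam * k * (6 * L) ≤ 100 * lam * k * q ^ (1 / 3 : ℝ) := by gcongr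
  have h4 : 306 * k * Real.log (n / k) ≤ 306 * k * L := by gcongr
  have h5 : k * L ≤ lam * (k * L) := le_mul_of_one_le_left (by positivity) hlam1
  have h6 : lam * k * 1 ≤ lam * k * L := by gcongr; linarith
  have h7 : 0 ≤ lam * k := by positivity
  linarith

/-- The potential is not decreasing along the possible overlaps. -/
theorem not_antitoneOn_tensorFP (hL : 10 ^ 9 ≤ Real.log n) {d : ℝ}
    (hd : 512 * Real.log n ^ 3 ≤ Real.log n ^ d)
    (hpos : ∀ q : ℝ, 306 * Real.log n ^ 3 ≤ q → q ≤ Real.log n ^ d →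
      (0 : EReal) < (tensorFP n k lam q : EReal) - (tensorFP n k lam 0 : EReal)) :
    ¬ AntitoneOn (tensorFP n k lam)
      {q : ℝ | 0 ≤ q ∧ q ≤ Real.log n ^ d ∧ ∃ j : ℕ, q = (j : ℝ) ^ 3} := by
  intro hanti
  set L := Real.log n
  -- An integer between `7 * L` and `8 * L`: `7 ^ 3 = 343 ≥ 306` puts its cube in the range of the
  -- gap, and `8 ^ 3 = 512` keeps it below `L ^ d`.
  set j : ℕ := ⌈7 * L⌉₊
  have hj1 : 7 * L ≤ j := Nat.le_ceil _
  have hj2 : (j : ℝ) ≤ 8 * L := by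
    have := Nat.ceil_lt_add_one (by linarith : 0 ≤ 7 * L)
    linarith
  have hL3 : 0 < L ^ 3 := by positivity
  have hq1 : 306 * L ^ 3 ≤ (j : ℝ) ^ 3 := by
    have : (7 * L) ^ 3 ≤ (j : ℝ) ^ 3 := by gcongr
    rw [mul_pow] at this
    linarith
  have hq2 : (j : ℝ) ^ 3 ≤ L ^ d := by
    have : (j : ℝ) ^ 3 ≤ (8 * L) ^ 3 := by gcongr
    rw [mul_pow] at this
    linarith
  have h := hpos _ hq1 hq2
  have hle : tensorFP n k lam ((j : ℝ) ^ 3) ≤ tensorFP n k lam 0 :=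
    hanti ⟨le_rfl, by linarith, 0, by simp⟩ ⟨by positivity, hq2, j, rfl⟩ (by positivity)
  refine absurd h (not_lt.2 ?_)
  exact EReal.sub_nonpos.2 (EReal.coe_ennreal_le_coe_ennreal_iff.2 hle)

end Regime

theorem theoremA9 :
    ∃ c : ℝ, 0 < c ∧ ∃ C : ℝ, 0 < C ∧ ∃ β₀ : ℝ, 0 < β₀ ∧
      -- the lower bound, for all amplitudes and all overlaps
      (∀ β : ℝ, 0 < β → β < β₀ → ∀ k : ℕ → ℕ,
        Tendsto (fun n : ℕ => Real.log (k n) / Real.log n) atTop (𝓝 β) →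
        ∀ᶠ n : ℕ in atTop, ∀ lam : ℝ, 0 ≤ lam → ∀ q : ℝ, 1 ≤ q →
          ((-lam ^ 2 * q - C * k n * Real.log (n / k n)
              + c * lam * k n * q ^ (1 / 3 : ℝ) / Real.sqrt (Real.log n) : ℝ) : EReal)
            ≤ (tensorFP n (k n) lam q : EReal) - (tensorFP n (k n) lam 0 : EReal)) ∧
      -- the regime `lam = k ^ (ε + o(1))`
      (∀ ε : ℝ, 0 < ε → ε < 1 → ∃ δ : ℝ, 0 < δ ∧
        ∀ β : ℝ, 0 < β → β < β₀ → ∀ k : ℕ → ℕ,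
        Tendsto (fun n : ℕ => Real.log (k n) / Real.log n) atTop (𝓝 β) →
        ∀ lam : ℕ → ℝ, (∀ n, 0 < lam n) →
        Tendsto (fun n : ℕ => Real.log (lam n) / Real.log (k n)) atTop (𝓝 ε) →
          -- this regime is polynomially above the order-one algorithmic threshold
          (∃ η : ℝ, 0 < η ∧ ∀ᶠ n : ℕ in atTop, (n : ℝ) ^ η ≤ lam n) ∧
          -- and it is low-degree easy
          (∀ D : ℕ → ℕ, (fun n : ℕ => (D n : ℝ)) =Θ[atTop] (fun n : ℕ => Real.log n) →
            Tendsto (fun n : ℕ =>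
              lowDegreeMMSE (truncSparseTensorPrior n (k n)) (lam n ^ 2) (D n) /
                trivialMMSE (truncSparseTensorPrior n (k n))) atTop (𝓝 0)) ∧
          ∀ d : ℝ, 3 < d → ∀ᶠ n : ℕ in atTop,
            -- the potential is well above its value at `0`
            (∀ q : ℝ, C * Real.log n ^ 3 ≤ q → q ≤ Real.log n ^ d →
              (((k n : ℝ) ^ (1 + δ) : ℝ) : EReal)
                ≤ (tensorFP n (k n) (lam n) q : EReal)
                  - (tensorFP n (k n) (lam n) 0 : EReal)) ∧
            -- it is finite at the possible overlaps, which are cubes of integers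
            (∀ j : ℕ, (j : ℝ) ^ 3 ≤ Real.log n ^ d →
              tensorFP n (k n) (lam n) ((j : ℝ) ^ 3) ≠ ∞) ∧
            -- and it is not decreasing, even when restricted to possible overlaps
            ¬ AntitoneOn (tensorFP n (k n) (lam n))
              {q : ℝ | 0 ≤ q ∧ q ≤ Real.log n ^ d ∧ ∃ j : ℕ, q = (j : ℝ) ^ 3}) := by
  -- The bound obtained has gain `100` without the factor `1 / √(log n)`, so `c = 1` is far from
  -- tight. With `δ = ε / 2` the amplitude is eventually at least `k ^ δ`.
  refine ⟨1, one_pos, 306, by norm_num, 2e-8, by norm_num, fun β hβ hβ₀ k hk => ?_,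
    fun ε hε hε1 => ⟨ε / 2, half_pos hε, fun β hβ hβ₀ k hk lam hlam hlamk => ?_⟩⟩
  · filter_upwards [eventually_log_sparsity_bounds hβ hβ₀ hk,
      eventually_log_rpow_le_sparsity hβ hk 1 one_pos] with n ⟨h1, _, h3⟩ h4 l hl q hq
    rw [Real.rpow_one, Real.rpow_one] at h4
    refine le_trans (EReal.coe_le_coe_iff.2 ?_) (le_tensorFP_sub_of_large h1 h4 h3 hl hq)
    have hs : 1 ≤ √(Real.log n) := Real.le_sqrt_of_sq_le (by linarith)
    have hp : 0 ≤ l * k n * q ^ (1 / 3 : ℝ) := by positivity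
    have := div_le_self hp hs
    rw [one_mul]
    linarith
  · have hlow : ∃ η : ℝ, 0 < η ∧ ∀ᶠ n : ℕ in atTop, (n : ℝ) ^ η ≤ lam n := by
      refine ⟨β / 2 * (ε / 2), by positivity, ?_⟩
      filter_upwards [eventually_log_sparsity_bounds hβ hβ₀ hk,
        eventually_amplitude_bounds hβ hk hlam (half_lt_self hε) (lt_add_one ε) hlamk]
        with n ⟨h1, h2, _⟩ ⟨h4, _⟩
      refine le_trans ?_ h4
      have hn0 : (0 : ℝ) < n := by
        rcases Nat.eq_zero_or_pos n with h | h
        · rw [h, Nat.cast_zero, Real.log_zero] at h1; norm_num at h1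
        · exact_mod_cast h
      have hk0 : (0 : ℝ) < k n := by
        rcases Nat.eq_zero_or_pos (k n) with h | h
        · rw [h, Nat.cast_zero, Real.log_zero] at h2
          have : 0 < β / 2 * Real.log n := by
            have : 0 < Real.log n := by linarith
            positivity
          linarith
        · exact_mod_cast h
      rw [Real.rpow_def_of_pos hn0, Real.rpow_def_of_pos hk0, Real.exp_le_exp]
      nlinarith
    refine ⟨hlow, fun D hD => ?_, fun d hd => ?_⟩
    · obtain ⟨η, hη, hηlam⟩ := hlow
      exact tendsto_lowDegreeMMSE_div hβ (by norm_num at hβ₀ ⊢; linarith) hk hη hηlam hD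
    · filter_upwards [eventually_log_sparsity_bounds hβ hβ₀ hk,
        eventually_log_rpow_le_sparsity hβ hk 1 one_pos,
        eventually_amplitude_bounds hβ hk hlam (half_lt_self hε)
          (by linarith : ε < (1 + ε) / 2) hlamk,
        eventually_log_rpow_le_sparsity hβ hk d (by linarith : 0 < (1 - ε) / 2),
        ((tendsto_rpow_atTop (by linarith : 0 < d - 3)).comp
          tendsto_log_natCast).eventually_ge_atTop 512] with n ⟨h1, _, h3⟩ h4 ⟨h5, h6⟩ h7 h8
      rw [Real.rpow_one, Real.rpow_one] at h4
      have hL0 : 0 < Real.log n := by linarith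
      have hk9 : (10 ^ 9 : ℝ) ≤ k n := h1.trans h4
      have hk0 : (0 : ℝ) < k n := by linarith
      have hlam1 : 1 ≤ lam n := (Real.one_le_rpow (by linarith) (by linarith)).trans h5
      have hLd : 512 * Real.log n ^ 3 ≤ Real.log n ^ d := by
        have : Real.log n ^ d = Real.log n ^ (d - 3) * Real.log n ^ 3 := by
          rw [← Real.rpow_natCast, ← Real.rpow_add hL0]; norm_num
        rw [this]
        exact mul_le_mul_of_nonneg_right h8 (by positivity)
      have hlamd : lam n * Real.log n ^ d ≤ k n := by
        -- The exponent `1` is split at `(1 + ε) / 2 > ε`, leaving a positive power of `k` for the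
        -- logarithms; this is where `ε < 1` is used.
        calc lam n * Real.log n ^ d ≤ (k n : ℝ) ^ ((1 + ε) / 2) * (k n : ℝ) ^ ((1 - ε) / 2) := by
              gcongr
          _ = k n := by
              rw [← Real.rpow_add hk0, show (1 + ε) / 2 + (1 - ε) / 2 = 1 by ring, Real.rpow_one]
      have hkn := (eliminationBounds_of_large h1 h4 h3).2
      have hgap := fun q hq hqd => rpow_le_tensorFP_sub h1 h4 h3 (half_pos hε).le h5 hlamd
        (q := q) hq hqd
      refine ⟨hgap, fun j hj => ?_, not_antitoneOn_tensorFP h1 hLd fun q hq hqd =>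
        lt_of_lt_of_le ?_ (hgap q hq hqd)⟩
      · have hkN : 0 < k n := by exact_mod_cast hk0
        refine tensorFP_ne_top hkN (by omega) (hlam n).le fun v hv =>
          overlapShell_natCast_nonempty hkn hv ?_
        -- Then `j ≤ j ^ 3 ≤ (log n) ^ d ≤ k / 2`, so the overlap `j` is attainable with every
        -- signal.
        have h9 : (k n : ℝ) ^ ((1 - ε) / 2) ≤ (k n : ℝ) / 2 := by
          have h10 : (k n : ℝ) ^ ((1 - ε) / 2) ≤ (k n : ℝ) ^ (1 / 2 : ℝ) :=
            Real.rpow_le_rpow_of_exponent_le (by linarith) (by linarith)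
          rw [← Real.sqrt_eq_rpow] at h10
          refine h10.trans (Real.sqrt_le_iff.2 ⟨by linarith, ?_⟩)
          nlinarith
        have h11 : (j : ℝ) ≤ (j : ℝ) ^ 3 := by
          exact_mod_cast Nat.le_self_pow three_ne_zero j
        have h12 : 2 * (j : ℝ) ≤ k n := by linarith
        exact_mod_cast h12
      · exact_mod_cast Real.rpow_pos_of_pos hk0 _

end
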